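/- Let $k$ be a field and $A$ a $k$-algebra. A right bialgebroid $\mathcal R$ over $A$ (source $s_R\colon A\to\mathcal R$, target $t_R\colon A^{op}\to\mathcal R$, coproduct $\Delta X=X_{[1]}\otimes_A X_{[2]}$, counit $\varepsilon$) is an $A$-bimodule by $a\cdot X\cdot a'=X s_R(a')t_R(a)$; any right $\mathcal R$-module is an $A$-bimodule by $a\cdot m\cdot a'=m\blacktriangleleft s_R(a')t_R(a)$, and $\otimes_A$, right/left finitely generated projective (existence of a finite dual basis), the right dual $M^\vee=\mathrm{Hom}_{-A}(M,A)$ and the left dual ${}^\vee M=\mathrm{Hom}_{A-}(M,A)$ refer to these bimodule structures. A dual pairing between right bialgebroids $\Omega$ and $\mathcal R$ over $A$ is a $k$-linear map $(\cdot|\cdot)\colon\Omega\otimes\mathcal R\to A$ such that, for all $a,b,c,d,f\in A$, $\alpha,\beta\in\Omega$, $X,Y\in\mathcal R$, $$(s(a)t(b)\alpha s(c)t(d)|X)f=d(\alpha|s(c)t(a)Xs(f)t(b)),$$ $$(\alpha\beta|X)=(\beta|X_{[2]}t(\alpha|X_{[1]}))=(t(\alpha|X_{[1]})\beta|X_{[2]}),$$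 $$(\alpha|XY)=(\alpha_{[1]}|s(\alpha_{[2]}|X)Y)=(\alpha_{[1]}s(\alpha_{[2]}|X)|Y),\qquad (\alpha|1)=\varepsilon(\alpha),\quad (1|X)=\varepsilon(X).$$ One writes $\Omega=\mathcal R^\vee$ if $\alpha\mapsto(\alpha|\cdot)$ is a bijection $\Omega\to\mathcal R^\vee$, and $\mathcal R={}^\vee\Omega$ if $X\mapsto(\cdot|X)$ is a bijection $\mathcal R\to{}^\vee\Omega$. A right-right Yetter–Drinfeld module of $\mathcal R$ is a right $\mathcal R$-module and right $\mathcal R$-comodule (over the above $A$-bimodule structure) with $$(m\blacktriangleleft X_{[2]})_{[0]}\otimes_A X_{[1]}(m\blacktriangleleft X_{[2]})_{[1]}=m_{[0]}\blacktriangleleft X_{[1]}\otimes_A m_{[1]}X_{[2]},$$ and a left-right Yetter–Drinfeld module of $\Omega$ is a right $\Omega$-module and left $\Omega$-comodule with $$\alpha_{[2]}(m\blacktriangleleft \alpha_{[1]})_{[-1]}\otimes_A(m\blacktriangleleft \alpha_{[1]})_{[0]}=m_{[-1]}\alpha_{[1]}\otimes_A m_{[0]}\blacktriangleleft \alpha_{[2]};$$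 morphisms are the linear and colinear maps. **Theorem.** Let $\mathcal R$ be a right finitely generated projective right bialgebroid over $A$ and $\Omega$ a left finitely generated projective right bialgebroid over $A$, with a dual pairing by which $\Omega=\mathcal R^\vee$ or $\mathcal R={}^\vee\Omega$. Then: 1. The category $\mathcal C$ of right finitely generated projective right-right Yetter–Drinfeld modules of $\mathcal R$ is monoidal with tensor product $\otimes_A$, unit $A$, action $(\eta^1\otimes\eta^2)\blacktriangleleft X=\eta^1\blacktriangleleft X_{[1]}\otimes\eta^2\blacktriangleleft X_{[2]}$ and coaction $\eta^1\otimes\eta^2\mapsto\eta^1_{[0]}\otimes\eta^2_{[0]}\otimes\eta^1_{[1]}\eta^2_{[1]}$, and it is pre-braided by $\sigma(\eta^1\otimes\eta^2)=\eta^2_{[0]}\otimes\eta^1\blacktriangleleft\eta^2_{[1]}$. 2. The category $\mathcal D$ of left finitely generated projective left-right Yetter–Drinfeld modules of $\Omega$ is monoidal with tensor product $\otimes_A$, unit $A$, the diagonal action and coaction $f\otimes g\mapsto g_{[-1]}f_{[-1]}\otimes f_{[0]}\otimes g_{[0]}$, and it is pre-braided by $\tilde\sigma(f\otimes g)=g\blacktriangleleft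 f_{[-1]}\otimes f_{[0]}$. 3. For $\Lambda\in\mathcal C$, the right dual $\Lambda^\vee$, with evaluation pairing $(\cdot,\cdot)\colon\Lambda^\vee\otimes\Lambda\to A$, is an object of $\mathcal D$ with structure determined by $$(f\blacktriangleleft\alpha,\eta)=(\alpha|\eta_{[1]}t(f,\eta_{[0]})),\qquad (f,\eta\blacktriangleleft X)=(f_{[-1]}|s(f_{[0]},\eta)X),$$ and $\Lambda\mapsto\Lambda^\vee$ (precomposition on morphisms) is an equivalence of categories $\mathcal C^{op}\to\mathcal D$. It is (strong) anti-monoidal, with natural isomorphisms $$\psi\colon\Lambda^{2\vee}\otimes_A\Lambda^{1\vee}\to(\Lambda^1\otimes_A\Lambda^2)^\vee,\quad (\psi(f\otimes g),\eta^1\otimes\eta^2)=(f,\eta^2\blacktriangleleft t(g,\eta^1))=(f\blacktriangleleft s(g,\eta^1),\eta^2),$$ and $A\to A^\vee$, $a\mapsto(b\mapsto ab)$, and it is compatible with the pre-braidings: $\psi\circ\tilde\sigma=\sigma^\vee\circ\psi$, where $\sigma^\vee$ is precomposition with $\sigma$. In particular $\mathcal C$ and $\mathcal D$ are anti-monoidally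 (and contravariantly) equivalent as pre-braided monoidal categories. -/

import Mathlib

open CategoryTheory MonoidalCategory Opposite
open scoped RightActions

universe u

/-! ## Balanced tensor products over the base algebra -/

/-- An algebra `R` with commuting source map `s : A → R` and target map `t : Aᵒᵖ → R`. -/
structure SourceTarget (k A R : Type*) [Field k] [Ring A] [Algebra k A] [Ring R] [Algebra k R] where
  s : A →ₐ[k] R
  tOp : Aᵐᵒᵖ →ₐ[k] R
  commute : ∀ a b : A, s a * tOp (MulOpposite.op b) = tOp (MulOpposite.op b) * s a

namespace SourceTarget

variable {k A R : Type*} [Field k] [Ring A] [Algebra k A] [Ring R] [Algebra k R]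
  (E : SourceTarget k A R)

/-- The target map as an (anti-multiplicative) function on `A`. -/
def t (a : A) : R := E.tOp (MulOpposite.op a)

variable (M N P : Type*)
  [AddCommGroup M] [Module k M] [Module Rᵐᵒᵖ M] [IsScalarTower k Rᵐᵒᵖ M]
  [AddCommGroup N] [Module k N] [Module Rᵐᵒᵖ N] [IsScalarTower k Rᵐᵒᵖ N]
  [AddCommGroup P] [Module k P] [Module Rᵐᵒᵖ P] [IsScalarTower k Rᵐᵒᵖ P]

/-- Every right `R`-module `M` (for instance `R` itself) is an `A`-bimodule through
`a . m . a' = m ◁ (s a' * t a)`. These are the relations `(m . a) ⊗ n = m ⊗ (a . n)` that define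
the tensor product over `A` with respect to this bimodule structure. -/
def balSub : Submodule k (TensorProduct k M N) :=
  Submodule.span k {w | ∃ (m : M) (a : A) (n : N),
    w = TensorProduct.tmul k (m <• E.s a) n - TensorProduct.tmul k m (n <• E.t a)}

/-- The tensor product `M ⊗_A N`. -/
abbrev Bal : Type _ := TensorProduct k M N ⧸ E.balSub M N

variable {M N P} in
/-- The pure tensor `m ⊗_A n`. -/
def tmul (m : M) (n : N) : E.Bal M N := (E.balSub M N).mkQ (TensorProduct.tmul k m n)

/-- The relations that define `M ⊗_A N ⊗_A P`. -/
def balSub₃ : Submodule k (TensorProduct k (TensorProduct k M N) P) :=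
  Submodule.span k
    ({w | ∃ (m : M) (a : A) (n : N) (p : P),
        w = TensorProduct.tmul k (TensorProduct.tmul k (m <• E.s a) n) p
          - TensorProduct.tmul k (TensorProduct.tmul k m (n <• E.t a)) p} ∪
     {w | ∃ (m : M) (n : N) (a : A) (p : P),
        w = TensorProduct.tmul k (TensorProduct.tmul k m (n <• E.s a)) p
          - TensorProduct.tmul k (TensorProduct.tmul k m n) (p <• E.t a)})

/-- The tensor product `M ⊗_A N ⊗_A P`. -/
abbrev Bal₃ : Type _ := TensorProduct k (TensorProduct k M N) P ⧸ E.balSub₃ M N P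

variable {M N P}

/-- The map `(M ⊗_A N) × P → M ⊗_A N ⊗_A P`, `(m ⊗ n, p) ↦ m ⊗ n ⊗ p`. -/
noncomputable def tmulLeft : E.Bal M N →ₗ[k] P →ₗ[k] E.Bal₃ M N P :=
  (E.balSub M N).liftQ
    ((TensorProduct.mk k (TensorProduct k M N) P).compr₂ (E.balSub₃ M N P).mkQ) (by
      rw [balSub, Submodule.span_le]
      rintro _ ⟨m, a, n, rfl⟩
      refine LinearMap.ext fun p => ?_
      simp only [LinearMap.compr₂_apply, TensorProduct.mk_apply, LinearMap.zero_apply,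
        Submodule.mkQ_apply, TensorProduct.sub_tmul]
      exact (Submodule.Quotient.mk_eq_zero _).2 (Submodule.subset_span (Or.inl ⟨m, a, n, p, rfl⟩)))

/-- The map `M × (N ⊗_A P) → M ⊗_A N ⊗_A P`, `(m, n ⊗ p) ↦ m ⊗ n ⊗ p`. -/
noncomputable def tmulRight (m : M) : E.Bal N P →ₗ[k] E.Bal₃ M N P :=
  (E.balSub N P).liftQ
    ((E.balSub₃ M N P).mkQ ∘ₗ TensorProduct.map (TensorProduct.mk k M N m) LinearMap.id) (by
      rw [balSub, Submodule.span_le]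
      rintro _ ⟨n, a, p, rfl⟩
      simp only [SetLike.mem_coe, LinearMap.mem_ker, LinearMap.comp_apply, map_sub,
        TensorProduct.map_tmul, TensorProduct.mk_apply, LinearMap.id_apply]
      rw [← map_sub]
      exact (Submodule.Quotient.mk_eq_zero _).2 (Submodule.subset_span (Or.inr ⟨m, n, a, p, rfl⟩)))

/-- `φ : M → A` is right `A`-linear: `φ (m . a) = φ m * a`. The right `A`-linear maps form the
right dual `M^∨`. -/
def IsRightLinear (φ : M →ₗ[k] A) : Prop := ∀ (m : M) (a : A), φ (m <• E.s a) = φ m * a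

/-- `φ : M → A` is left `A`-linear: `φ (a . m) = a * φ m`. The left `A`-linear maps form the
left dual `^∨M`. -/
def IsLeftLinear (φ : M →ₗ[k] A) : Prop := ∀ (m : M) (a : A), φ (m <• E.t a) = a * φ m

variable (M)

/-- `M` is right finitely generated projective over `A`: it has a finite dual basis. -/
def RightFGP : Prop :=
  ∃ (n : ℕ) (x : Fin n → M) (φ : Fin n → M →ₗ[k] A),
    (∀ i, E.IsRightLinear (φ i)) ∧ ∀ m : M, m = ∑ i, x i <• E.s (φ i m)

/-- `M` is left finitely generated projective over `A`: it has a finite dual basis. -/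
def LeftFGP : Prop :=
  ∃ (n : ℕ) (x : Fin n → M) (φ : Fin n → M →ₗ[k] A),
    (∀ i, E.IsLeftLinear (φ i)) ∧ ∀ m : M, m = ∑ i, x i <• E.t (φ i m)

end SourceTarget

/-! ## Right bialgebroids, comodules

Sweedler sums: a formula in `X₁ ⊗ X₂ = Δ X` is stated for every finite family of pure tensors
`x i ⊗ y i` with sum `Δ X`; such a family always exists, as pure tensors span `R ⊗_A R`. The same
convention is used for coactions. -/

/-- A right bialgebroid over `A`. The `A`-bimodule structure on `R` is `c . X . b = X * s b * t c`. -/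
structure RightBialgebroid (k A R : Type*) [Field k] [Ring A] [Algebra k A] [Ring R] [Algebra k R]
    extends SourceTarget k A R where
  Δ : R →ₗ[k] toSourceTarget.Bal R R
  ε : R →ₗ[k] A
  /-- `Δ` is a map of `A`-bimodules. -/
  Δ_bimod : ∀ (X : R) (b c : A) (n : ℕ) (x y : Fin n → R),
    Δ X = ∑ i, toSourceTarget.tmul (x i) (y i) →
    Δ (X * s b * toSourceTarget.t c) =
      ∑ i, toSourceTarget.tmul (x i * toSourceTarget.t c) (y i * s b)
  /-- `ε` is a map of `A`-bimodules. -/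
  ε_bimod : ∀ (X : R) (b c : A), ε (X * s b * toSourceTarget.t c) = c * ε X * b
  coassoc : ∀ (X : R) (n : ℕ) (x y : Fin n → R),
    Δ X = ∑ i, toSourceTarget.tmul (x i) (y i) →
    ∑ i, toSourceTarget.tmulLeft (Δ (x i)) (y i) = ∑ i, toSourceTarget.tmulRight (x i) (Δ (y i))
  /-- `ε(X₁) . X₂ = X`. -/
  counit_left : ∀ (X : R) (n : ℕ) (x y : Fin n → R),
    Δ X = ∑ i, toSourceTarget.tmul (x i) (y i) →
    ∑ i, y i * toSourceTarget.t (ε (x i)) = X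
  /-- `X₁ . ε(X₂) = X`. -/
  counit_right : ∀ (X : R) (n : ℕ) (x y : Fin n → R),
    Δ X = ∑ i, toSourceTarget.tmul (x i) (y i) →
    ∑ i, x i * s (ε (y i)) = X
  /-- `Δ` takes values in the Takeuchi product. -/
  takeuchi : ∀ (X : R) (a : A) (n : ℕ) (x y : Fin n → R),
    Δ X = ∑ i, toSourceTarget.tmul (x i) (y i) →
    ∑ i, toSourceTarget.tmul (s a * x i) (y i) =
      ∑ i, toSourceTarget.tmul (x i) (toSourceTarget.t a * y i)
  Δ_one : Δ 1 = toSourceTarget.tmul 1 1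
  Δ_mul : ∀ (X Y : R) (n : ℕ) (x y : Fin n → R) (n' : ℕ) (x' y' : Fin n' → R),
    Δ X = ∑ i, toSourceTarget.tmul (x i) (y i) →
    Δ Y = ∑ j, toSourceTarget.tmul (x' j) (y' j) →
    Δ (X * Y) = ∑ i, ∑ j, toSourceTarget.tmul (x i * x' j) (y i * y' j)
  ε_one : ε 1 = 1
  ε_s : ∀ X Y : R, ε (s (ε X) * Y) = ε (X * Y)
  ε_t : ∀ X Y : R, ε (toSourceTarget.t (ε X) * Y) = ε (X * Y)

section Comodules

variable {k A R : Type*} [Field k] [Ring A] [Algebra k A] [Ring R] [Algebra k R]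
  (H : RightBialgebroid k A R) {M : Type*}
  [AddCommGroup M] [Module k M] [Module Rᵐᵒᵖ M] [IsScalarTower k Rᵐᵒᵖ M]

/-- `δ` is a right `R`-comodule structure on the `A`-bimodule underlying the right `R`-module `M`,
`a . m . a' = m ◁ (s a' * t a)`. -/
structure IsRightComodule (δ : M →ₗ[k] H.Bal M R) : Prop where
  /-- `δ (a . m . a') = m₀ ⊗ s a * m₁ * s a'`. -/
  bimod : ∀ (m : M) (a a' : A) (n : ℕ) (x : Fin n → M) (z : Fin n → R),
    δ m = ∑ i, H.tmul (x i) (z i) →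
    δ (m <• (H.s a' * H.t a)) = ∑ i, H.tmul (x i) (H.s a * z i * H.s a')
  /-- `δ` takes values in the Takeuchi product: `(a . m₀) ⊗ m₁ = m₀ ⊗ t a * m₁`. -/
  takeuchi : ∀ (m : M) (a : A) (n : ℕ) (x : Fin n → M) (z : Fin n → R),
    δ m = ∑ i, H.tmul (x i) (z i) →
    ∑ i, H.tmul (x i <• H.t a) (z i) = ∑ i, H.tmul (x i) (H.t a * z i)
  coassoc : ∀ (m : M) (n : ℕ) (x : Fin n → M) (z : Fin n → R),
    δ m = ∑ i, H.tmul (x i) (z i) →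
    ∑ i, H.tmulLeft (δ (x i)) (z i) = ∑ i, H.tmulRight (x i) (H.Δ (z i))
  /-- `m₀ . ε(m₁) = m`. -/
  counit : ∀ (m : M) (n : ℕ) (x : Fin n → M) (z : Fin n → R),
    δ m = ∑ i, H.tmul (x i) (z i) → ∑ i, x i <• H.s (H.ε (z i)) = m

/-- `δ` is a left `R`-comodule structure on the `A`-bimodule underlying the right `R`-module `M`,
`a . m . a' = m ◁ (s a' * t a)`. -/
structure IsLeftComodule (δ : M →ₗ[k] H.Bal R M) : Prop where
  /-- `δ (a . m . a') = t a' * m₋₁ * t a ⊗ m₀`. -/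
  bimod : ∀ (m : M) (a a' : A) (n : ℕ) (z : Fin n → R) (x : Fin n → M),
    δ m = ∑ i, H.tmul (z i) (x i) →
    δ (m <• (H.s a' * H.t a)) = ∑ i, H.tmul (H.t a' * z i * H.t a) (x i)
  /-- `δ` takes values in the Takeuchi product: `s a * m₋₁ ⊗ m₀ = m₋₁ ⊗ (m₀ . a)`. -/
  takeuchi : ∀ (m : M) (a : A) (n : ℕ) (z : Fin n → R) (x : Fin n → M),
    δ m = ∑ i, H.tmul (z i) (x i) →
    ∑ i, H.tmul (H.s a * z i) (x i) = ∑ i, H.tmul (z i) (x i <• H.s a)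
  coassoc : ∀ (m : M) (n : ℕ) (z : Fin n → R) (x : Fin n → M),
    δ m = ∑ i, H.tmul (z i) (x i) →
    ∑ i, H.tmulLeft (H.Δ (z i)) (x i) = ∑ i, H.tmulRight (z i) (δ (x i))
  /-- `ε(m₋₁) . m₀ = m`. -/
  counit : ∀ (m : M) (n : ℕ) (z : Fin n → R) (x : Fin n → M),
    δ m = ∑ i, H.tmul (z i) (x i) → ∑ i, x i <• H.t (H.ε (z i)) = m

end Comodules

/-! ## Right-right Yetter-Drinfeld modules -/

section RR

variable {k : Type*} {A : Type u} {R : Type*} [Field k] [Ring A] [Algebra k A] [Ring R] [Algebra k R]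

/-- A right-right Yetter-Drinfeld module. The `A`-bimodule underlying the comodule is the one given
by the module structure: `m . a = m ◁ s a` and `a . m = m ◁ t a`. -/
structure YDRR (H : RightBialgebroid k A R) where
  carrier : Type u
  [addCommGroup : AddCommGroup carrier]
  [module : Module k carrier]
  [rightModule : Module Rᵐᵒᵖ carrier]
  [tower : IsScalarTower k Rᵐᵒᵖ carrier]
  δ : carrier →ₗ[k] H.Bal carrier R
  comodule : IsRightComodule H δ
  /-- `(m ◁ X₂)₀ ⊗ X₁ * (m ◁ X₂)₁ = m₀ ◁ X₁ ⊗ m₁ * X₂`; the `j`-th family below represents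
  `δ (m ◁ y j)`. -/
  yd : ∀ (m : carrier) (X : R) (n : ℕ) (x y : Fin n → R) (p : ℕ) (m₀ : Fin p → carrier)
    (m₁ : Fin p → R) (q : Fin n → ℕ) (l : ∀ j, Fin (q j) → carrier) (z : ∀ j, Fin (q j) → R),
    H.Δ X = ∑ j, H.tmul (x j) (y j) →
    δ m = ∑ i, H.tmul (m₀ i) (m₁ i) →
    (∀ j, δ (m <• y j) = ∑ i, H.tmul (l j i) (z j i)) →
    ∑ j, ∑ i, H.tmul (l j i) (x j * z j i) = ∑ j, ∑ i, H.tmul (m₀ i <• x j) (m₁ i * y j)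

attribute [instance] YDRR.addCommGroup YDRR.module YDRR.rightModule YDRR.tower

namespace YDRR

variable {H : RightBialgebroid k A R}

/-- Morphisms are right `R`-linear and right `R`-colinear maps. -/
@[ext]
structure Hom (M N : YDRR H) where
  toLin : M.carrier →ₗ[Rᵐᵒᵖ] N.carrier
  colinear : ∀ (m : M.carrier) (n : ℕ) (x : Fin n → M.carrier) (z : Fin n → R),
    M.δ m = ∑ i, H.tmul (x i) (z i) → N.δ (toLin m) = ∑ i, H.tmul (toLin (x i)) (z i)

instance : Category (YDRR H) where
  Hom M N := Hom M N
  id M := ⟨LinearMap.id, fun _ _ _ _ h => h⟩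
  comp f g := ⟨g.toLin ∘ₗ f.toLin, fun m n x z h =>
    g.colinear (f.toLin m) n (fun i => f.toLin (x i)) z (f.colinear m n x z h)⟩

end YDRR

/-- The category of right finitely generated projective right-right Yetter-Drinfeld modules. -/
abbrev RRFGP (H : RightBialgebroid k A R) : Type _ :=
  ObjectProperty.FullSubcategory (fun M : YDRR H => H.RightFGP M.carrier)

namespace RRFGP

variable {H : RightBialgebroid k A R}

/-- The underlying type. -/
abbrev El (M : RRFGP H) : Type u := M.obj.carrier

/-- The underlying map of a morphism. -/
def app {M N : RRFGP H} (f : M ⟶ N) : M.El →ₗ[Rᵐᵒᵖ] N.El := YDRR.Hom.toLin f.hom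

end RRFGP

/-- The monoidal structure on right-right Yetter-Drinfeld modules is the one whose tensor product is
`⊗_A` with the diagonal action and coaction, and whose unit is `A`. The data are the identifications
`tens M N` of `M ⊗_A N` and `unit` of `A` with the underlying spaces of `M ⊗ N` and `𝟙_`. -/
structure RRDiagonal (H : RightBialgebroid k A R) [MonoidalCategory (RRFGP H)] where
  tens (M N : RRFGP H) : H.Bal M.El N.El ≃ₗ[k] (M ⊗ N : RRFGP H).El
  unit : A ≃ₗ[k] (𝟙_ (RRFGP H)).El
  /-- `(m ⊗ m') ◁ X = m ◁ X₁ ⊗ m' ◁ X₂`. -/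
  tens_act : ∀ (M N : RRFGP H) (m : M.El) (m' : N.El) (X : R) (n : ℕ) (x y : Fin n → R),
    H.Δ X = ∑ i, H.tmul (x i) (y i) →
    tens M N (H.tmul m m') <• X = ∑ i, tens M N (H.tmul (m <• x i) (m' <• y i))
  /-- `δ (m ⊗ m') = (m₀ ⊗ m'₀) ⊗ m₁ * m'₁`. -/
  tens_coact : ∀ (M N : RRFGP H) (m : M.El) (m' : N.El) (n : ℕ) (x : Fin n → M.El)
    (z : Fin n → R) (n' : ℕ) (x' : Fin n' → N.El) (z' : Fin n' → R),
    M.obj.δ m = ∑ i, H.tmul (x i) (z i) → N.obj.δ m' = ∑ j, H.tmul (x' j) (z' j) →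
    (M ⊗ N : RRFGP H).obj.δ (tens M N (H.tmul m m')) =
      ∑ i, ∑ j, H.tmul (tens M N (H.tmul (x i) (x' j))) (z i * z' j)
  /-- `a ◁ X = ε (s a * X)`. -/
  unit_act : ∀ (a : A) (X : R), unit a <• X = unit (H.ε (H.s a * X))
  /-- `δ a = 1 ⊗ s a`. -/
  unit_coact : ∀ a : A, (𝟙_ (RRFGP H)).obj.δ (unit a) = H.tmul (unit 1) (H.s a)
  hom_tens : ∀ {M M' N N' : RRFGP H} (f : M ⟶ M') (g : N ⟶ N') (m : M.El) (m' : N.El),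
    RRFGP.app (f ⊗ₘ g) (tens M N (H.tmul m m')) =
      tens M' N' (H.tmul (RRFGP.app f m) (RRFGP.app g m'))
  assoc : ∀ (M N P : RRFGP H) (m : M.El) (m' : N.El) (m'' : P.El),
    RRFGP.app (α_ M N P).hom (tens (M ⊗ N) P (H.tmul (tens M N (H.tmul m m')) m'')) =
      tens M (N ⊗ P) (H.tmul m (tens N P (H.tmul m' m'')))
  /-- `a ⊗ m ↦ a . m`. -/
  left_unit : ∀ (M : RRFGP H) (a : A) (m : M.El),
    RRFGP.app (λ_ M).hom (tens (𝟙_ _) M (H.tmul (unit a) m)) = m <• H.t a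
  /-- `m ⊗ a ↦ m . a`. -/
  right_unit : ∀ (M : RRFGP H) (a : A) (m : M.El),
    RRFGP.app (ρ_ M).hom (tens M (𝟙_ _) (H.tmul m (unit a))) = m <• H.s a

end RR

/-! ## Left-right Yetter-Drinfeld modules -/

section LR

variable {k : Type*} {A : Type u} {R : Type*} [Field k] [Ring A] [Algebra k A] [Ring R] [Algebra k R]

/-- A left-right Yetter-Drinfeld module (left coaction, right action). The `A`-bimodule underlying
the comodule is the one given by the module structure: `m . a = m ◁ s a` and `a . m = m ◁ t a`. -/
structure YDLR (H : RightBialgebroid k A R) where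
  carrier : Type u
  [addCommGroup : AddCommGroup carrier]
  [module : Module k carrier]
  [rightModule : Module Rᵐᵒᵖ carrier]
  [tower : IsScalarTower k Rᵐᵒᵖ carrier]
  δ : carrier →ₗ[k] H.Bal R carrier
  comodule : IsLeftComodule H δ
  /-- `X₂ * (m ◁ X₁)₋₁ ⊗ (m ◁ X₁)₀ = m₋₁ * X₁ ⊗ m₀ ◁ X₂`; the `j`-th family below represents
  `δ (m ◁ x j)`. -/
  yd : ∀ (m : carrier) (X : R) (n : ℕ) (x y : Fin n → R) (p : ℕ) (m₁ : Fin p → R)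
    (m₀ : Fin p → carrier) (q : Fin n → ℕ) (z : ∀ j, Fin (q j) → R) (l : ∀ j, Fin (q j) → carrier),
    H.Δ X = ∑ j, H.tmul (x j) (y j) →
    δ m = ∑ i, H.tmul (m₁ i) (m₀ i) →
    (∀ j, δ (m <• x j) = ∑ i, H.tmul (z j i) (l j i)) →
    ∑ j, ∑ i, H.tmul (y j * z j i) (l j i) = ∑ j, ∑ i, H.tmul (m₁ i * x j) (m₀ i <• y j)

attribute [instance] YDLR.addCommGroup YDLR.module YDLR.rightModule YDLR.tower

namespace YDLR

variable {H : RightBialgebroid k A R}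

/-- Morphisms are right `R`-linear and left `R`-colinear maps. -/
@[ext]
structure Hom (M N : YDLR H) where
  toLin : M.carrier →ₗ[Rᵐᵒᵖ] N.carrier
  colinear : ∀ (m : M.carrier) (n : ℕ) (z : Fin n → R) (x : Fin n → M.carrier),
    M.δ m = ∑ i, H.tmul (z i) (x i) → N.δ (toLin m) = ∑ i, H.tmul (z i) (toLin (x i))

instance : Category (YDLR H) where
  Hom M N := Hom M N
  id M := ⟨LinearMap.id, fun _ _ _ _ h => h⟩
  comp f g := ⟨g.toLin ∘ₗ f.toLin, fun m n z x h =>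
    g.colinear (f.toLin m) n z (fun i => f.toLin (x i)) (f.colinear m n z x h)⟩

end YDLR

/-- The category of left finitely generated projective left-right Yetter-Drinfeld modules. -/
abbrev LRFGP (H : RightBialgebroid k A R) : Type _ :=
  ObjectProperty.FullSubcategory (fun M : YDLR H => H.LeftFGP M.carrier)

namespace LRFGP

variable {H : RightBialgebroid k A R}

/-- The underlying type. -/
abbrev El (M : LRFGP H) : Type u := M.obj.carrier

/-- The underlying map of a morphism. -/
def app {M N : LRFGP H} (f : M ⟶ N) : M.El →ₗ[Rᵐᵒᵖ] N.El := YDLR.Hom.toLin f.hom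

end LRFGP

/-- The monoidal structure on left-right Yetter-Drinfeld modules is the one whose tensor product is
`⊗_A` with the diagonal action and coaction, and whose unit is `A`. The data are the identifications
`tens M N` of `M ⊗_A N` and `unit` of `A` with the underlying spaces of `M ⊗ N` and `𝟙_`. -/
structure LRDiagonal (H : RightBialgebroid k A R) [MonoidalCategory (LRFGP H)] where
  tens (M N : LRFGP H) : H.Bal M.El N.El ≃ₗ[k] (M ⊗ N : LRFGP H).El
  unit : A ≃ₗ[k] (𝟙_ (LRFGP H)).El
  /-- `(m ⊗ m') ◁ X = m ◁ X₁ ⊗ m' ◁ X₂`. -/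
  tens_act : ∀ (M N : LRFGP H) (m : M.El) (m' : N.El) (X : R) (n : ℕ) (x y : Fin n → R),
    H.Δ X = ∑ i, H.tmul (x i) (y i) →
    tens M N (H.tmul m m') <• X = ∑ i, tens M N (H.tmul (m <• x i) (m' <• y i))
  /-- `δ (m ⊗ m') = m'₋₁ * m₋₁ ⊗ (m₀ ⊗ m'₀)`. -/
  tens_coact : ∀ (M N : LRFGP H) (m : M.El) (m' : N.El) (n : ℕ) (z : Fin n → R)
    (x : Fin n → M.El) (n' : ℕ) (z' : Fin n' → R) (x' : Fin n' → N.El),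
    M.obj.δ m = ∑ i, H.tmul (z i) (x i) → N.obj.δ m' = ∑ j, H.tmul (z' j) (x' j) →
    (M ⊗ N : LRFGP H).obj.δ (tens M N (H.tmul m m')) =
      ∑ i, ∑ j, H.tmul (z' j * z i) (tens M N (H.tmul (x i) (x' j)))
  /-- `a ◁ X = ε (s a * X)`. -/
  unit_act : ∀ (a : A) (X : R), unit a <• X = unit (H.ε (H.s a * X))
  /-- `δ a = t a ⊗ 1`. -/
  unit_coact : ∀ a : A, (𝟙_ (LRFGP H)).obj.δ (unit a) = H.tmul (H.t a) (unit 1)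
  hom_tens : ∀ {M M' N N' : LRFGP H} (f : M ⟶ M') (g : N ⟶ N') (m : M.El) (m' : N.El),
    LRFGP.app (f ⊗ₘ g) (tens M N (H.tmul m m')) =
      tens M' N' (H.tmul (LRFGP.app f m) (LRFGP.app g m'))
  assoc : ∀ (M N P : LRFGP H) (m : M.El) (m' : N.El) (m'' : P.El),
    LRFGP.app (α_ M N P).hom (tens (M ⊗ N) P (H.tmul (tens M N (H.tmul m m')) m'')) =
      tens M (N ⊗ P) (H.tmul m (tens N P (H.tmul m' m'')))
  /-- `a ⊗ m ↦ a . m`. -/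
  left_unit : ∀ (M : LRFGP H) (a : A) (m : M.El),
    LRFGP.app (λ_ M).hom (tens (𝟙_ _) M (H.tmul (unit a) m)) = m <• H.t a
  /-- `m ⊗ a ↦ m . a`. -/
  right_unit : ∀ (M : LRFGP H) (a : A) (m : M.El),
    LRFGP.app (ρ_ M).hom (tens M (𝟙_ _) (H.tmul m (unit a))) = m <• H.s a

end LR

/-! ## Pre-braidings and contravariant anti-monoidal functors -/

/-- A pre-braiding: a braiding that need not be invertible (and therefore satisfies the unit axioms
by requirement). -/
structure PreBraiding (C : Type*) [Category C] [MonoidalCategory C] where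
  braid (X Y : C) : X ⊗ Y ⟶ Y ⊗ X
  naturality : ∀ {X X' Y Y' : C} (f : X ⟶ X') (g : Y ⟶ Y'),
    (f ⊗ₘ g) ≫ braid X' Y' = braid X Y ≫ (g ⊗ₘ f)
  hexagon_forward : ∀ X Y Z : C,
    (α_ X Y Z).hom ≫ braid X (Y ⊗ Z) ≫ (α_ Y Z X).hom =
      (braid X Y ▷ Z) ≫ (α_ Y X Z).hom ≫ (Y ◁ braid X Z)
  hexagon_reverse : ∀ X Y Z : C,
    (α_ X Y Z).inv ≫ braid (X ⊗ Y) Z ≫ (α_ Z X Y).inv =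
      (X ◁ braid Y Z) ≫ (α_ X Z Y).inv ≫ (braid X Z ▷ Y)
  unit_right : ∀ X : C, braid X (𝟙_ C) ≫ (λ_ X).hom = (ρ_ X).hom
  unit_left : ∀ X : C, braid (𝟙_ C) X ≫ (ρ_ X).hom = (λ_ X).hom

section AntiMonoidal

variable {C D : Type*} [Category C] [Category D] [MonoidalCategory C] [MonoidalCategory D]

/-- A contravariant functor, seen on the opposite category with the reversed tensor product. Its
strong monoidal structures are the anti-monoidal structures on `F`. -/
abbrev revFunctor (F : Cᵒᵖ ⥤ D) : MonoidalOpposite Cᵒᵖ ⥤ D := unmopFunctor Cᵒᵖ ⋙ F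

variable (F : Cᵒᵖ ⥤ D) [(revFunctor F).Monoidal]

/-- The structure isomorphism `F Y ⊗ F X → F (X ⊗ Y)` of an anti-monoidal functor. -/
def antiμ (X Y : C) : F.obj (op Y) ⊗ F.obj (op X) ⟶ F.obj (op (X ⊗ Y)) :=
  Functor.LaxMonoidal.μ (revFunctor F) (MonoidalOpposite.mop (op Y)) (MonoidalOpposite.mop (op X))

/-- The structure isomorphism `𝟙 → F 𝟙` of an anti-monoidal functor. -/
def antiε : 𝟙_ D ⟶ F.obj (op (𝟙_ C)) := Functor.LaxMonoidal.ε (revFunctor F)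

/-- An anti-monoidal contravariant functor is braided with respect to two pre-braidings. -/
def AntiBraided (σ : PreBraiding C) (σ' : PreBraiding D) : Prop :=
  ∀ X Y : C, σ'.braid (F.obj (op Y)) (F.obj (op X)) ≫ antiμ F Y X =
    antiμ F X Y ≫ F.map (σ.braid Y X).op

end AntiMonoidal

/-! ## Dual pairings -/

section Pairings

variable {k : Type*} {A : Type u} {R Ω : Type*} [Field k] [Ring A] [Algebra k A]
  [Ring R] [Algebra k R] [Ring Ω] [Algebra k Ω]

/-- A dual pairing `(α | X)` between the right bialgebroids `Ω` and `R` over `A`. -/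
structure DualPairing (G : RightBialgebroid k A Ω) (H : RightBialgebroid k A R) where
  pair : Ω →ₗ[k] R →ₗ[k] A
  bimod : ∀ (a b c d f : A) (α : Ω) (X : R),
    pair (G.s a * G.t b * α * G.s c * G.t d) X * f =
      d * pair α (H.s c * H.t a * X * H.s f * H.t b)
  /-- `(αβ | X) = (β | X₂ t(α | X₁))`. -/
  mul_pair : ∀ (α β : Ω) (X : R) (n : ℕ) (x y : Fin n → R),
    H.Δ X = ∑ i, H.tmul (x i) (y i) →
    pair (α * β) X = ∑ i, pair β (y i * H.t (pair α (x i)))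
  /-- `(αβ | X) = (t(α | X₁) β | X₂)`. -/
  mul_pair' : ∀ (α β : Ω) (X : R) (n : ℕ) (x y : Fin n → R),
    H.Δ X = ∑ i, H.tmul (x i) (y i) →
    pair (α * β) X = ∑ i, pair (G.t (pair α (x i)) * β) (y i)
  /-- `(α | XY) = (α₁ s(α₂ | X) | Y)`. -/
  pair_mul : ∀ (α : Ω) (X Y : R) (n : ℕ) (β γ : Fin n → Ω),
    G.Δ α = ∑ i, G.tmul (β i) (γ i) →
    pair α (X * Y) = ∑ i, pair (β i * G.s (pair (γ i) X)) Y
  /-- `(α | XY) = (α₁ | s(α₂ | X) Y)`. -/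
  pair_mul' : ∀ (α : Ω) (X Y : R) (n : ℕ) (β γ : Fin n → Ω),
    G.Δ α = ∑ i, G.tmul (β i) (γ i) →
    pair α (X * Y) = ∑ i, pair (β i) (H.s (pair (γ i) X) * Y)
  pair_one : ∀ α : Ω, pair α 1 = G.ε α
  one_pair : ∀ X : R, pair 1 X = H.ε X

variable {G : RightBialgebroid k A Ω} {H : RightBialgebroid k A R}

/-- The pairing identifies `Ω` with the right dual `R^∨`. As the axioms of a dual pairing determine
all structure maps of the bialgebroid `R^∨`, this says `Ω = R^∨` as right bialgebroids. -/
def DualPairing.IdentifiesRightDual (P : DualPairing G H) : Prop :=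
  ∀ φ : R →ₗ[k] A, H.IsRightLinear φ → ∃! α : Ω, P.pair α = φ

/-- The pairing identifies `R` with the left dual `^∨Ω`, that is `R = ^∨Ω` as right bialgebroids. -/
def DualPairing.IdentifiesLeftDual (P : DualPairing G H) : Prop :=
  ∀ φ : Ω →ₗ[k] A, G.IsLeftLinear φ → ∃! X : R, P.pair.flip X = φ

/-- A dual pairing `(f, η)` between a left-right Yetter-Drinfeld module `T` of `Ω` and a right-right
Yetter-Drinfeld module `L` of `R`, with respect to a dual pairing of the bialgebroids. -/
structure IsYDPairing (P : DualPairing G H) (T : YDLR G) (L : YDRR H)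
    (p : T.carrier →ₗ[k] L.carrier →ₗ[k] A) : Prop where
  bimod : ∀ (f : T.carrier) (η : L.carrier) (a b c : A),
    p (f <• (G.s a * G.t b)) η * c = b * p f (η <• (H.s c * H.t a))
  /-- `(f ◁ α, η) = (t(f, η₀) α | η₁)`. -/
  act_left : ∀ (f : T.carrier) (α : Ω) (η : L.carrier) (n : ℕ) (x : Fin n → L.carrier)
    (z : Fin n → R), L.δ η = ∑ i, H.tmul (x i) (z i) →
    p (f <• α) η = ∑ i, P.pair (G.t (p f (x i)) * α) (z i)
  /-- `(f ◁ α, η) = (α | η₁ t(f, η₀))`. -/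
  act_left' : ∀ (f : T.carrier) (α : Ω) (η : L.carrier) (n : ℕ) (x : Fin n → L.carrier)
    (z : Fin n → R), L.δ η = ∑ i, H.tmul (x i) (z i) →
    p (f <• α) η = ∑ i, P.pair α (z i * H.t (p f (x i)))
  /-- `(f, η ◁ X) = (f₋₁ | s(f₀, η) X)`. -/
  act_right : ∀ (f : T.carrier) (η : L.carrier) (X : R) (n : ℕ) (ω : Fin n → Ω)
    (g : Fin n → T.carrier), T.δ f = ∑ i, G.tmul (ω i) (g i) →
    p f (η <• X) = ∑ i, P.pair (ω i) (H.s (p (g i) η) * X)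
  /-- `(f, η ◁ X) = (f₋₁ s(f₀, η) | X)`. -/
  act_right' : ∀ (f : T.carrier) (η : L.carrier) (X : R) (n : ℕ) (ω : Fin n → Ω)
    (g : Fin n → T.carrier), T.δ f = ∑ i, G.tmul (ω i) (g i) →
    p f (η <• X) = ∑ i, P.pair (ω i * G.s (p (g i) η)) X

/-- `F` is the right dual functor `L ↦ L^∨`: evaluation pairings `ev L : F L × L → A` identify `F L`
with the space of right `A`-linear maps `L → A`, the Yetter-Drinfeld structure on `F L` is the one
for which `ev L` is a dual pairing, and `F` acts on morphisms by precomposition. -/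
structure RightDualFunctor (P : DualPairing G H) (F : (RRFGP H)ᵒᵖ ⥤ LRFGP G) where
  ev (L : RRFGP H) : (F.obj (op L)).El →ₗ[k] L.El →ₗ[k] A
  isPairing : ∀ L : RRFGP H, IsYDPairing P (F.obj (op L)).obj L.obj (ev L)
  dual : ∀ (L : RRFGP H) (φ : L.El →ₗ[k] A), H.IsRightLinear φ → ∃! f, ev L f = φ
  map : ∀ {L L' : RRFGP H} (g : L ⟶ L') (f : (F.obj (op L')).El) (η : L.El),
    ev L (LRFGP.app (F.map g.op) f) η = ev L' f (RRFGP.app g η)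

end Pairings

/-! Sweedler notation is made into a calculus. `sw w B` sums `B` over a chosen representation of `w`
in `M ⊗_A N`, and for balanced `B` the choice does not matter (`sw_eq_lift`). Every axiom of
bialgebroids, comodules and Yetter-Drinfeld modules thus becomes a rewriting rule for nested sums.

The right-right category is built directly from these rules: `YDRR.tensor_comodule` and
`YDRR.tensor_yd` give the tensor product. The map `σ` is linear by the Yetter-Drinfeld condition of
its second argument and colinear by that of its first.

Left-right modules are reduced to right-right ones. Interchanging source and target and flipping the
coproduct gives a right bialgebroid over `Aᵒᵖ`, the coopposite. A left-right module of `Ω` is a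
right-right module of the coopposite of `Ω`, with the order of tensor products reversed, so the
monoidal structure and the pre-braiding are transported. Being coopposite is treated as a symmetric
relation (`CopPair`), so that the opposite of `Aᵒᵖ` never has to be identified with `A`.

For duality, either hypothesis on the pairing provides finite bases `e j` of `R` and `ω j` of `Ω`
that are dual to each other (`DualPairing.isPerfect`). On the right dual of `Λ`, with dual bases `x
i` and `φ i`, the action of `Ω` is given by the stated formula, and the coaction is forced to be `f
↦ ∑ ω j t(f, x i ◁ e j) ⊗ φ i`. The functionals `ω ⊗ f ↦ (ω | s(f, η) X)` separate the points of `Ω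
⊗_A Λ^∨` (`test_ext`). Tested against them, the comodule axioms of the dual become module axioms of
`Λ`, and its Yetter-Drinfeld condition becomes that of `Λ`.

The coopposite pairing interchanges `Ω` and `R`. The existence of duals of objects and morphisms
therefore also yields preduals (`DualPairing.exists_predual`, `IsYDPairing.exists_predualHom`), that
is, essential surjectivity and fullness; faithfulness is nondegeneracy.

Finally `(g ⊗ f, η ⊗ ξ) = (g, ξ ◁ t(f, η))` is again a perfect Yetter-Drinfeld pairing
(`tensorPairing_act`, `tensorPairing_coact`, `tensorPairing_isPerfect`). Two modules in perfect
duality with the same `Λ` are canonically isomorphic (`PerfectPairing.dualIso`); this gives `ψ` and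
the unit isomorphism. Coherence and compatibility with the pre-braidings are then checked by
evaluating on pure tensors. -/

set_option linter.unusedSectionVars false
namespace SourceTarget

/-! ### Sweedler calculus: balanced functions and sums over representations. -/

section Sweedler

variable {k A R : Type*} [Field k] [Ring A] [Algebra k A] [Ring R] [Algebra k R]
  (E : SourceTarget k A R) {M N L Q Q' : Type*}
  [AddCommGroup M] [Module k M] [Module Rᵐᵒᵖ M] [IsScalarTower k Rᵐᵒᵖ M]
  [AddCommGroup N] [Module k N] [Module Rᵐᵒᵖ N] [IsScalarTower k Rᵐᵒᵖ N]
  [AddCommGroup L] [Module k L] [Module Rᵐᵒᵖ L] [IsScalarTower k Rᵐᵒᵖ L]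
  [AddCommGroup Q] [AddCommGroup Q']

@[simp] theorem t_add (a b : A) : E.t (a + b) = E.t a + E.t b := map_add E.tOp _ _
@[simp] theorem t_zero : E.t 0 = 0 := map_zero E.tOp
@[simp] theorem t_one : E.t 1 = 1 := map_one E.tOp
theorem t_mul (a b : A) : E.t (a * b) = E.t b * E.t a := map_mul E.tOp _ _
theorem t_smul (c : k) (a : A) : E.t (c • a) = c • E.t a := map_smul E.tOp c _
theorem t_sum {ι : Type*} (S : Finset ι) (f : ι → A) :
    E.t (∑ i ∈ S, f i) = ∑ i ∈ S, E.t (f i) := by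
  classical
  induction S using Finset.induction_on with
  | empty => simp
  | insert a S ha ih => rw [Finset.sum_insert ha, Finset.sum_insert ha, t_add, ih]
theorem s_comm_t (a b : A) : E.s a * E.t b = E.t b * E.s a := E.commute a b
theorem t_algebraMap (c : k) : E.t (algebraMap k A c) = algebraMap k R c := E.tOp.commutes c

omit [Algebra k R] [Field k] in
theorem _root_.rsmul_mul {R : Type*} [Ring R] {M : Type*} [AddCommGroup M] [Module Rᵐᵒᵖ M]
    (m : M) (X Y : R) : m <• (X * Y) = (m <• X) <• Y := by
  rw [MulOpposite.op_mul, mul_smul]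

theorem rsmul_s_t (m : M) (a b : A) : (m <• E.s a) <• E.t b = (m <• E.t b) <• E.s a := by
  rw [← rsmul_mul, s_comm_t, rsmul_mul]

theorem rsmul_algebraMap (c : k) (m : M) : m <• algebraMap k R c = c • m :=
  algebraMap_smul (A := Rᵐᵒᵖ) c m

/-- Biadditive functions that are balanced over `A`. -/
structure IsBal (B : M → N → Q) : Prop where
  add_left : ∀ m m' n, B (m + m') n = B m n + B m' n
  add_right : ∀ m n n', B m (n + n') = B m n + B m n'
  bal : ∀ m a n, B (m <• E.s a) n = B m (n <• E.t a)

/-- Triadditive functions that are balanced over `A`. -/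
structure IsBal₃ (B : M → N → L → Q) : Prop where
  add_left : ∀ m m' n p, B (m + m') n p = B m n p + B m' n p
  add_mid : ∀ m n n' p, B m (n + n') p = B m n p + B m n' p
  add_right : ∀ m n p p', B m n (p + p') = B m n p + B m n p'
  bal_left : ∀ m a n p, B (m <• E.s a) n p = B m (n <• E.t a) p
  bal_right : ∀ m n a p, B m (n <• E.s a) p = B m n (p <• E.t a)

namespace IsBal
variable {E} {B : M → N → Q} (h : E.IsBal B)
include h

/-- Both `s` and `t` are maps of `k`-algebras, so balance over `A` contains balance over `k`. This
is why `IsBal` asks for additivity only. -/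
theorem smul_smul (c : k) (m : M) (n : N) : B (c • m) n = B m (c • n) := by
  have := h.bal m (algebraMap k A c) n
  rwa [AlgHom.commutes, t_algebraMap, rsmul_algebraMap, rsmul_algebraMap] at this

theorem map {F : Type*} [FunLike F Q Q'] [AddMonoidHomClass F Q Q'] (f : F) :
    E.IsBal (fun m n => f (B m n)) :=
  ⟨fun _ _ _ => by rw [h.add_left, map_add], fun _ _ _ => by rw [h.add_right, map_add],
    fun _ _ _ => by rw [h.bal]⟩

end IsBal

namespace IsBal
variable {E}

/-- The default tactics cover the typical `f` and `g`, namely `x ↦ m ◁ x` and `z ↦ X * z`, which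
commute with right multiplication. -/
theorem comp {M' N' : Type*} [AddCommGroup M'] [Module Rᵐᵒᵖ M'] [AddCommGroup N']
    [Module Rᵐᵒᵖ N'] {B : M' → N' → Q} (h : E.IsBal B) {f : M → M'} {g : N → N'}
    (hf : ∀ m a, f (m <• E.s a) = f m <• E.s a := by intros; simp [mul_smul, mul_assoc])
    (hg : ∀ n a, g (n <• E.t a) = g n <• E.t a := by intros; simp [mul_smul, mul_assoc])
    (f_add : ∀ m m', f (m + m') = f m + f m' := by intros; simp [add_smul, mul_add, add_mul])
    (g_add : ∀ n n', g (n + n') = g n + g n' := by intros; simp [add_smul, mul_add, add_mul]) :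
    E.IsBal (fun m n => B (f m) (g n)) :=
  ⟨fun _ _ _ => by rw [f_add, h.add_left], fun _ _ _ => by rw [g_add, h.add_right],
    fun _ _ _ => by rw [hf, hg, h.bal]⟩

theorem congr {B B' : M → N → Q} (h : E.IsBal B) (e : ∀ m n, B' m n = B m n) : E.IsBal B' := by
  rwa [show B' = B from funext fun m => funext (e m)]

end IsBal

theorem isBal_tmul : E.IsBal (tmul E : M → N → E.Bal M N) where
  add_left m m' n := by simp only [tmul, TensorProduct.add_tmul, map_add]
  add_right m n n' := by simp only [tmul, TensorProduct.tmul_add, map_add]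
  bal m a n := by
    rw [tmul, tmul, ← sub_eq_zero, ← map_sub, Submodule.mkQ_apply, Submodule.Quotient.mk_eq_zero]
    exact Submodule.subset_span ⟨m, a, n, rfl⟩

@[simp] theorem add_tmul (m m' : M) (n : N) : E.tmul (m + m') n = E.tmul m n + E.tmul m' n :=
  E.isBal_tmul.add_left m m' n
@[simp] theorem tmul_add (m : M) (n n' : N) : E.tmul m (n + n') = E.tmul m n + E.tmul m n' :=
  E.isBal_tmul.add_right m n n'
theorem tmul_bal (m : M) (a : A) (n : N) : E.tmul (m <• E.s a) n = E.tmul m (n <• E.t a) :=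
  E.isBal_tmul.bal m a n
theorem tmul_bal_mul (m : M) (a : A) (X : R) : E.tmul (m <• E.s a) X = E.tmul m (X * E.t a) :=
  E.isBal_tmul.bal m a X
theorem mul_tmul_bal (X : R) (a : A) (n : N) : E.tmul (X * E.s a) n = E.tmul X (n <• E.t a) :=
  E.isBal_tmul.bal X a n
@[simp] theorem zero_tmul (n : N) : E.tmul (0 : M) n = 0 := by simp [tmul]
@[simp] theorem tmul_zero (m : M) : E.tmul m (0 : N) = 0 := by simp [tmul]
theorem sum_tmul {ι : Type*} (S : Finset ι) (f : ι → M) (n : N) :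
    E.tmul (∑ i ∈ S, f i) n = ∑ i ∈ S, E.tmul (f i) n := by
  simp only [tmul, TensorProduct.sum_tmul, map_sum]
theorem tmul_sum {ι : Type*} (S : Finset ι) (f : ι → N) (m : M) :
    E.tmul m (∑ i ∈ S, f i) = ∑ i ∈ S, E.tmul m (f i) := by
  simp only [tmul, TensorProduct.tmul_sum, map_sum]
theorem smul_tmul (c : k) (m : M) (n : N) : E.tmul (c • m) n = c • E.tmul m n := by
  simp only [tmul, ← TensorProduct.smul_tmul', map_smul]
theorem tmul_smul (c : k) (m : M) (n : N) : E.tmul m (c • n) = c • E.tmul m n := by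
  simp only [tmul, TensorProduct.tmul_smul, map_smul]

variable {E}

/-- The additive map on `M ⊗_A N` induced by a balanced function. -/
noncomputable def lift (B : M → N → Q) (h : E.IsBal B) : E.Bal M N →+ Q :=
  QuotientAddGroup.lift (E.balSub M N).toAddSubgroup
    (TensorProduct.liftAddHom
      (AddMonoidHom.mk' (fun m => AddMonoidHom.mk' (B m) (h.add_right m))
        (fun m m' => AddMonoidHom.ext fun n => h.add_left m m' n))
      (fun c m n => h.smul_smul c m n)) (by
    intro w hw
    change w ∈ E.balSub M N at hw
    rw [AddMonoidHom.mem_ker]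
    induction hw using Submodule.closure_induction with
    | zero => exact map_zero _
    | add x y _ _ hx hy => rw [map_add, hx, hy, add_zero]
    -- The span is presented by sums of scalar multiples of generators; the scalar is absorbed into
    -- `m`, which gives another instance of balance.
    | smul_mem c w hw =>
      obtain ⟨m, a, n, rfl⟩ := hw
      rw [smul_sub, map_sub, sub_eq_zero, TensorProduct.smul_tmul', TensorProduct.smul_tmul',
        smul_comm c (MulOpposite.op (E.s a)) m]
      exact h.bal (c • m) a n)

@[simp] theorem lift_tmul (B : M → N → Q) (h : E.IsBal B) (m : M) (n : N) :
    lift B h (E.tmul m n) = B m n := rfl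

@[elab_as_elim]
theorem bal_induction {p : E.Bal M N → Prop} (w : E.Bal M N) (h0 : p 0)
    (h1 : ∀ m n, p (E.tmul m n)) (h2 : ∀ w w', p w → p w' → p (w + w')) : p w := by
  obtain ⟨w, rfl⟩ := Submodule.mkQ_surjective _ w
  induction w using TensorProduct.induction_on with
  | zero => simpa using h0
  | tmul m n => exact h1 m n
  | add x y hx hy => rw [map_add]; exact h2 _ _ hx hy

/-- The map `M ⊗_A N → Q` induced by a balanced function that is `k`-linear. -/
noncomputable def liftₗ [Module k Q] (B : M → N → Q) (h : E.IsBal B)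
    (hs : ∀ (c : k) m n, B (c • m) n = c • B m n) : E.Bal M N →ₗ[k] Q where
  __ := lift B h
  map_smul' c w := by
    change lift B h (c • w) = c • lift B h w
    induction w using bal_induction with
    | h0 => simp
    | h1 m n => rw [← smul_tmul, lift_tmul, hs, lift_tmul]
    | h2 w w' hw hw' => simp only [smul_add, map_add, hw, hw']

@[simp] theorem liftₗ_tmul [Module k Q] (B : M → N → Q) (h : E.IsBal B)
    (hs : ∀ (c : k) m n, B (c • m) n = c • B m n) (m : M) (n : N) :
    liftₗ B h hs (E.tmul m n) = B m n := rfl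

/-- Two hom classes are allowed so that linear and merely additive maps can be compared. -/
theorem addHom_ext {F F' : Type*} [FunLike F (E.Bal M N) Q] [AddMonoidHomClass F (E.Bal M N) Q]
    [FunLike F' (E.Bal M N) Q] [AddMonoidHomClass F' (E.Bal M N) Q]
    (f : F) (g : F') (h : ∀ m n, f (E.tmul m n) = g (E.tmul m n)) (w : E.Bal M N) : f w = g w := by
  induction w using bal_induction with
  | h0 => rw [map_zero, map_zero]
  | h1 m n => exact h m n
  | h2 w w' hw hw' => rw [map_add, map_add, hw, hw']

theorem exists_rep (w : E.Bal M N) :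
    ∃ (n : ℕ) (x : Fin n → M) (y : Fin n → N), w = ∑ i, E.tmul (x i) (y i) := by
  induction w using bal_induction with
  | h0 => exact ⟨0, Fin.elim0, Fin.elim0, by simp⟩
  | h1 m n => exact ⟨1, fun _ => m, fun _ => n, by simp⟩
  | h2 w w' hw hw' =>
    obtain ⟨n, x, y, rfl⟩ := hw
    obtain ⟨n', x', y', rfl⟩ := hw'
    exact ⟨n + n', Fin.append x x', Fin.append y y', by simp [Fin.sum_univ_add]⟩

/-- The number of terms in a chosen representation of `w`. -/
noncomputable def repLen (w : E.Bal M N) : ℕ := (exists_rep w).choose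
/-- The left factors in a chosen representation of `w`. -/
noncomputable def repL (w : E.Bal M N) : Fin (repLen w) → M := (exists_rep w).choose_spec.choose
/-- The right factors in a chosen representation of `w`. -/
noncomputable def repR (w : E.Bal M N) : Fin (repLen w) → N :=
  (exists_rep w).choose_spec.choose_spec.choose
theorem rep_spec (w : E.Bal M N) : w = ∑ i, E.tmul (repL w i) (repR w i) :=
  (exists_rep w).choose_spec.choose_spec.choose_spec

/-- The Sweedler sum `∑ B m n` over a chosen representation `w = ∑ m ⊗ n`. It does not depend on
the choice if `B` is balanced. -/
noncomputable def sw (w : E.Bal M N) (B : M → N → Q) : Q := ∑ i, B (repL w i) (repR w i)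

theorem sw_congr {w : E.Bal M N} {B B' : M → N → Q} (h : ∀ m n, B m n = B' m n) :
    sw w B = sw w B' := Finset.sum_congr rfl fun _ _ => h _ _

theorem sw_tmul_self (w : E.Bal M N) : sw w (tmul E) = w := (rep_spec w).symm

/-- This is the independence of the chosen representation: the right-hand side mentions none. -/
theorem sw_eq_lift {B : M → N → Q} (h : E.IsBal B) (w : E.Bal M N) : sw w B = lift B h w := by
  conv_rhs => rw [rep_spec w, map_sum]
  rfl

/-- Passage from the chosen representation to an arbitrary family, which is the form in which the
structures state their axioms. -/
theorem sw_rep {B : M → N → Q} (h : E.IsBal B) {w : E.Bal M N} {n : ℕ} {x : Fin n → M}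
    {y : Fin n → N} (hw : w = ∑ i, E.tmul (x i) (y i)) : sw w B = ∑ i, B (x i) (y i) := by
  rw [sw_eq_lift h, hw, map_sum]
  rfl

theorem sw_tmul {B : M → N → Q} (h : E.IsBal B) (m : M) (n : N) : sw (E.tmul m n) B = B m n := by
  rw [sw_eq_lift h, lift_tmul]

theorem sw_add {B : M → N → Q} (h : E.IsBal B) (w w' : E.Bal M N) :
    sw (w + w') B = sw w B + sw w' B := by
  simp only [sw_eq_lift h, map_add]

theorem sw_zero {B : M → N → Q} (h : E.IsBal B) : sw (0 : E.Bal M N) B = 0 := by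
  rw [sw_eq_lift h, map_zero]

theorem sw_zero_fun (w : E.Bal M N) : sw w (fun _ _ => (0 : Q)) = 0 := Finset.sum_const_zero

theorem sw_smul [Module k Q] {B : M → N → Q} (h : E.IsBal B)
    (hs : ∀ (c : k) m n, B (c • m) n = c • B m n) (c : k) (w : E.Bal M N) :
    sw (c • w) B = c • sw w B := by
  simp only [sw_eq_lift h]
  exact (liftₗ B h hs).map_smul c w

theorem sw_sum {B : M → N → Q} (h : E.IsBal B) {ι : Type*} (S : Finset ι) (w : ι → E.Bal M N) :
    sw (∑ i ∈ S, w i) B = ∑ i ∈ S, sw (w i) B := by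
  simp only [sw_eq_lift h, map_sum]

theorem sw_sw {k' A' R' M' N' : Type*} [Field k'] [Ring A'] [Algebra k' A'] [Ring R']
    [Algebra k' R'] {E' : SourceTarget k' A' R'}
    [AddCommGroup M'] [Module k' M'] [Module R'ᵐᵒᵖ M']
    [IsScalarTower k' R'ᵐᵒᵖ M'] [AddCommGroup N'] [Module k' N'] [Module R'ᵐᵒᵖ N']
    [IsScalarTower k' R'ᵐᵒᵖ N'] {B : M → N → Q} (h : E.IsBal B) (w : E'.Bal M' N')
    (f : M' → N' → E.Bal M N) : sw (sw w f) B = sw w (fun m n => sw (f m n) B) := by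
  exact sw_sum h _ _

theorem map_sw {F : Type*} [FunLike F Q Q'] [AddMonoidHomClass F Q Q'] (f : F) (w : E.Bal M N)
    (B : M → N → Q) : f (sw w B) = sw w (fun m n => f (B m n)) := map_sum f _ _

theorem sw_rsmul {S : Type*} [Ring S] [Module Sᵐᵒᵖ Q] (w : E.Bal M N) (B : M → N → Q) (X : S) :
    sw w B <• X = sw w (fun m n => B m n <• X) := Finset.smul_sum

theorem rsmul_sw {S : Type*} [Ring S] [Module Sᵐᵒᵖ Q'] (w : E.Bal M N) (B : M → N → S) (m : Q') :
    m <• sw w B = sw w (fun x y => m <• B x y) := by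
  simp only [sw, Finset.op_sum, Finset.sum_smul]

theorem sw_mul {S : Type*} [Ring S] (w : E.Bal M N) (B : M → N → S) (X : S) :
    sw w B * X = sw w (fun m n => B m n * X) := Finset.sum_mul _ _ _

theorem mul_sw {S : Type*} [Ring S] (w : E.Bal M N) (B : M → N → S) (X : S) :
    X * sw w B = sw w (fun m n => X * B m n) := Finset.mul_sum _ _ _

theorem smul_sw [Module k Q] (c : k) (w : E.Bal M N) (B : M → N → Q) :
    c • sw w B = sw w (fun m n => c • B m n) := Finset.smul_sum

theorem sw_add_fun (w : E.Bal M N) (B B' : M → N → Q) :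
    sw w (fun m n => B m n + B' m n) = sw w B + sw w B' := Finset.sum_add_distrib

theorem sw_sum_fun {ι : Type*} (S : Finset ι) (w : E.Bal M N) (B : ι → M → N → Q) :
    sw w (fun m n => ∑ i ∈ S, B i m n) = ∑ i ∈ S, sw w (B i) := Finset.sum_comm

theorem sw_tmul_left (w : E.Bal M N) (B : M → N → L) {P : Type*} [AddCommGroup P] [Module k P]
    [Module Rᵐᵒᵖ P] [IsScalarTower k Rᵐᵒᵖ P] (p : P) :
    E.tmul (sw w B) p = sw w (fun m n => E.tmul (B m n) p) := sum_tmul _ _ _ _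

theorem tmul_sw (w : E.Bal M N) (B : M → N → L) {P : Type*} [AddCommGroup P] [Module k P]
    [Module Rᵐᵒᵖ P] [IsScalarTower k Rᵐᵒᵖ P] (p : P) :
    E.tmul p (sw w B) = sw w (fun m n => E.tmul p (B m n)) := tmul_sum _ _ _ _

theorem t_sw {k' A' R' M' N' : Type*} [Field k'] [Ring A'] [Algebra k' A'] [Ring R']
    [Algebra k' R'] {E' : SourceTarget k' A' R'}
    [AddCommGroup M'] [Module k' M'] [Module R'ᵐᵒᵖ M']
    [IsScalarTower k' R'ᵐᵒᵖ M'] [AddCommGroup N'] [Module k' N'] [Module R'ᵐᵒᵖ N']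
    [IsScalarTower k' R'ᵐᵒᵖ N'] (w : E'.Bal M' N') (B : M' → N' → A) :
    E.t (sw w B) = sw w (fun m n => E.t (B m n)) :=
  t_sum _ _ _

theorem sw_apply {V W : Type*} [AddCommGroup V] [Module k V] [AddCommGroup W] [Module k W]
    (w : E.Bal M N) (B : M → N → V →ₗ[k] W) (v : V) : sw w B v = sw w (fun m n => B m n v) :=
  LinearMap.sum_apply _ _ _

/-- Both sums run over fixed representations, so no balance is needed. -/
theorem sw_comm {k' A' R' M' N' : Type*} [Field k'] [Ring A'] [Algebra k' A'] [Ring R']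
    [Algebra k' R'] {E' : SourceTarget k' A' R'}
    [AddCommGroup M'] [Module k' M'] [Module R'ᵐᵒᵖ M']
    [IsScalarTower k' R'ᵐᵒᵖ M'] [AddCommGroup N'] [Module k' N'] [Module R'ᵐᵒᵖ N']
    [IsScalarTower k' R'ᵐᵒᵖ N'] (w : E.Bal M N) (w' : E'.Bal M' N') (B : M → N → M' → N' → Q) :
    sw w (fun m n => sw w' (fun m' n' => B m n m' n')) =
      sw w' (fun m' n' => sw w (fun m n => B m n m' n')) := Finset.sum_comm

theorem sum_sw {B : M → N → Q} (h : E.IsBal B) {w : E.Bal M N} {n : ℕ} {x : Fin n → M}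
    {y : Fin n → N} (hw : w = ∑ i, E.tmul (x i) (y i)) : ∑ i, B (x i) (y i) = sw w B :=
  (sw_rep h hw).symm

theorem isBal_tmul_mul_s (a : A) : E.IsBal (fun (m : M) (z : R) => E.tmul m (z * E.s a)) :=
  E.isBal_tmul.comp (hg := by intros; simp [mul_assoc, E.s_comm_t])

theorem isBal_tmul_mul (X : R) : E.IsBal (fun (m : M) (z : R) => E.tmul m (X * z)) :=
  E.isBal_tmul.comp

theorem isBal_rsmul_t_tmul (a : A) : E.IsBal (fun (m : M) (n : N) => E.tmul (m <• E.t a) n) :=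
  ⟨by simp, by simp, fun m b n => by rw [rsmul_s_t, tmul_bal]⟩

/-! Threefold tensor products -/

theorem tmulLeft_tmul (m : M) (n : N) (p : L) :
    E.tmulLeft (E.tmul m n) p = E.tmulRight m (E.tmul n p) := rfl

theorem tmulLeft_sw {k' A' R' M' N' : Type*} [Field k'] [Ring A'] [Algebra k' A'] [Ring R']
    [Algebra k' R'] {E' : SourceTarget k' A' R'}
    [AddCommGroup M'] [Module k' M'] [Module R'ᵐᵒᵖ M']
    [IsScalarTower k' R'ᵐᵒᵖ M'] [AddCommGroup N'] [Module k' N'] [Module R'ᵐᵒᵖ N']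
    [IsScalarTower k' R'ᵐᵒᵖ N'] (w : E'.Bal M' N') (f : M' → N' → E.Bal M N) (p : L) :
    E.tmulLeft (sw w f) p = sw w (fun m n => E.tmulLeft (f m n) p) :=
  map_sw (E.tmulLeft.flip p) w f

theorem isBal₃_tmul : E.IsBal₃ (fun (m : M) (n : N) (p : L) => E.tmulRight m (E.tmul n p)) where
  add_left m m' n p := by rw [← tmulLeft_tmul, add_tmul, map_add]; rfl
  add_mid m n n' p := by rw [add_tmul, map_add]
  add_right m n p p' := by rw [tmul_add, map_add]
  bal_left m a n p := by rw [← tmulLeft_tmul, tmul_bal, tmulLeft_tmul]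
  bal_right m n a p := by rw [tmul_bal]

namespace IsBal₃
variable {B : M → N → L → Q} (h : E.IsBal₃ B)
include h

theorem left (p : L) : E.IsBal (fun m n => B m n p) :=
  ⟨fun _ _ _ => h.add_left _ _ _ _, fun _ _ _ => h.add_mid _ _ _ _, fun _ _ _ => h.bal_left _ _ _ _⟩

theorem right (m : M) : E.IsBal (B m) :=
  ⟨fun _ _ _ => h.add_mid _ _ _ _, fun _ _ _ => h.add_right _ _ _ _, fun _ _ _ => h.bal_right _ _ _ _⟩

end IsBal₃

theorem IsBal₃.comp {M' N' L' : Type*} [AddCommGroup M'] [Module Rᵐᵒᵖ M'] [AddCommGroup N']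
    [Module Rᵐᵒᵖ N'] [AddCommGroup L'] [Module Rᵐᵒᵖ L']
    {B : M' → N' → L' → Q} (h : E.IsBal₃ B) {f : M → M'} {g : N → N'} {l : L → L'}
    (hf : ∀ m a, f (m <• E.s a) = f m <• E.s a := by intros; simp [mul_smul, mul_assoc])
    (hg : ∀ n a, g (n <• E.t a) = g n <• E.t a := by intros; simp [mul_smul, mul_assoc])
    (hg' : ∀ n a, g (n <• E.s a) = g n <• E.s a := by intros; simp [mul_smul, mul_assoc])
    (hl : ∀ n a, l (n <• E.t a) = l n <• E.t a := by intros; simp [mul_smul, mul_assoc])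
    (f_add : ∀ m m', f (m + m') = f m + f m' := by intros; simp [add_smul, mul_add, add_mul])
    (g_add : ∀ n n', g (n + n') = g n + g n' := by intros; simp [add_smul, mul_add, add_mul])
    (l_add : ∀ n n', l (n + n') = l n + l n' := by intros; simp [add_smul, mul_add, add_mul]) :
    E.IsBal₃ (fun m n p => B (f m) (g n) (l p)) :=
  ⟨fun _ _ _ _ => by rw [f_add, h.add_left], fun _ _ _ _ => by rw [g_add, h.add_mid],
    fun _ _ _ _ => by rw [l_add, h.add_right],
    fun _ _ _ _ => by rw [hf, hg, h.bal_left], fun _ _ _ _ => by rw [hg', hl, h.bal_right]⟩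

/-- The additive map on `M ⊗_A N ⊗_A L` induced by a balanced function. -/
noncomputable def lift₃ (B : M → N → L → Q) (h : E.IsBal₃ B) : E.Bal₃ M N L →+ Q :=
  QuotientAddGroup.lift (E.balSub₃ M N L).toAddSubgroup
    (TensorProduct.liftAddHom
      (TensorProduct.liftAddHom
        (AddMonoidHom.mk' (fun m => AddMonoidHom.mk' (fun n => AddMonoidHom.mk' (B m n)
          (h.add_right m n)) (fun n n' => AddMonoidHom.ext fun p => h.add_mid m n n' p))
          (fun m m' => AddMonoidHom.ext fun n => AddMonoidHom.ext fun p => h.add_left m m' n p))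
        (fun c m n => AddMonoidHom.ext fun p => (h.left p).smul_smul c m n))
      (fun c w p => by
        induction w using TensorProduct.induction_on with
        | zero => simp
        | add x y hx hy => simp only [smul_add, map_add, AddMonoidHom.add_apply, hx, hy]
        | tmul m n =>
          rw [TensorProduct.smul_tmul', TensorProduct.smul_tmul]
          exact (h.right m).smul_smul c n p)) (by
    intro w hw
    change w ∈ E.balSub₃ M N L at hw
    rw [AddMonoidHom.mem_ker]
    induction hw using Submodule.closure_induction with
    | zero => exact map_zero _
    | add x y _ _ hx hy => rw [map_add, hx, hy, add_zero]
    | smul_mem c w hw =>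
      obtain ⟨m, a, n, p, rfl⟩ | ⟨m, n, a, p, rfl⟩ := hw
      · rw [smul_sub, map_sub, sub_eq_zero]
        simp only [TensorProduct.smul_tmul', smul_comm c (MulOpposite.op (E.s a)) m]
        exact h.bal_left (c • m) a n p
      · rw [smul_sub, map_sub, sub_eq_zero]
        simp only [TensorProduct.smul_tmul']
        exact h.bal_right (c • m) n a p)

/-- Together with `lift₃_tmulLeft` this turns coassociativity, an equation in `Bal₃`, into an
equality of nested Sweedler sums. -/
theorem lift₃_tmulRight (B : M → N → L → Q) (h : E.IsBal₃ B) (m : M) (w : E.Bal N L) :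
    lift₃ B h (E.tmulRight m w) = sw w (B m) := by
  rw [sw_eq_lift (h.right m)]
  exact addHom_ext ((lift₃ B h).comp (E.tmulRight m).toAddMonoidHom) (lift _ (h.right m))
    (fun _ _ => rfl) w

theorem lift₃_tmulLeft (B : M → N → L → Q) (h : E.IsBal₃ B) (w : E.Bal M N) (p : L) :
    lift₃ B h (E.tmulLeft w p) = sw w (fun m n => B m n p) := by
  rw [sw_eq_lift (h.left p)]
  exact addHom_ext ((lift₃ B h).comp (E.tmulLeft.flip p).toAddMonoidHom) (lift _ (h.left p))
    (fun _ _ => rfl) w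

@[elab_as_elim]
theorem bal₃_induction {p : E.Bal₃ M N L → Prop} (w : E.Bal₃ M N L) (h0 : p 0)
    (h1 : ∀ m n l, p (E.tmulRight m (E.tmul n l)))
    (h2 : ∀ w w', p w → p w' → p (w + w')) : p w := by
  obtain ⟨w, rfl⟩ := Submodule.mkQ_surjective _ w
  induction w using TensorProduct.induction_on with
  | zero => simpa using h0
  | tmul w l =>
    induction w using TensorProduct.induction_on with
    | zero => simpa using h0
    | tmul m n => exact h1 m n l
    | add x y hx hy => rw [TensorProduct.add_tmul, map_add]; exact h2 _ _ hx hy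
  | add x y hx hy => rw [map_add]; exact h2 _ _ hx hy

theorem rightFGP_of_fintype (E : SourceTarget k A R) (ι : Type*) [Fintype ι] (x : ι → M)
    (φ : ι → M →ₗ[k] A) (hφ : ∀ i, E.IsRightLinear (φ i))
    (hx : ∀ m : M, m = ∑ i, x i <• E.s (φ i m)) : E.RightFGP M := by
  let e := (Fintype.equivFin ι).symm
  refine ⟨Fintype.card ι, x ∘ e, φ ∘ e, fun i => hφ _, fun m => (hx m).trans ?_⟩
  exact (e.sum_comp (fun i => x i <• E.s (φ i m))).symm

end Sweedler
end SourceTarget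

open SourceTarget

/-! ### Bialgebroid axioms as rules for Sweedler sums. -/

namespace RightBialgebroid

variable {k A R Q : Type*} [Field k] [Ring A] [Algebra k A] [Ring R] [Algebra k R]
  [AddCommGroup Q] (H : RightBialgebroid k A R) {B : R → R → Q}

section
variable (hB : H.IsBal B) (X Y : R) (a : A)
include hB

theorem sw_Δ_mul_t : sw (H.Δ (X * H.t a)) B = sw (H.Δ X) (fun x y => B (x * H.t a) y) := by
  refine sw_rep hB ?_
  simpa using H.Δ_bimod X 1 a _ _ _ (rep_spec (H.Δ X))

theorem sw_Δ_one : sw (H.Δ 1) B = B 1 1 := by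
  rw [H.Δ_one, sw_tmul hB]

theorem sw_Δ_mul : sw (H.Δ (X * Y)) B =
    sw (H.Δ X) (fun x y => sw (H.Δ Y) (fun x' y' => B (x * x') (y * y'))) := by
  rw [H.Δ_mul X Y _ _ _ _ _ _ (rep_spec (H.Δ X)) (rep_spec (H.Δ Y)), sw_sum hB]
  refine Finset.sum_congr rfl fun i _ => ?_
  rw [sw_sum hB]
  refine Finset.sum_congr rfl fun j _ => ?_
  rw [sw_tmul hB]

theorem sw_takeuchi : sw (H.Δ X) (fun x y => B (H.s a * x) y) =
    sw (H.Δ X) (fun x y => B x (H.t a * y)) := by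
  have := congrArg (lift B hB) (H.takeuchi X a _ _ _ (rep_spec (H.Δ X)))
  simpa [map_sum, sw] using this

/-- For `X = s a` or `X = t a` the coproduct is a pure tensor, and the double sum in `sw_Δ_mul`
reduces to a single one. -/
theorem sw_Δ_mul_of {u v : R} (hX : H.Δ X = H.tmul u v) :
    sw (H.Δ (X * Y)) B = sw (H.Δ Y) (fun x y => B (u * x) (v * y)) := by
  refine sw_rep hB ?_
  simpa using H.Δ_mul X Y 1 (fun _ => u) (fun _ => v) _ _ _ (by simpa using hX) (rep_spec (H.Δ Y))

theorem sw_Δ_s_mul : sw (H.Δ (H.s a * X)) B = sw (H.Δ X) (fun x y => B x (H.s a * y)) := by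
  have h := H.Δ_bimod 1 a 1 1 (fun _ => 1) (fun _ => 1) (by simp [H.Δ_one])
  simpa using sw_Δ_mul_of H hB _ X (u := 1) (v := H.s a) (by simpa using h)

theorem sw_Δ_t_mul : sw (H.Δ (H.t a * X)) B = sw (H.Δ X) (fun x y => B (H.t a * x) y) := by
  have h := H.Δ_bimod 1 1 a 1 (fun _ => 1) (fun _ => 1) (by simp [H.Δ_one])
  simpa using sw_Δ_mul_of H hB _ X (u := H.t a) (v := 1) (by simpa using h)

end

theorem sw_coassoc {B : R → R → R → Q} (hB : H.IsBal₃ B) (X : R) :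
    sw (H.Δ X) (fun x y => sw (H.Δ x) (fun x₁ x₂ => B x₁ x₂ y)) =
      sw (H.Δ X) (fun x y => sw (H.Δ y) (fun y₁ y₂ => B x y₁ y₂)) := by
  have := congrArg (lift₃ B hB) (H.coassoc X _ _ _ (rep_spec (H.Δ X)))
  simp only [map_sum, lift₃_tmulLeft, lift₃_tmulRight] at this
  exact this

theorem sw_counit_left (X : R) : sw (H.Δ X) (fun x y => y * H.t (H.ε x)) = X :=
  H.counit_left X _ _ _ (rep_spec (H.Δ X))

theorem sw_counit_right (X : R) : sw (H.Δ X) (fun x y => x * H.s (H.ε y)) = X :=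
  H.counit_right X _ _ _ (rep_spec (H.Δ X))

theorem ε_mul_s (X : R) (a : A) : H.ε (X * H.s a) = H.ε X * a := by
  simpa using H.ε_bimod X a 1

theorem ε_mul_t (X : R) (a : A) : H.ε (X * H.t a) = a * H.ε X := by
  simpa using H.ε_bimod X 1 a

end RightBialgebroid

/-! ### Right comodules in Sweedler form. -/

section Comodule

variable {k A R Q : Type*} [Field k] [Ring A] [Algebra k A] [Ring R] [Algebra k R]
  [AddCommGroup Q] {H : RightBialgebroid k A R} {M : Type*}
  [AddCommGroup M] [Module k M] [Module Rᵐᵒᵖ M] [IsScalarTower k Rᵐᵒᵖ M]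
  {δ : M →ₗ[k] H.Bal M R}

/-- The right dual pairing of a module with itself: `m ◁ X` is balanced over `Δ`. -/
theorem SourceTarget.IsBal.sw_diag {N : Type*} [AddCommGroup N] [Module k N] [Module Rᵐᵒᵖ N]
    [IsScalarTower k Rᵐᵒᵖ N] {B : M → N → Q} (hB : H.IsBal B) (X : R) :
    H.IsBal (fun m n => sw (H.Δ X) fun x y => B (m <• x) (n <• y)) where
  add_left m m' n := by simp only [smul_add, hB.add_left, sw_add_fun]
  add_right m n n' := by simp only [smul_add, hB.add_right, sw_add_fun]
  bal m a n := by
    simp only [← rsmul_mul]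
    refine H.sw_takeuchi (B := fun x y => B (m <• x) (n <• y)) ⟨?_, ?_, ?_⟩ X a
    · intro x x' y; simp only [MulOpposite.op_add, add_smul, hB.add_left]
    · intro x x' y; simp only [MulOpposite.op_add, add_smul, hB.add_right]
    · intro x b y
      exact (congrArg (fun z => B z _) (rsmul_mul _ _ _)).trans ((hB.bal _ _ _).trans
        (congrArg (fun z => B _ z) (rsmul_mul _ _ _).symm))

namespace IsRightComodule

variable (h : IsRightComodule H δ) {B : M → R → Q}
include h

theorem sw_s (hB : H.IsBal B) (m : M) (a : A) :
    sw (δ (m <• H.s a)) B = sw (δ m) (fun x z => B x (z * H.s a)) := by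
  refine sw_rep hB ?_
  simpa using h.bimod m 1 a _ _ _ (rep_spec (δ m))

theorem sw_t (hB : H.IsBal B) (m : M) (a : A) :
    sw (δ (m <• H.t a)) B = sw (δ m) (fun x z => B x (H.s a * z)) := by
  refine sw_rep hB ?_
  simpa using h.bimod m a 1 _ _ _ (rep_spec (δ m))

theorem sw_takeuchi (hB : H.IsBal B) (m : M) (a : A) :
    sw (δ m) (fun x z => B (x <• H.t a) z) = sw (δ m) (fun x z => B x (H.t a * z)) := by
  have := congrArg (lift B hB) (h.takeuchi m a _ _ _ (rep_spec (δ m)))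
  simpa [map_sum, sw] using this

theorem sw_coassoc {B : M → R → R → Q} (hB : H.IsBal₃ B) (m : M) :
    sw (δ m) (fun x y => sw (δ x) (fun x₁ x₂ => B x₁ x₂ y)) =
      sw (δ m) (fun x y => sw (H.Δ y) (fun y₁ y₂ => B x y₁ y₂)) := by
  have := congrArg (lift₃ B hB) (h.coassoc m _ _ _ (rep_spec (δ m)))
  simp only [map_sum, lift₃_tmulLeft, lift₃_tmulRight] at this
  exact this

theorem sw_counit (m : M) : sw (δ m) (fun x z => x <• H.s (H.ε z)) = m :=
  h.counit m _ _ _ (rep_spec (δ m))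

omit h

/-- Balance comes from `Δ (z t(b)) = z₁ t(b) ⊗ z₂`: the factor `t b` stays next to `m`. -/
theorem isBal_tmulRight_Δ : H.IsBal (fun (m : M) z => H.tmulRight m (H.Δ z)) := by
  refine ⟨fun m m' z => ?_, by simp, fun m b z => ?_⟩
  · exact addHom_ext (H.tmulRight (m + m') : H.Bal R R →ₗ[k] H.Bal₃ M R R)
      (H.tmulRight m + H.tmulRight m') (fun x y => H.isBal₃_tmul.add_left _ _ _ _) _
  · have e : H.Δ (z <• H.t b) = _ := (sw_tmul_self _).symm.trans
      (H.sw_Δ_mul_t H.isBal_tmul z b)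
    rw [e, ← sw_tmul_self (H.Δ z), map_sw, map_sw, sw_tmul_self]
    simp only [← tmulLeft_tmul, tmul_bal_mul]

theorem isBal_tmulLeft_δ (h : ∀ m a, δ (m <• H.s a) = sw (δ m) (fun x z => H.tmul x (z * H.s a))) :
    H.IsBal (fun m (z : R) => H.tmulLeft (δ m) z) := by
  refine ⟨by simp, by simp, fun m b z => ?_⟩
  conv_rhs => rw [← sw_tmul_self (δ m)]
  rw [h, tmulLeft_sw, tmulLeft_sw]
  simp only [tmulLeft_tmul, mul_tmul_bal]

theorem isBal_rsmul_ε : H.IsBal (fun (m : M) z => m <• H.s (H.ε z)) := by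
  refine ⟨by simp, by simp [add_smul], fun m b z => ?_⟩
  simp [H.ε_mul_t, mul_smul]

/-- Both sides of each axiom are sums of balanced functions, so one representation is as good as
all. The condition `h1` plays a double role: it is half of the bimodule axiom, and it makes `δ m ⊗
z` balanced, which coassociativity needs. -/
theorem of_sw
    (h1 : ∀ m a, δ (m <• H.s a) = sw (δ m) (fun x z => H.tmul x (z * H.s a)))
    (h2 : ∀ m a, δ (m <• H.t a) = sw (δ m) (fun x z => H.tmul x (H.s a * z)))
    (h3 : ∀ m a, sw (δ m) (fun x z => H.tmul (x <• H.t a) z) =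
      sw (δ m) (fun x z => H.tmul x (H.t a * z)))
    (h4 : ∀ m, sw (δ m) (fun x z => H.tmulLeft (δ x) z) =
      sw (δ m) (fun x z => H.tmulRight x (H.Δ z)))
    (h5 : ∀ m, sw (δ m) (fun x z => x <• H.s (H.ε z)) = m) : IsRightComodule H δ where
  bimod m a a' n x z hm := by
    rw [rsmul_mul, h2, h1, sw_sw (isBal_tmul_mul _), sum_sw (B := fun x z => H.tmul x (H.s a * z * H.s a')) _ hm]
    · simp only [sw_tmul (isBal_tmul_mul _), mul_assoc]
    · refine H.isBal_tmul.comp (hg := fun z b => ?_)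
      simp only [MulOpposite.smul_eq_mul_unop, MulOpposite.unop_op, mul_assoc, H.s_comm_t]
  takeuchi m a n x z hm := by
    have := h3 m a
    rwa [sw_rep _ hm, sw_rep _ hm] at this
    · exact isBal_tmul_mul _
    · exact isBal_rsmul_t_tmul _
  coassoc m n x z hm := by
    have := h4 m
    rwa [sw_rep _ hm, sw_rep _ hm] at this
    · exact isBal_tmulRight_Δ
    · exact isBal_tmulLeft_δ h1
  counit m n x z hm := by
    have := h5 m
    rwa [sw_rep _ hm] at this
    exact isBal_rsmul_ε

end IsRightComodule
end Comodule

/-! ### The modules `M ⊗_A N` and `A`. -/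

section TensorModule

variable {k A R Q : Type*} [Field k] [Ring A] [Algebra k A] [Ring R] [Algebra k R]
  [AddCommGroup Q] (H : RightBialgebroid k A R) {M N : Type*}
  [AddCommGroup M] [Module k M] [Module Rᵐᵒᵖ M] [IsScalarTower k Rᵐᵒᵖ M]
  [AddCommGroup N] [Module k N] [Module Rᵐᵒᵖ N] [IsScalarTower k Rᵐᵒᵖ N]

namespace RightBialgebroid

theorem isBal_rsmul_rsmul {B : M → N → Q} (hB : H.IsBal B) (m : M) (n : N) :
    H.IsBal (fun x y : R => B (m <• x) (n <• y)) := hB.comp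

/-- The diagonal right action on `M ⊗_A N`. -/
noncomputable instance tensorModule : Module Rᵐᵒᵖ (H.Bal M N) where
  -- The diagonal action descends to `⊗_A` because `Δ` takes values in the Takeuchi product.
  smul X := lift _ (H.isBal_tmul.sw_diag X.unop)
  one_smul w := by
    refine addHom_ext (lift _ (H.isBal_tmul.sw_diag 1)) (AddMonoidHom.id _) (fun m n => ?_) w
    rw [lift_tmul, H.sw_Δ_one (H.isBal_rsmul_rsmul H.isBal_tmul m n)]
    simp
  mul_smul X Y w := by
    refine addHom_ext (lift _ (H.isBal_tmul.sw_diag (Y.unop * X.unop)))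
      ((lift _ (H.isBal_tmul.sw_diag X.unop)).comp (lift _ (H.isBal_tmul.sw_diag Y.unop)))
      (fun m n => ?_) w
    rw [lift_tmul, H.sw_Δ_mul (H.isBal_rsmul_rsmul H.isBal_tmul m n), AddMonoidHom.comp_apply,
      lift_tmul, map_sw]
    simp only [lift_tmul, rsmul_mul]
  smul_zero X := map_zero (lift _ (H.isBal_tmul.sw_diag X.unop))
  smul_add X := map_add (lift _ (H.isBal_tmul.sw_diag X.unop))
  add_smul X Y w := by
    refine addHom_ext (lift _ (H.isBal_tmul.sw_diag (X.unop + Y.unop)))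
      (lift _ (H.isBal_tmul.sw_diag X.unop) + lift _ (H.isBal_tmul.sw_diag Y.unop))
      (fun m n => ?_) w
    rw [lift_tmul, map_add, sw_add (H.isBal_rsmul_rsmul H.isBal_tmul m n)]
    rfl
  zero_smul w := by
    refine addHom_ext (lift _ (H.isBal_tmul.sw_diag 0)) (0 : _ →+ H.Bal M N) (fun m n => ?_) w
    rw [lift_tmul, map_zero, sw_eq_lift (H.isBal_rsmul_rsmul H.isBal_tmul m n), map_zero]
    rfl

theorem tmul_rsmul (m : M) (n : N) (X : R) :
    H.tmul m n <• X = sw (H.Δ X) fun x y => H.tmul (m <• x) (n <• y) := rfl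

theorem Δ_s (a : A) : H.Δ (H.s a) = H.tmul 1 (H.s a) := by
  simpa using H.Δ_bimod 1 a 1 1 (fun _ => 1) (fun _ => 1) (by simp [H.Δ_one])

theorem Δ_t (a : A) : H.Δ (H.t a) = H.tmul (H.t a) 1 := by
  simpa using H.Δ_bimod 1 1 a 1 (fun _ => 1) (fun _ => 1) (by simp [H.Δ_one])

theorem tmul_rsmul_s (m : M) (n : N) (a : A) :
    H.tmul m n <• H.s a = H.tmul m (n <• H.s a) := by
  rw [tmul_rsmul, Δ_s, sw_tmul (H.isBal_rsmul_rsmul H.isBal_tmul m n)]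
  simp

theorem tmul_rsmul_t (m : M) (n : N) (a : A) :
    H.tmul m n <• H.t a = H.tmul (m <• H.t a) n := by
  rw [tmul_rsmul, Δ_t, sw_tmul (H.isBal_rsmul_rsmul H.isBal_tmul m n)]
  simp

/-- A scalar `c` acts as `s` of its image in `A`, hence on the second factor alone since `Δ (s a) =
1 ⊗ s a`. -/
instance tensorTower : IsScalarTower k Rᵐᵒᵖ (H.Bal M N) where
  smul_assoc c X w := by
    have e : c • X = MulOpposite.op (X.unop * algebraMap k R c) := by
      rw [← Algebra.commutes, ← Algebra.smul_def]; rfl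
    have e' (m : M) (n : N) : H.tmul m n <• algebraMap k R c = c • H.tmul m n := by
      rw [← H.s.commutes, tmul_rsmul_s, H.s.commutes, rsmul_algebraMap, tmul_smul]
    rw [e, rsmul_mul]
    exact addHom_ext (DistribSMul.toAddMonoidHom _ (MulOpposite.op (algebraMap k R c)))
      (DistribSMul.toAddMonoidHom (H.Bal M N) c) e' _

/-- From dual bases `(x, φ)` and `(y, ψ)` one gets the basis `x i ⊗ y j` with functionals `m ⊗ n ↦ ψ
j (φ i m . n)`. -/
theorem rightFGP_tensor (hM : H.RightFGP M) (hN : H.RightFGP N) : H.RightFGP (H.Bal M N) := by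
  obtain ⟨n, x, φ, hφ, hx⟩ := hM
  obtain ⟨p, y, ψ, hψ, hy⟩ := hN
  have hB (i j) : H.IsBal (fun (a : M) (b : N) => ψ j (b <• H.t (φ i a))) :=
    ⟨by simp [add_smul], by simp, fun m a n => by rw [hφ, H.t_mul, rsmul_mul]⟩
  refine H.rightFGP_of_fintype (Fin n × Fin p) (fun q => H.tmul (x q.1) (y q.2))
    (fun q => liftₗ _ (hB q.1 q.2) fun c m n => ?_) (fun q w a => ?_) fun w => ?_
  · rw [(φ q.1).map_smul, H.t_smul, MulOpposite.op_smul, smul_assoc, (ψ q.2).map_smul]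
  · induction w using bal_induction with
    | h0 => simp only [smul_zero, map_zero, zero_mul]
    | h2 w w' hw hw' => rw [smul_add, map_add, hw, hw', map_add, add_mul]
    | h1 m n => rw [H.tmul_rsmul_s, liftₗ_tmul, liftₗ_tmul, H.rsmul_s_t, hψ]
  · induction w using bal_induction with
    | h0 => simp only [map_zero, MulOpposite.op_zero, zero_smul, Finset.sum_const_zero]
    | h2 w w' hw hw' =>
      simp only [map_add, MulOpposite.op_add, add_smul, Finset.sum_add_distrib, ← hw, ← hw']
    | h1 m n =>
      simp only [liftₗ_tmul, H.tmul_rsmul_s, Fintype.sum_prod_type]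
      conv_lhs => rw [hx m, sum_tmul]
      refine Finset.sum_congr rfl fun i _ => ?_
      rw [tmul_bal, ← tmul_sum, ← hy]

/-- The algebra `A` as the underlying space of the unit object. -/
@[nolint unusedArguments]
def UnitSpace (_ : RightBialgebroid k A R) : Type _ := A

noncomputable instance : AddCommGroup H.UnitSpace := inferInstanceAs (AddCommGroup A)
noncomputable instance : Module k H.UnitSpace := inferInstanceAs (Module k A)

/-- An element of `A` as an element of the unit object. -/
def toUnit : A ≃ₗ[k] H.UnitSpace := LinearEquiv.refl k A

/-- The action `a ◁ X = ε (s a * X)`. -/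
noncomputable instance unitModule : Module Rᵐᵒᵖ H.UnitSpace where
  smul X a := H.toUnit (H.ε (H.s (H.toUnit.symm a) * X.unop))
  one_smul a := by
    change H.toUnit (H.ε (H.s (H.toUnit.symm a) * 1)) = a
    rw [mul_one, ← one_mul (H.s _), H.ε_mul_s, H.ε_one, one_mul, LinearEquiv.apply_symm_apply]
  mul_smul X Y a := by
    change H.toUnit (H.ε (H.s (H.toUnit.symm a) * (Y.unop * X.unop))) =
      H.toUnit (H.ε (H.s (H.ε (H.s (H.toUnit.symm a) * Y.unop)) * X.unop))
    -- Associativity of the action is the axiom `ε(s(ε X) Y) = ε(XY)`.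
    rw [H.ε_s, mul_assoc]
  smul_zero X := by
    change H.toUnit (H.ε (H.s (H.toUnit.symm 0) * X.unop)) = 0
    simp
  smul_add X a b := by
    change H.toUnit (H.ε (H.s (H.toUnit.symm (a + b)) * X.unop)) =
      H.toUnit (H.ε (H.s (H.toUnit.symm a) * X.unop)) +
        H.toUnit (H.ε (H.s (H.toUnit.symm b) * X.unop))
    simp [add_mul]
  add_smul X Y a := by
    change H.toUnit (H.ε (H.s (H.toUnit.symm a) * (X.unop + Y.unop))) =
      H.toUnit (H.ε (H.s (H.toUnit.symm a) * X.unop)) +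
        H.toUnit (H.ε (H.s (H.toUnit.symm a) * Y.unop))
    simp [mul_add]
  zero_smul a := by
    change H.toUnit (H.ε (H.s (H.toUnit.symm a) * 0)) = 0
    simp

theorem unit_rsmul (a : A) (X : R) : H.toUnit a <• X = H.toUnit (H.ε (H.s a * X)) := rfl

theorem unit_rsmul_s (a b : A) : H.toUnit a <• H.s b = H.toUnit (a * b) := by
  rw [unit_rsmul, ← map_mul, ← one_mul (H.s _), H.ε_mul_s, H.ε_one, one_mul]

theorem unit_rsmul_t (a b : A) : H.toUnit a <• H.t b = H.toUnit (b * a) := by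
  rw [unit_rsmul, H.ε_mul_t, ← one_mul (H.s _), H.ε_mul_s, H.ε_one, one_mul]

instance unitTower : IsScalarTower k Rᵐᵒᵖ H.UnitSpace where
  smul_assoc c X a := by
    change H.toUnit (H.ε (H.s (H.toUnit.symm a) * (c • X.unop))) =
      c • H.toUnit (H.ε (H.s (H.toUnit.symm a) * X.unop))
    simp

theorem rightFGP_unit : H.RightFGP H.UnitSpace := by
  refine ⟨1, fun _ => H.toUnit 1, fun _ => H.toUnit.symm, fun _ m a => ?_, fun m => ?_⟩
  · obtain ⟨b, rfl⟩ := H.toUnit.surjective m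
    simp [unit_rsmul_s]
  · obtain ⟨b, rfl⟩ := H.toUnit.surjective m
    simp [unit_rsmul_s]

end RightBialgebroid

end TensorModule

/-! ### Tensor product and unit of right-right Yetter-Drinfeld modules. -/

section YD

variable {k : Type*} {A : Type u} {R : Type*} [Field k] [Ring A] [Algebra k A] [Ring R]
  [Algebra k R] {Q : Type*} [AddCommGroup Q] {H : RightBialgebroid k A R}

namespace YDRR

theorem sw_yd (M : YDRR H) {B : M.carrier → R → Q} (hB : H.IsBal B) (m : M.carrier) (X : R) :
    sw (H.Δ X) (fun x y => sw (M.δ (m <• y)) fun l z => B l (x * z)) =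
      sw (M.δ m) (fun m₀ m₁ => sw (H.Δ X) fun x y => B (m₀ <• x) (m₁ * y)) := by
  rw [sw_comm]
  have := congrArg (lift B hB) (M.yd m X _ _ _ _ _ _ _ _ _ (rep_spec (H.Δ X)) (rep_spec (M.δ m))
    (fun j => rep_spec (M.δ (m <• repR (H.Δ X) j))))
  simp only [map_sum, lift_tmul] at this
  exact this

theorem isBal_yd {M : Type*} [AddCommGroup M] [Module k M] [Module Rᵐᵒᵖ M]
    [IsScalarTower k Rᵐᵒᵖ M] {δ : M →ₗ[k] H.Bal M R} (hδ : IsRightComodule H δ)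
    {B : M → R → Q} (hB : H.IsBal B) (m : M) :
    H.IsBal (fun x y : R => sw (δ (m <• y)) fun l z => B l (x * z)) := by
  have hB' (x : R) : H.IsBal (fun l z => B l (x * z)) := hB.comp
  refine ⟨fun x x' y => ?_, fun x y y' => ?_, fun x a y => ?_⟩
  · simp [add_mul, hB.add_right, sw_add_fun]
  · simp [add_smul, sw_add (hB' x)]
  · simp only [MulOpposite.smul_eq_mul_unop, MulOpposite.unop_op, rsmul_mul, mul_assoc,
      hδ.sw_t (hB' x)]

theorem isBal_rsmul_mul {M : Type*} [AddCommGroup M] [Module k M] [Module Rᵐᵒᵖ M]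
    [IsScalarTower k Rᵐᵒᵖ M] {B : M → R → Q} (hB : H.IsBal B) (m : M) (z : R) :
    H.IsBal (fun x y : R => B (m <• x) (z * y)) := hB.comp

/-- The inner families may vary with `j`, so they are replaced first, for each `j`; the outer sum is
then balanced by `isBal_yd`. -/
theorem yd_of_sw {M : Type*} [AddCommGroup M] [Module k M] [Module Rᵐᵒᵖ M]
    [IsScalarTower k Rᵐᵒᵖ M] {δ : M →ₗ[k] H.Bal M R} (hδ : IsRightComodule H δ)
    (h : ∀ m X, sw (H.Δ X) (fun x y => sw (δ (m <• y)) fun l z => H.tmul l (x * z)) =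
      sw (δ m) (fun m₀ m₁ => sw (H.Δ X) fun x y => H.tmul (m₀ <• x) (m₁ * y)))
    (m : M) (X : R) (n : ℕ) (x y : Fin n → R) (p : ℕ) (m₀ : Fin p → M)
    (m₁ : Fin p → R) (q : Fin n → ℕ) (l : ∀ j, Fin (q j) → M) (z : ∀ j, Fin (q j) → R)
    (hX : H.Δ X = ∑ j, H.tmul (x j) (y j)) (hm : δ m = ∑ i, H.tmul (m₀ i) (m₁ i))
    (hl : ∀ j, δ (m <• y j) = ∑ i, H.tmul (l j i) (z j i)) :
    ∑ j, ∑ i, H.tmul (l j i) (x j * z j i) = ∑ j, ∑ i, H.tmul (m₀ i <• x j) (m₁ i * y j) := by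
  have hB' (x : R) : H.IsBal (fun (l : M) z => H.tmul l (x * z)) := H.isBal_tmul.comp
  have e (j) : ∑ i, H.tmul (l j i) (x j * z j i) =
      sw (δ (m <• y j)) fun l z => H.tmul l (x j * z) := sum_sw (hB' _) (hl j)
  simp only [e]
  rw [sum_sw (isBal_yd hδ H.isBal_tmul m) hX, h, Finset.sum_comm]
  refine (sum_sw (H.isBal_tmul.sw_diag X) hm).symm.trans (Finset.sum_congr rfl fun i _ => ?_)
  exact (sum_sw (isBal_rsmul_mul H.isBal_tmul (m₀ i) (m₁ i)) hX).symm

variable (M N P : YDRR H)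

theorem isBal_coact_right {B : H.Bal M.carrier N.carrier → R → Q} (hB : H.IsBal B)
    (m : M.carrier) (z : R) :
    H.IsBal (fun (n : N.carrier) z' => B (H.tmul m n) (z * z')) :=
  hB.comp (hf := by intros; rw [H.tmul_rsmul_s])

/-- Moving `a` from `m` to `n₀` and then to the coefficient is the Takeuchi condition for the
coaction of `N`. -/
theorem isBal_coact_left {B : H.Bal M.carrier N.carrier → R → Q} (hB : H.IsBal B)
    (n : N.carrier) : H.IsBal (fun (m : M.carrier) z =>
      sw (N.δ n) fun n₀ z' => B (H.tmul m n₀) (z * z')) where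
  add_left m m' z := by simp [hB.add_left, sw_add_fun]
  add_right m z z' := by simp [add_mul, hB.add_right, sw_add_fun]
  bal m a z := by
    simp only [MulOpposite.smul_eq_mul_unop, MulOpposite.unop_op, mul_assoc, tmul_bal]
    exact N.comodule.sw_takeuchi (isBal_coact_right M N hB m z) n a

/-- Both `m ◁ s a` and `n ◁ t a` insert the factor `s a` between the coefficients `z` and `z'`. -/
theorem isBal_coact {B : H.Bal M.carrier N.carrier → R → Q} (hB : H.IsBal B) :
    H.IsBal (fun (m : M.carrier) (n : N.carrier) =>
      sw (M.δ m) fun m₀ z => sw (N.δ n) fun n₀ z' => B (H.tmul m₀ n₀) (z * z')) where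
  add_left m m' n := by rw [map_add, sw_add (isBal_coact_left M N hB n)]
  add_right m n n' := by
    simp only [map_add, sw_add (isBal_coact_right M N hB _ _), sw_add_fun]
  bal m a n := by
    rw [M.comodule.sw_s (isBal_coact_left M N hB n)]
    simp only [N.comodule.sw_t (isBal_coact_right M N hB _ _), mul_assoc]

/-- The diagonal coaction. -/
noncomputable def tensorδ :
    H.Bal M.carrier N.carrier →ₗ[k] H.Bal (H.Bal M.carrier N.carrier) R :=
  liftₗ _ (isBal_coact M N H.isBal_tmul) (fun c m n => by
    rw [map_smul]
    refine sw_smul (isBal_coact_left M N H.isBal_tmul n) (fun c m z => ?_) c _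
    simp only [smul_tmul, smul_sw])

theorem tensorδ_tmul (m : M.carrier) (n : N.carrier) : tensorδ M N (H.tmul m n) =
    sw (M.δ m) fun m₀ z => sw (N.δ n) fun n₀ z' => H.tmul (H.tmul m₀ n₀) (z * z') := rfl

theorem sw_tensorδ {B : H.Bal M.carrier N.carrier → R → Q} (hB : H.IsBal B)
    (m : M.carrier) (n : N.carrier) : sw (tensorδ M N (H.tmul m n)) B =
    sw (M.δ m) fun m₀ z => sw (N.δ n) fun n₀ z' => B (H.tmul m₀ n₀) (z * z') := by
  rw [tensorδ_tmul, sw_sw hB]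
  simp only [sw_sw hB, sw_tmul hB]

/-- Proved ahead of `tensor_comodule`, where coassociativity already needs it through
`isBal_tmulLeft_δ`. -/
theorem tensorδ_s (w : H.Bal M.carrier N.carrier) (a : A) :
    tensorδ M N (w <• H.s a) = sw (tensorδ M N w) (fun x z => H.tmul x (z * H.s a)) := by
  have hs := isBal_tmul_mul_s (E := H.toSourceTarget) (M := H.Bal M.carrier N.carrier) a
  rw [sw_eq_lift hs]
  refine addHom_ext ((tensorδ M N).toAddMonoidHom.comp (DistribSMul.toAddMonoidHom _
    (MulOpposite.op (H.s a)))) ((lift _ hs).comp (tensorδ M N).toAddMonoidHom)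
    (fun m n => ?_) w
  simp only [AddMonoidHom.comp_apply, DistribSMul.toAddMonoidHom_apply, H.tmul_rsmul_s,
    ← sw_eq_lift hs, LinearMap.toAddMonoidHom_coe]
  rw [tensorδ_tmul, sw_tensorδ M N hs]
  simp only [N.comodule.sw_s (isBal_coact_right M N H.isBal_tmul _ _), mul_assoc]

section
variable {M N} {W : H.Bal M.carrier N.carrier → R → R → Q} (hW : H.IsBal₃ W)
include hW

theorem isBal₃_coassoc_right (m : M.carrier) (y z : R) :
    H.IsBal₃ (fun (n : N.carrier) u v => W (H.tmul m n) (y * u) (z * v)) :=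
  hW.comp (hf := by intros; rw [H.tmul_rsmul_s])

theorem isBal_coassoc_right (m : M.carrier) (y z : R) :
    H.IsBal (fun (n : N.carrier) v => sw (H.Δ v) fun v₁ v₂ =>
      W (H.tmul m n) (y * v₁) (z * v₂)) := by
  have h := isBal₃_coassoc_right hW m y z
  refine ⟨fun n n' v => ?_, fun n v v' => ?_, fun n a v => ?_⟩
  · simp only [h.add_left, sw_add_fun]
  · rw [map_add, sw_add (h.right n)]
  · simp only [MulOpposite.smul_eq_mul_unop, MulOpposite.unop_op]
    rw [H.sw_Δ_mul_t (h.right n)]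
    simp only [h.bal_left, MulOpposite.smul_eq_mul_unop, MulOpposite.unop_op]

/-- The two balance conditions are the Takeuchi conditions for the coaction of `N` and for `Δ`. -/
theorem isBal₃_coassoc_left (n : N.carrier) :
    H.IsBal₃ (fun (m : M.carrier) y z => sw (N.δ n) fun n₀ v => sw (H.Δ v) fun v₁ v₂ =>
      W (H.tmul m n₀) (y * v₁) (z * v₂)) where
  add_left m m' y z := by simp only [add_tmul, hW.add_left, sw_add_fun]
  add_mid m y y' z := by simp only [add_mul, hW.add_mid, sw_add_fun]
  add_right m y z z' := by simp only [add_mul, hW.add_right, sw_add_fun]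
  bal_left m a y z := by
    simp only [tmul_bal, MulOpposite.smul_eq_mul_unop, MulOpposite.unop_op, mul_assoc]
    rw [N.comodule.sw_takeuchi (isBal_coassoc_right hW m y z)]
    simp only [H.sw_Δ_t_mul ((isBal₃_coassoc_right hW m y z).right _)]
  bal_right m y a z := by
    simp only [MulOpposite.smul_eq_mul_unop, MulOpposite.unop_op, mul_assoc]
    simp only [H.sw_takeuchi ((isBal₃_coassoc_right hW m y z).right _)]

end

theorem tensor_comodule : IsRightComodule H (tensorδ M N) := by
  have ht (a : A) := isBal_tmul_mul (E := H.toSourceTarget) (M := H.Bal M.carrier N.carrier) (H.s a)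
  have ht' (a : A) := isBal_tmul_mul (E := H.toSourceTarget) (M := H.Bal M.carrier N.carrier) (H.t a)
  have ht'' (a : A) :=
    isBal_rsmul_t_tmul (E := H.toSourceTarget) (M := H.Bal M.carrier N.carrier) (N := R) a
  refine .of_sw (fun w a => ?_) (fun w a => ?_) (fun w a => ?_) (fun w => ?_) (fun w => ?_)
  · exact tensorδ_s M N w a
  · rw [sw_eq_lift (ht a)]
    refine addHom_ext ((tensorδ M N).toAddMonoidHom.comp (DistribSMul.toAddMonoidHom _
      (MulOpposite.op (H.t a)))) ((lift _ (ht a)).comp (tensorδ M N).toAddMonoidHom)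
      (fun m n => ?_) w
    simp only [AddMonoidHom.comp_apply, DistribSMul.toAddMonoidHom_apply, H.tmul_rsmul_t,
      ← sw_eq_lift (ht a), LinearMap.toAddMonoidHom_coe]
    rw [tensorδ_tmul, sw_tensorδ M N (ht a)]
    simp only [M.comodule.sw_t (isBal_coact_left M N H.isBal_tmul _), mul_assoc]
  · rw [sw_eq_lift (ht' a), sw_eq_lift (ht'' a)]
    refine addHom_ext ((lift _ (ht'' a)).comp (tensorδ M N).toAddMonoidHom)
      ((lift _ (ht' a)).comp (tensorδ M N).toAddMonoidHom) (fun m n => ?_) w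
    simp only [AddMonoidHom.comp_apply, ← sw_eq_lift (ht' a), ← sw_eq_lift (ht'' a),
      LinearMap.toAddMonoidHom_coe]
    rw [sw_tensorδ M N (ht' a), sw_tensorδ M N (ht'' a)]
    simp only [H.tmul_rsmul_t, ← mul_assoc]
    exact M.comodule.sw_takeuchi (isBal_coact_left M N H.isBal_tmul n) m a
  · have h₁ := IsRightComodule.isBal_tmulLeft_δ (tensorδ_s M N)
    have h₂ := IsRightComodule.isBal_tmulRight_Δ (H := H) (M := H.Bal M.carrier N.carrier)
    rw [sw_eq_lift h₁, sw_eq_lift h₂]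
    refine addHom_ext ((lift _ h₁).comp (tensorδ M N).toAddMonoidHom)
      ((lift _ h₂).comp (tensorδ M N).toAddMonoidHom) (fun m n => ?_) w
    simp only [AddMonoidHom.comp_apply, ← sw_eq_lift h₁, ← sw_eq_lift h₂,
      LinearMap.toAddMonoidHom_coe]
    rw [sw_tensorδ M N h₁, sw_tensorδ M N h₂]
    have hW := H.isBal₃_tmul (M := H.Bal M.carrier N.carrier) (N := R) (L := R)
    simp only [tensorδ_tmul, tmulLeft_sw, tmulLeft_tmul]
    have e (z z' : R) (m : H.Bal M.carrier N.carrier) : H.tmulRight m (H.Δ (z * z')) =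
        sw (H.Δ z) fun x y => sw (H.Δ z') fun x' y' =>
          H.tmulRight m (H.tmul (x * x') (y * y')) := by
      rw [← H.sw_Δ_mul (hW.right m), ← map_sw, sw_tmul_self]
    simp only [e]
    -- The sums are reordered so that coassociativity of `N` applies inside that of `M`.
    refine (sw_congr fun m₀ z => sw_comm _ _ _).trans ?_
    refine (sw_congr fun m₀ z => sw_congr fun p y => N.comodule.sw_coassoc
      (isBal₃_coassoc_right hW p y z) n).trans ?_
    refine (M.comodule.sw_coassoc (isBal₃_coassoc_left hW n) m).trans ?_
    exact sw_congr fun m₀ z => sw_comm _ _ _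
  · have h₁ := IsRightComodule.isBal_rsmul_ε (H := H) (M := H.Bal M.carrier N.carrier)
    rw [sw_eq_lift h₁]
    refine addHom_ext ((lift _ h₁).comp (tensorδ M N).toAddMonoidHom) (AddMonoidHom.id _)
      (fun m n => ?_) w
    simp only [AddMonoidHom.comp_apply, ← sw_eq_lift h₁,
      LinearMap.toAddMonoidHom_coe, AddMonoidHom.id_apply]
    rw [sw_tensorδ M N h₁]
    -- Here `ε(z z') = ε(s(ε z) z')`, and `s(ε z)` is absorbed into the coaction of `n ◁ t(ε z)`;
    -- the counit of `N` then applies.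
    have e (z : R) : sw (N.δ n) (fun x z' => x <• H.s (H.ε (z * z'))) = n <• H.t (H.ε z) := by
      refine (sw_congr fun x z' => by rw [← H.ε_s]).trans ?_
      exact (N.comodule.sw_t IsRightComodule.isBal_rsmul_ε _ _).symm.trans (N.comodule.sw_counit _)
    simp only [H.tmul_rsmul_s, ← tmul_sw, e, ← tmul_bal, ← sw_tmul_left, M.comodule.sw_counit]

section
variable {M N} {B : H.Bal M.carrier N.carrier → R → Q} (hB : H.IsBal B)
include hB

theorem isBal₃_yd_fst (m : M.carrier) (n : N.carrier) :
    H.IsBal₃ (fun x y y' : R => sw (M.δ (m <• y)) fun m₀ z => sw (N.δ (n <• y')) fun n₀ z' =>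
      B (H.tmul m₀ n₀) (x * (z * z'))) := by
  have hx (x : R) : H.IsBal (fun m z => B m (x * z)) := hB.comp
  have h₁ (x : R) (n : N.carrier) := isBal_coact_left M N (hx x) n
  have h₂ (x : R) (m : M.carrier) (z : R) := isBal_coact_right M N (hx x) m z
  refine ⟨fun x x' y y' => ?_, fun x y₁ y₂ y' => ?_, fun x y y₁ y₂ => ?_, fun x a y y' => ?_,
    fun x y a y' => ?_⟩
  · simp only [add_mul, hB.add_right, sw_add_fun]
  · rw [MulOpposite.op_add, add_smul, map_add, sw_add (h₁ x _)]
  · simp only [MulOpposite.op_add, add_smul, map_add, sw_add (h₂ x _ _), sw_add_fun]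
  · simp only [MulOpposite.smul_eq_mul_unop, MulOpposite.unop_op, rsmul_mul, mul_assoc,
      M.comodule.sw_t (h₁ x _)]
  · simp only [MulOpposite.smul_eq_mul_unop, MulOpposite.unop_op, rsmul_mul, mul_assoc,
      M.comodule.sw_s (h₁ x _), N.comodule.sw_t (h₂ x _ _)]

theorem isBal₃_yd_mid (m : M.carrier) (n : N.carrier) (z : R) :
    H.IsBal₃ (fun x y y' : R => sw (N.δ (n <• y')) fun n₀ z' =>
      B (H.tmul (m <• x) n₀) (z * (y * z'))) := by
  have h₂ (m : M.carrier) (z : R) := isBal_coact_right M N hB m z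
  have h₃ (m : M.carrier) (z y : R) : H.IsBal fun (n₀ : N.carrier) z' =>
      B (H.tmul m n₀) (z * (y * z')) := (h₂ m (z * y)).congr (by simp [mul_assoc])
  refine ⟨fun x x' y y' => ?_, fun x y₁ y₂ y' => ?_, fun x y y₁ y₂ => ?_, fun x a y y' => ?_,
    fun x y a y' => ?_⟩
  · simp only [MulOpposite.op_add, add_smul, add_tmul, hB.add_left, sw_add_fun]
  · simp only [add_mul, mul_add, hB.add_right, sw_add_fun]
  · simp only [MulOpposite.op_add, add_smul, map_add, sw_add (h₃ _ _ _)]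
  · simp only [MulOpposite.smul_eq_mul_unop, MulOpposite.unop_op, rsmul_mul, mul_assoc, tmul_bal]
    exact N.comodule.sw_takeuchi (h₃ _ _ _) _ a
  · simp only [MulOpposite.smul_eq_mul_unop, MulOpposite.unop_op, rsmul_mul, mul_assoc,
      N.comodule.sw_t (h₃ _ _ _)]

theorem isBal₃_yd_snd (m : M.carrier) (n : N.carrier) (z : R) :
    H.IsBal₃ (fun x y y' : R => B (H.tmul (m <• x) (n <• y)) (z * y')) where
  add_left x x' y z := by simp [add_smul, hB.add_left]
  add_mid x x' y z := by simp [add_smul, hB.add_left]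
  add_right x x' y z := by simp [mul_add, hB.add_right]
  bal_left x a y y' := by
    simp only [MulOpposite.smul_eq_mul_unop, MulOpposite.unop_op, rsmul_mul, tmul_bal]
  bal_right x y a y' := by
    simp only [MulOpposite.smul_eq_mul_unop, MulOpposite.unop_op, rsmul_mul, ← H.tmul_rsmul_s,
      hB.bal, mul_assoc]

end

/-- With `X₁ ⊗ X₂ ⊗ X₃`, the condition of `M` is applied to the first two legs and that of `N` to
the last two; coassociativity of `Δ` regroups the legs before, between and after. -/
theorem tensor_yd (w : H.Bal M.carrier N.carrier) (X : R) :
    sw (H.Δ X) (fun x y => sw (tensorδ M N (w <• y)) fun l z => H.tmul l (x * z)) =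
      sw (tensorδ M N w) (fun m₀ m₁ => sw (H.Δ X) fun x y => H.tmul (m₀ <• x) (m₁ * y)) := by
  have hB := H.isBal_tmul (M := H.Bal M.carrier N.carrier) (N := R)
  have hx (x : R) := isBal_tmul_mul (E := H.toSourceTarget) (M := H.Bal M.carrier N.carrier) x
  have h₂ := hB.sw_diag X
  simp only [MulOpposite.smul_eq_mul_unop, MulOpposite.unop_op] at h₂
  induction w using bal_induction with
  | h0 => simp only [smul_zero, map_zero, sw_zero (hx _), sw_zero h₂, sw_zero_fun]
  | h2 w w' hw hw' =>
    simp only [smul_add, map_add, sw_add (hx _), sw_add h₂, sw_add_fun, hw, hw']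
  | h1 m n =>
  rw [sw_tensorδ M N h₂]
  simp only [H.tmul_rsmul, map_sw, sw_sw (hx _), sw_tensorδ M N (hx _), sw_tmul_left,
    mul_assoc]
  refine (H.sw_coassoc (isBal₃_yd_fst hB m n) X).symm.trans ?_
  refine (sw_congr fun x y => (sw_congr fun _ _ => ?_).trans
    (M.sw_yd (isBal_coact_left M N hB (n <• y)) m x)).trans ?_
  · simp only [mul_assoc]
  rw [sw_comm]
  refine sw_congr fun m₀ z => ?_
  simp only [mul_assoc]
  refine (H.sw_coassoc (isBal₃_yd_mid hB m₀ n z) X).trans ?_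
  refine (sw_congr fun x y => N.sw_yd (isBal_coact_right M N hB (m₀ <• x) z) n y).trans ?_
  rw [sw_comm]
  refine sw_congr fun n₀ z' => ?_
  simpa only [mul_assoc] using (H.sw_coassoc (isBal₃_yd_snd hB m₀ n₀ (z * z')) X).symm

/-- The tensor product of right-right Yetter-Drinfeld modules. -/
noncomputable abbrev tensor : YDRR H where
  carrier := H.Bal M.carrier N.carrier
  δ := tensorδ M N
  comodule := tensor_comodule M N
  yd := yd_of_sw (tensor_comodule M N) (tensor_yd M N)

theorem isBal_mul_s_ε : H.IsBal (fun x y : R => x * H.s (H.ε y)) :=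
  IsRightComodule.isBal_rsmul_ε

theorem isBal_mul_t_ε : H.IsBal (fun x y : R => y * H.t (H.ε x)) :=
  ⟨by simp [mul_add], by simp [add_mul], by simp [H.ε_mul_s, H.t_mul, mul_assoc]⟩

/-- The counit law for `s a * X`. This identity and the next one control the diagonal action when a
tensor factor is the unit object, where `a ◁ y = ε(s a * y)`. -/
theorem sw_mul_s_ε (X : R) (a : A) :
    sw (H.Δ X) (fun x y => x * H.s (H.ε (H.s a * y))) = H.s a * X := by
  rw [← H.sw_Δ_s_mul isBal_mul_s_ε, H.sw_counit_right]

theorem sw_mul_t_ε (X : R) (a : A) :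
    sw (H.Δ X) (fun x y => y * H.t (H.ε (H.s a * x))) = H.t a * X := by
  rw [H.sw_takeuchi isBal_mul_t_ε]
  simp only [mul_assoc, ← mul_sw, H.sw_counit_left]

variable (H)

/-- The unit coaction `a ↦ 1 ⊗ s a`. -/
noncomputable def unitδ : H.UnitSpace →ₗ[k] H.Bal H.UnitSpace R where
  toFun a := H.tmul (H.toUnit 1) (H.s (H.toUnit.symm a))
  map_add' a b := by simp
  map_smul' c a := by simp [tmul_smul]

theorem unitδ_toUnit (a : A) : unitδ H (H.toUnit a) = H.tmul (H.toUnit 1) (H.s a) := rfl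

theorem unitδ_s (w : H.UnitSpace) (a : A) :
    unitδ H (w <• H.s a) = sw (unitδ H w) (fun x z => H.tmul x (z * H.s a)) := by
  obtain ⟨b, rfl⟩ := H.toUnit.surjective w
  rw [H.unit_rsmul_s, unitδ_toUnit, unitδ_toUnit, sw_tmul (isBal_tmul_mul_s a), map_mul]

theorem unit_comodule : IsRightComodule H (unitδ H) := by
  refine .of_sw (fun w a => ?_) (fun w a => ?_) (fun w a => ?_) (fun w => ?_) (fun w => ?_) <;>
    obtain ⟨b, rfl⟩ := H.toUnit.surjective w
  · exact unitδ_s H _ a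
  · rw [H.unit_rsmul_t, unitδ_toUnit, unitδ_toUnit, sw_tmul (isBal_tmul_mul _), map_mul]
  · rw [unitδ_toUnit, sw_tmul (isBal_tmul_mul _), sw_tmul (isBal_rsmul_t_tmul a),
      H.unit_rsmul_t, mul_one, ← H.s_comm_t, ← tmul_bal_mul, H.unit_rsmul_s, one_mul]
  · rw [unitδ_toUnit, sw_tmul IsRightComodule.isBal_tmulRight_Δ,
      sw_tmul (IsRightComodule.isBal_tmulLeft_δ (unitδ_s H)), unitδ_toUnit, H.Δ_s, map_one H.s,
      tmulLeft_tmul]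
  · rw [unitδ_toUnit, sw_tmul IsRightComodule.isBal_rsmul_ε, H.unit_rsmul_s, one_mul,
      ← one_mul (H.s b), H.ε_mul_s, H.ε_one, one_mul]

/-- The unit object. -/
noncomputable abbrev unitObj : YDRR H where
  carrier := H.UnitSpace
  δ := unitδ H
  comodule := unit_comodule H
  yd := yd_of_sw (unit_comodule H) fun w X => by
    obtain ⟨b, rfl⟩ := H.toUnit.surjective w
    have h₂ := (H.isBal_tmul (M := H.UnitSpace) (N := R)).sw_diag X
    simp only [MulOpposite.smul_eq_mul_unop, MulOpposite.unop_op] at h₂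
    rw [unitδ_toUnit, sw_tmul h₂]
    simp only [H.unit_rsmul, unitδ_toUnit, sw_tmul (isBal_tmul_mul _), ← tmul_sw, sw_mul_s_ε]
    have e (x : R) : H.toUnit (H.ε (H.s 1 * x)) = H.toUnit 1 <• H.s (H.ε x) := by
      rw [H.unit_rsmul_s, map_one, one_mul, one_mul]
    simp only [e, tmul_bal_mul, mul_assoc, ← tmul_sw, ← mul_sw, H.sw_counit_left]

end YDRR
end YD

/-! ### Morphisms of right-right Yetter-Drinfeld modules. -/

section

variable {k : Type*} {A : Type u} {R : Type*} [Field k] [Ring A] [Algebra k A] [Ring R]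
  [Algebra k R] {Q : Type*} [AddCommGroup Q] {H : RightBialgebroid k A R}

namespace YDRR

/-- The underlying linear map of a morphism. -/
def ap {M N : YDRR H} (f : M ⟶ N) : M.carrier →ₗ[Rᵐᵒᵖ] N.carrier := Hom.toLin f

@[simp] theorem ap_comp {M N P : YDRR H} (f : M ⟶ N) (g : N ⟶ P) (m : M.carrier) :
    ap (f ≫ g) m = ap g (ap f m) := rfl

@[simp] theorem ap_id (M : YDRR H) (m : M.carrier) : ap (𝟙 M) m = m := rfl

theorem hom_ext {M N : YDRR H} {f g : M ⟶ N} (h : ∀ m, ap f m = ap g m) : f = g :=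
  Hom.ext (LinearMap.ext h)

section
variable {M N : YDRR H} (f : M ⟶ N)

theorem isBal_ap_tmul {L L' : Type*} [AddCommGroup L] [Module k L] [Module Rᵐᵒᵖ L]
    [IsScalarTower k Rᵐᵒᵖ L]
    [AddCommGroup L'] [Module k L'] [Module Rᵐᵒᵖ L'] [IsScalarTower k Rᵐᵒᵖ L']
    (f : L →ₗ[Rᵐᵒᵖ] L') {B : L' → R → Q} (hB : H.IsBal B) :
    H.IsBal (fun m (z : R) => B (f m) z) :=
  hB.comp (g := id) (hf := by intros; simp) (hg := by intros; rfl) (f_add := by intros; simp)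
    (g_add := by intros; rfl)

theorem δ_ap (m : M.carrier) : N.δ (ap f m) = sw (M.δ m) (fun x z => H.tmul (ap f x) z) :=
  Hom.colinear f m _ _ _ (rep_spec _)

theorem sw_δ_ap {B : N.carrier → R → Q} (hB : H.IsBal B) (m : M.carrier) :
    sw (N.δ (ap f m)) B = sw (M.δ m) (fun x z => B (ap f x) z) := by
  rw [δ_ap, sw_sw hB]
  exact sw_congr fun _ _ => sw_tmul hB _ _

end

/-- Constructor for morphisms. -/
def mkHom {M N : YDRR H} (f : M.carrier →+ N.carrier) (hf : ∀ m (X : R), f (m <• X) = f m <• X)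
    (hδ : ∀ m, N.δ (f m) = sw (M.δ m) (fun x z => H.tmul (f x) z)) : M ⟶ N :=
  Hom.mk { f with map_smul' := fun X m => hf m X.unop } fun m n x z h => by
    refine (hδ m).trans (sw_rep (B := fun x z => H.tmul (f x) z) ?_ h)
    exact isBal_ap_tmul ({ f with map_smul' := fun X m => hf m X.unop } :
      M.carrier →ₗ[Rᵐᵒᵖ] N.carrier) H.isBal_tmul

/-- Constructor for isomorphisms. -/
def mkIso {M N : YDRR H} (f : M ⟶ N) (g : N.carrier → M.carrier) (hg : ∀ m, g (ap f m) = m)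
    (hg' : ∀ n, ap f (g n) = n) : M ≅ N where
  hom := f
  -- A set-theoretic inverse of a morphism is automatically additive, linear and colinear: each
  -- identity is checked after cancelling `f` against `g`.
  inv := mkHom
    { toFun := g
      map_zero' := by rw [← map_zero (ap f), hg]
      map_add' := fun x y => by rw [← hg (g x + g y), map_add, hg', hg'] }
    (fun n X => by
      change g (n <• X) = g n <• X
      rw [← hg (g n <• X), map_smul, hg'])
    (fun n => by
      change M.δ (g n) = sw (N.δ n) (fun x z => H.tmul (g x) z)
      have hb : H.IsBal (fun x (z : R) => H.tmul (g x) z) := by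
        refine ⟨fun x y z => ?_, by simp, fun x a z => ?_⟩
        · rw [← add_tmul, ← hg (g x + g y), map_add, hg', hg']
        · rw [← tmul_bal, ← hg (g x <• H.s a), map_smul, hg']
      conv_rhs => rw [← hg' n]
      rw [sw_δ_ap f hb]
      simp only [hg, sw_tmul_self])
  hom_inv_id := hom_ext hg
  inv_hom_id := hom_ext hg'

variable {M N P M' N' : YDRR H}

theorem tensor_hom_ext {f g : tensor M N ⟶ P}
    (h : ∀ m n, ap f (H.tmul m n) = ap g (H.tmul m n)) : f = g :=
  hom_ext fun w => addHom_ext (ap f) (ap g) h w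

theorem isBal_tensorHom (f : M ⟶ M') (g : N ⟶ N') :
    H.IsBal (fun (m : M.carrier) (n : N.carrier) => H.tmul (ap f m) (ap g n)) :=
  H.isBal_tmul.comp (hf := by intros; simp) (hg := by intros; simp) (f_add := by intros; simp)
    (g_add := by intros; simp)

/-- Constructor for morphisms out of a tensor product. -/
noncomputable def tensorMk (B : M.carrier → N.carrier → P.carrier) (hB : H.IsBal B)
    (hl : ∀ m n (X : R), sw (H.Δ X) (fun x y => B (m <• x) (n <• y)) = B m n <• X)
    (hc : ∀ m n, P.δ (B m n) = sw (M.δ m) (fun m₀ z => sw (N.δ n) fun n₀ z' =>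
      H.tmul (B m₀ n₀) (z * z'))) : tensor M N ⟶ P :=
  have hf (w : H.Bal M.carrier N.carrier) (X : R) : lift B hB (w <• X) = lift B hB w <• X := by
    refine addHom_ext ((lift B hB).comp (DistribSMul.toAddMonoidHom _ (MulOpposite.op X)))
      ((DistribSMul.toAddMonoidHom _ (MulOpposite.op X)).comp (lift B hB)) (fun m n => ?_) w
    simp only [AddMonoidHom.comp_apply, DistribSMul.toAddMonoidHom_apply, H.tmul_rsmul, map_sw,
      lift_tmul, hl]
  have hb : H.IsBal (fun x (z : R) => H.tmul (lift B hB x) z) :=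
    isBal_ap_tmul ({ lift B hB with map_smul' := fun X w => hf w X.unop } :
      H.Bal M.carrier N.carrier →ₗ[Rᵐᵒᵖ] P.carrier) H.isBal_tmul
  mkHom (M := tensor M N) (lift B hB) hf fun w => by
    rw [sw_eq_lift hb]
    refine addHom_ext (P.δ.toAddMonoidHom.comp (lift B hB))
      ((lift _ hb).comp (tensorδ M N).toAddMonoidHom) (fun m n => ?_) w
    simp only [AddMonoidHom.comp_apply, LinearMap.toAddMonoidHom_coe, lift_tmul,
      ← sw_eq_lift hb, sw_tensorδ M N hb, hc]

@[simp] theorem ap_tensorMk (B : M.carrier → N.carrier → P.carrier) (hB : H.IsBal B)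
    (hl : ∀ m n (X : R), sw (H.Δ X) (fun x y => B (m <• x) (n <• y)) = B m n <• X)
    (hc : ∀ m n, P.δ (B m n) = sw (M.δ m) (fun m₀ z => sw (N.δ n) fun n₀ z' =>
      H.tmul (B m₀ n₀) (z * z'))) (m : M.carrier) (n : N.carrier) :
    ap (tensorMk B hB hl hc) (H.tmul m n) = B m n := rfl

/-- The tensor product of morphisms. -/
noncomputable def tensorHom (f : M ⟶ M') (g : N ⟶ N') : tensor M N ⟶ tensor M' N' :=
  tensorMk _ (isBal_tensorHom f g)
    (fun m n X => by simp only [map_smul, H.tmul_rsmul])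
    (fun m n => by
      rw [tensorδ_tmul, sw_δ_ap f (isBal_coact_left M' N' H.isBal_tmul _)]
      exact sw_congr fun m₀ z => sw_δ_ap g (isBal_coact_right M' N' H.isBal_tmul _ _) n)

@[simp] theorem ap_tensorHom (f : M ⟶ M') (g : N ⟶ N') (m : M.carrier) (n : N.carrier) :
    ap (tensorHom f g) (H.tmul m n) = H.tmul (ap f m) (ap g n) := rfl

end YDRR
end

/-! ### The monoidal category of right-right modules and its pre-braiding. -/

section

variable {k : Type*} {A : Type u} {R : Type*} [Field k] [Ring A] [Algebra k A] [Ring R]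
  [Algebra k R] {Q : Type*} [AddCommGroup Q] {H : RightBialgebroid k A R}

namespace YDRR

section Associator
variable (M N P : YDRR H)

theorem isBal_assoc_left (p : P.carrier) : H.IsBal (fun (m : M.carrier) (n : N.carrier) =>
    H.tmul m (H.tmul n p)) :=
  ⟨by simp, by simp, fun m a n => by rw [tmul_bal, H.tmul_rsmul_t]⟩

theorem isBal_assoc : H.IsBal (fun (w : H.Bal M.carrier N.carrier) (p : P.carrier) =>
    sw w fun m n => H.tmul m (H.tmul n p)) := by
  refine ⟨fun w w' p => sw_add (isBal_assoc_left M N P p) w w', fun w p p' => ?_,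
    fun w a p => ?_⟩
  · simp only [tmul_add, sw_add_fun]
  · have h := isBal_assoc_left M N P
    rw [sw_eq_lift (h _), sw_eq_lift (h _)]
    refine addHom_ext ((lift _ (h _)).comp (DistribSMul.toAddMonoidHom _
      (MulOpposite.op (H.s a)))) (lift _ (h _)) (fun m n => ?_) w
    simp only [AddMonoidHom.comp_apply, DistribSMul.toAddMonoidHom_apply, H.tmul_rsmul_s,
      lift_tmul, tmul_bal]

theorem isBal_assocInv_right (m : M.carrier) : H.IsBal (fun (n : N.carrier) (p : P.carrier) =>
    H.tmul (H.tmul m n) p) :=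
  ⟨by simp, by simp, fun n a p => by rw [← tmul_bal, H.tmul_rsmul_s]⟩

theorem isBal_assocInv : H.IsBal (fun (m : M.carrier) (w : H.Bal N.carrier P.carrier) =>
    sw w fun n p => H.tmul (H.tmul m n) p) := by
  refine ⟨fun m m' w => ?_, fun m w w' => sw_add (isBal_assocInv_right M N P m) w w',
    fun m a w => ?_⟩
  · simp only [add_tmul, sw_add_fun]
  · have h := isBal_assocInv_right M N P
    rw [sw_eq_lift (h _), sw_eq_lift (h _)]
    refine addHom_ext (lift _ (h _)) ((lift _ (h _)).comp (DistribSMul.toAddMonoidHom _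
      (MulOpposite.op (H.t a)))) (fun m n => ?_) w
    simp only [AddMonoidHom.comp_apply, DistribSMul.toAddMonoidHom_apply, H.tmul_rsmul_t,
      lift_tmul, tmul_bal]

theorem isBal₃_rsmul (m : M.carrier) (n : N.carrier) (p : P.carrier) :
    H.IsBal₃ (fun x y z : R => H.tmul (m <• x) (H.tmul (n <• y) (p <• z))) where
  add_left _ _ _ _ := by simp [add_smul]
  add_mid _ _ _ _ := by simp [add_smul]
  add_right _ _ _ _ := by simp [add_smul]
  bal_left _ _ _ _ := by
    simp only [MulOpposite.smul_eq_mul_unop, MulOpposite.unop_op, rsmul_mul, tmul_bal,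
      H.tmul_rsmul_t]
  bal_right _ _ _ _ := by
    simp only [MulOpposite.smul_eq_mul_unop, MulOpposite.unop_op, rsmul_mul, tmul_bal]

/-- Both bracketings are acted on by the iterated coproduct, so this is coassociativity of `Δ`. -/
theorem assoc_rsmul (w : H.Bal (H.Bal M.carrier N.carrier) P.carrier) (X : R) :
    lift _ (isBal_assoc M N P) (w <• X) = lift _ (isBal_assoc M N P) w <• X := by
  induction w using bal_induction with
  | h0 => simp only [smul_zero, map_zero]
  | h2 w w' hw hw' => simp only [smul_add, map_add, hw, hw']
  | h1 w p =>
    induction w using bal_induction with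
    | h0 => simp only [zero_tmul, smul_zero, map_zero]
    | h2 w w' hw hw' => simp only [add_tmul, smul_add, map_add, hw, hw']
    | h1 m n =>
      simp only [lift_tmul, sw_tmul (isBal_assoc_left M N P _), H.tmul_rsmul, map_sw, tmul_sw,
        sw_sw (isBal_assoc_left M N P _)]
      exact H.sw_coassoc (isBal₃_rsmul M N P m n p) X

/-- The associator as a linear map. -/
noncomputable def assocLin : H.Bal (H.Bal M.carrier N.carrier) P.carrier →ₗ[Rᵐᵒᵖ]
    H.Bal M.carrier (H.Bal N.carrier P.carrier) where
  __ := lift _ (isBal_assoc M N P)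
  map_smul' X w := assoc_rsmul M N P w X.unop

theorem assocLin_tmul (m : M.carrier) (n : N.carrier) (p : P.carrier) :
    assocLin M N P (H.tmul (H.tmul m n) p) = H.tmul m (H.tmul n p) :=
  sw_tmul (isBal_assoc_left M N P p) m n

/-- The associator as a morphism. -/
noncomputable def assocHom : tensor (tensor M N) P ⟶ tensor M (tensor N P) :=
  mkHom (M := tensor (tensor M N) P) (N := tensor M (tensor N P)) (assocLin M N P).toAddMonoidHom
    (fun w X => (assocLin M N P).map_smul (MulOpposite.op X) w) fun w => by
    have hB := H.isBal_tmul (M := H.Bal M.carrier (H.Bal N.carrier P.carrier)) (N := R)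
    have hb := isBal_ap_tmul (assocLin M N P) hB
    change tensorδ M (tensor N P) (assocLin M N P w) = sw (tensorδ (tensor M N) P w)
      fun x z => H.tmul (assocLin M N P x) z
    induction w using bal_induction with
    | h0 => simp only [map_zero, sw_zero hb]
    | h2 w w' hw hw' => simp only [map_add, sw_add hb, hw, hw']
    | h1 w p =>
      rw [sw_tensorδ (tensor M N) P hb]
      have hb' := isBal_coact_left (tensor M N) P hb p
      induction w using bal_induction with
      | h0 => simp only [zero_tmul, map_zero, sw_zero hb']
      | h2 w w' hw hw' => simp only [add_tmul, map_add, sw_add hb', hw, hw']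
      | h1 m n =>
        rw [assocLin_tmul, tensorδ_tmul, sw_tensorδ M N hb']
        refine sw_congr fun m₀ z => ?_
        rw [sw_tensorδ N P (isBal_coact_right M (tensor N P) hB m₀ z)]
        simp only [assocLin_tmul, mul_assoc]

/-- The associator. -/
noncomputable def assocIso : tensor (tensor M N) P ≅ tensor M (tensor N P) :=
  mkIso (assocHom M N P) (lift _ (isBal_assocInv M N P))
    (fun w => by
      induction w using bal_induction with
      | h0 => simp only [map_zero]
      | h2 w w' hw hw' => simp only [map_add, hw, hw']
      | h1 w p =>
        induction w using bal_induction with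
        | h0 => simp only [zero_tmul, map_zero]
        | h2 w w' hw hw' => simp only [add_tmul, map_add, hw, hw']
        | h1 m n =>
          refine (congrArg _ (assocLin_tmul M N P m n p)).trans ?_
          rw [lift_tmul, sw_tmul (isBal_assocInv_right M N P _)])
    (fun w => by
      induction w using bal_induction with
      | h0 => simp only [map_zero]
      | h2 w w' hw hw' => simp only [map_add, hw, hw']
      | h1 m w =>
        induction w using bal_induction with
        | h0 => simp only [tmul_zero, map_zero]
        | h2 w w' hw hw' => simp only [tmul_add, map_add, hw, hw']
        | h1 n p =>
          rw [lift_tmul, sw_tmul (isBal_assocInv_right M N P _)]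
          exact assocLin_tmul M N P m n p)

@[simp] theorem ap_assocIso_hom (m : M.carrier) (n : N.carrier) (p : P.carrier) :
    ap (assocIso M N P).hom (H.tmul (H.tmul m n) p) = H.tmul m (H.tmul n p) :=
  assocLin_tmul M N P m n p

@[simp] theorem ap_assocIso_inv (m : M.carrier) (n : N.carrier) (p : P.carrier) :
    ap (assocIso M N P).inv (H.tmul m (H.tmul n p)) = H.tmul (H.tmul m n) p := by
  rw [← ap_assocIso_hom, ← ap_comp, Iso.hom_inv_id, ap_id]

end Associator

section Unitors
variable (M : YDRR H)

theorem isBal_leftUnitor : H.IsBal (fun (a : H.UnitSpace) (m : M.carrier) =>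
    m <• H.t (H.toUnit.symm a)) := by
  refine ⟨by simp [add_smul], by simp, fun a b m => ?_⟩
  obtain ⟨a, rfl⟩ := H.toUnit.surjective a
  simp only [H.unit_rsmul_s, LinearEquiv.symm_apply_apply, H.t_mul, rsmul_mul]

theorem isBal_rightUnitor : H.IsBal (fun (m : M.carrier) (a : H.UnitSpace) =>
    m <• H.s (H.toUnit.symm a)) := by
  refine ⟨by simp, by simp [add_smul], fun m b a => ?_⟩
  obtain ⟨a, rfl⟩ := H.toUnit.surjective a
  simp only [H.unit_rsmul_t, LinearEquiv.symm_apply_apply, map_mul, rsmul_mul]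

theorem isBal_leftUnitor_coact (m : M.carrier) : H.IsBal (fun (a : H.UnitSpace) z =>
    sw (M.δ m) fun m₀ z' => H.tmul (m₀ <• H.t (H.toUnit.symm a)) (z * z')) := by
  refine ⟨?_, ?_, fun a b z => ?_⟩
  · intros; simp only [map_add, t_add, MulOpposite.op_add, add_smul, add_tmul, sw_add_fun]
  · intros; simp only [add_mul, tmul_add, sw_add_fun]
  · obtain ⟨a, rfl⟩ := H.toUnit.surjective a
    have h : H.IsBal fun (m : M.carrier) z' => H.tmul (m <• H.t a) (z * z') :=
      (isBal_rsmul_t_tmul a).comp (M' := M.carrier) (f := id) (hf := by intros; rfl)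
        (f_add := by intros; rfl)
    simp only [H.unit_rsmul_s, LinearEquiv.symm_apply_apply, H.t_mul, rsmul_mul,
      MulOpposite.smul_eq_mul_unop, MulOpposite.unop_op, mul_assoc]
    exact M.comodule.sw_takeuchi h m b

theorem isBal_rightUnitor_coact (m : M.carrier) (z : R) : H.IsBal (fun (a : H.UnitSpace) z' =>
    H.tmul (m <• H.s (H.toUnit.symm a)) (z * z')) := by
  refine ⟨?_, ?_, fun a b z => ?_⟩
  · intros; simp [add_smul]
  · intros; simp [mul_add]
  · obtain ⟨a, rfl⟩ := H.toUnit.surjective a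
    simp only [H.unit_rsmul_s, LinearEquiv.symm_apply_apply, map_mul, rsmul_mul, tmul_bal,
      MulOpposite.smul_eq_mul_unop, MulOpposite.unop_op, mul_assoc]

/-- The left unitor. -/
noncomputable def leftUnitorIso : tensor (unitObj H) M ≅ M :=
  mkIso (tensorMk _ (isBal_leftUnitor M)
    (fun a m X => by
      obtain ⟨a, rfl⟩ := H.toUnit.surjective a
      simp only [H.unit_rsmul, LinearEquiv.symm_apply_apply, ← rsmul_mul, ← rsmul_sw, sw_mul_t_ε])
    (fun a m => by
      obtain ⟨a, rfl⟩ := H.toUnit.surjective a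
      refine Eq.trans ?_ (sw_tmul (isBal_leftUnitor_coact M m) _ _).symm
      simp only [LinearEquiv.symm_apply_apply, t_one, MulOpposite.op_one, one_smul]
      exact (sw_tmul_self _).symm.trans (M.comodule.sw_t H.isBal_tmul m a)))
    (fun m => H.tmul (H.toUnit 1) m) (fun w => by
      induction w using bal_induction with
      | h0 => simp only [map_zero, tmul_zero]
      | h2 w w' hw hw' => simp only [map_add, tmul_add, hw, hw']
      | h1 a m =>
        obtain ⟨a, rfl⟩ := H.toUnit.surjective a
        rw [ap_tensorMk, ← tmul_bal, H.unit_rsmul_s, one_mul, LinearEquiv.symm_apply_apply])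
    (fun m => by rw [ap_tensorMk]; simp)

/-- The right unitor. -/
noncomputable def rightUnitorIso : tensor M (unitObj H) ≅ M :=
  mkIso (tensorMk _ (isBal_rightUnitor M)
    (fun m a X => by
      obtain ⟨a, rfl⟩ := H.toUnit.surjective a
      simp only [H.unit_rsmul, LinearEquiv.symm_apply_apply, ← rsmul_mul, ← rsmul_sw, sw_mul_s_ε])
    (fun m a => by
      obtain ⟨a, rfl⟩ := H.toUnit.surjective a
      refine Eq.trans ?_ (sw_congr fun m₀ z => sw_tmul (isBal_rightUnitor_coact M m₀ z) _ _).symm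
      simp only [LinearEquiv.symm_apply_apply, map_one H.s, MulOpposite.op_one, one_smul]
      exact (sw_tmul_self _).symm.trans (M.comodule.sw_s H.isBal_tmul m a)))
    (fun m => H.tmul m (H.toUnit 1)) (fun w => by
      induction w using bal_induction with
      | h0 => simp only [map_zero, zero_tmul]
      | h2 w w' hw hw' => simp only [map_add, add_tmul, hw, hw']
      | h1 m a =>
        obtain ⟨a, rfl⟩ := H.toUnit.surjective a
        rw [ap_tensorMk, tmul_bal, H.unit_rsmul_t, mul_one, LinearEquiv.symm_apply_apply])
    (fun m => by rw [ap_tensorMk]; simp)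

end Unitors

section Braiding
variable (M N : YDRR H)

theorem isBal_braid_inner (m : M.carrier) :
    H.IsBal (fun (n : N.carrier) (z : R) => H.tmul n (m <• z)) := H.isBal_tmul.comp (f := id)
      (hf := by intros; rfl) (f_add := by intros; rfl)

theorem isBal_braid : H.IsBal (fun (m : M.carrier) (n : N.carrier) =>
    sw (N.δ n) fun n₀ (z : R) => H.tmul n₀ (m <• z)) := by
  refine ⟨fun m m' n => ?_, fun m n n' => ?_, fun m a n => ?_⟩
  · simp only [smul_add, tmul_add, sw_add_fun]
  · rw [map_add, sw_add (isBal_braid_inner M N m)]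
  · rw [N.comodule.sw_t (isBal_braid_inner M N m)]
    simp only [rsmul_mul]

theorem isBal₃_braid_left (m : M.carrier) : H.IsBal₃ (fun (n : N.carrier) (u v : R) =>
    sw (M.δ (m <• v)) fun m₀ z => H.tmul (H.tmul n m₀) (u * z)) := by
  have h (n : N.carrier) (u : R) := isBal_coact_right N M H.isBal_tmul n u
  refine ⟨?_, ?_, ?_, fun n a u v => ?_, fun n u a v => ?_⟩
  · intros; simp only [add_tmul, sw_add_fun]
  · intros; simp only [add_mul, tmul_add, sw_add_fun]
  · intros; simp only [MulOpposite.op_add, add_smul, map_add, sw_add (h _ _)]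
  · simp only [tmul_bal, MulOpposite.smul_eq_mul_unop, MulOpposite.unop_op, mul_assoc]
    exact M.comodule.sw_takeuchi (h n u) _ a
  · simp only [MulOpposite.smul_eq_mul_unop, MulOpposite.unop_op, rsmul_mul,
      M.comodule.sw_t (h n _), mul_assoc]

theorem isBal₃_braid_right (m : M.carrier) (z : R) : H.IsBal₃ (fun (n : N.carrier) (u v : R) =>
    H.tmul (H.tmul n (m <• u)) (z * v)) := by
  refine ⟨?_, ?_, ?_, fun n a u v => ?_, fun n u a v => ?_⟩
  · intros; simp
  · intros; simp [add_smul]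
  · intros; simp [mul_add]
  · simp only [tmul_bal, MulOpposite.smul_eq_mul_unop, MulOpposite.unop_op, rsmul_mul]
  · simp only [MulOpposite.smul_eq_mul_unop, MulOpposite.unop_op, rsmul_mul, ← mul_assoc,
      ← tmul_bal_mul, H.tmul_rsmul_s]

theorem isBal_tmul_tmul (n : N.carrier) : H.IsBal (fun (m : M.carrier) (z : R) =>
    H.tmul (H.tmul n m) z) :=
  (isBal_coact_right N M H.isBal_tmul n 1).congr (by simp)

/-- The pre-braiding `m ⊗ n ↦ n₀ ⊗ m ◁ n₁`. -/
noncomputable def braid : tensor M N ⟶ tensor N M :=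
  tensorMk _ (isBal_braid M N)
    -- Linearity is the Yetter-Drinfeld condition of `N`, evaluated in the balanced function `n ⊗ z
    -- ↦ n ⊗ m ◁ z`.
    (fun m n X => by
      have h := N.sw_yd (isBal_braid_inner M N m) n X
      simp only [rsmul_mul] at h
      rw [sw_rsmul]
      exact h)
    -- Colinearity: coassociativity of `N` produces `n₀ ⊗ (m ◁ n₂)₀ ⊗ n₁ (m ◁ n₂)₁`, the condition
    -- of `M` rewrites it, and coassociativity of `N` is undone.
    (fun m n => by
      have h' : H.IsBal₃ _ := isBal₃_braid_left M N m
      rw [map_sw]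
      change (sw (N.δ n) fun n₀ z => tensorδ N M (H.tmul n₀ (m <• z))) = _
      simp only [tensorδ_tmul]
      refine (N.comodule.sw_coassoc h' n).trans ?_
      refine (sw_congr fun n₀ v => M.sw_yd (isBal_tmul_tmul M N n₀) m v).trans ?_
      rw [sw_comm]
      simp only [sw_tmul_left]
      exact sw_congr fun m₀ z => (N.comodule.sw_coassoc (isBal₃_braid_right M N m₀ z) n).symm)

@[simp] theorem ap_braid (m : M.carrier) (n : N.carrier) :
    ap (braid M N) (H.tmul m n) = sw (N.δ n) fun n₀ z => H.tmul n₀ (m <• z) := rfl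

end Braiding

section Monoidal
variable {M N P : YDRR H}

@[simp] theorem ap_leftUnitorIso_hom (a : A) (m : M.carrier) :
    ap (leftUnitorIso M).hom (H.tmul (H.toUnit a) m) = m <• H.t a := rfl

@[simp] theorem ap_rightUnitorIso_hom (a : A) (m : M.carrier) :
    ap (rightUnitorIso M).hom (H.tmul m (H.toUnit a)) = m <• H.s a := rfl

theorem tensor_hom_ext₃ {Q : YDRR H} {f g : tensor (tensor M N) P ⟶ Q}
    (h : ∀ m n p, ap f (H.tmul (H.tmul m n) p) = ap g (H.tmul (H.tmul m n) p)) : f = g := by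
  refine tensor_hom_ext fun w p => ?_
  induction w using bal_induction with
  | h0 => simp only [zero_tmul, map_zero]
  | h2 w w' hw hw' => simp only [add_tmul, map_add, hw, hw']
  | h1 m n => exact h m n p

theorem tensor_hom_ext₃' {Q : YDRR H} {f g : tensor M (tensor N P) ⟶ Q}
    (h : ∀ m n p, ap f (H.tmul m (H.tmul n p)) = ap g (H.tmul m (H.tmul n p))) : f = g := by
  refine tensor_hom_ext fun m w => ?_
  induction w using bal_induction with
  | h0 => simp only [tmul_zero, map_zero]
  | h2 w w' hw hw' => simp only [tmul_add, map_add, hw, hw']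
  | h1 n p => exact h m n p

theorem tensor_hom_ext₄ {Q Q' : YDRR H} {f g : tensor (tensor (tensor M N) P) Q ⟶ Q'}
    (h : ∀ m n p q, ap f (H.tmul (H.tmul (H.tmul m n) p) q) =
      ap g (H.tmul (H.tmul (H.tmul m n) p) q)) : f = g := by
  refine tensor_hom_ext₃ fun w p q => ?_
  induction w using bal_induction with
  | h0 => simp only [zero_tmul, map_zero]
  | h2 w w' hw hw' => simp only [add_tmul, map_add, hw, hw']
  | h1 m n => exact h m n p q

/-- Tensor product, unit and structure isomorphisms of Yetter-Drinfeld modules. -/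
@[reducible] noncomputable def monoidalCategoryStruct : MonoidalCategoryStruct (YDRR H) where
  tensorObj := tensor
  tensorUnit := unitObj H
  tensorHom := tensorHom
  whiskerLeft M _ _ f := tensorHom (𝟙 M) f
  whiskerRight f N := tensorHom f (𝟙 N)
  associator := assocIso
  leftUnitor := leftUnitorIso
  rightUnitor := rightUnitorIso

attribute [local instance] monoidalCategoryStruct

/-- The monoidal category of right-right Yetter-Drinfeld modules. -/
@[reducible] noncomputable def monoidalCategory : MonoidalCategory (YDRR H) := .ofTensorHom
  (id_tensorHom_id := fun M N => tensor_hom_ext fun m n => rfl)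
  (id_tensorHom := fun _ _ _ _ => rfl)
  (tensorHom_id := fun _ _ => rfl)
  (tensorHom_comp_tensorHom := fun _ _ _ _ => tensor_hom_ext fun m n => rfl)
  (associator_naturality := fun f g h => tensor_hom_ext₃ fun m n p => by
    change ap (assocIso _ _ _).hom (H.tmul (H.tmul (ap f m) (ap g n)) (ap h p)) =
      ap (tensorHom f (tensorHom g h)) (ap (assocIso _ _ _).hom (H.tmul (H.tmul m n) p))
    rw [ap_assocIso_hom, ap_assocIso_hom]
    rfl)
  (leftUnitor_naturality := fun {X Y} f => tensor_hom_ext fun a m => by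
    obtain ⟨a, rfl⟩ := H.toUnit.surjective a
    exact ((ap f).map_smul _ m).symm)
  (rightUnitor_naturality := fun {X Y} f => tensor_hom_ext fun m a => by
    obtain ⟨a, rfl⟩ := H.toUnit.surjective a
    exact ((ap f).map_smul _ m).symm)
  (pentagon := fun W X Y Z => tensor_hom_ext₄ fun m n p q => by
    change ap (tensorHom (𝟙 W) (assocIso X Y Z).hom) (ap (assocIso W (tensor X Y) Z).hom
      (H.tmul (ap (assocIso W X Y).hom (H.tmul (H.tmul m n) p)) q)) =
      ap (assocIso W X (tensor Y Z)).hom (ap (assocIso (tensor W X) Y Z).hom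
        (H.tmul (H.tmul (H.tmul m n) p) q))
    rw [ap_assocIso_hom, ap_assocIso_hom, ap_assocIso_hom, ap_tensorHom, ap_assocIso_hom,
      ap_assocIso_hom]
    rfl)
  (triangle := fun X Y => tensor_hom_ext₃ fun m a n => by
    obtain ⟨a, rfl⟩ := H.toUnit.surjective a
    change ap (tensorHom (𝟙 X) (leftUnitorIso Y).hom) (ap (assocIso X (unitObj H) Y).hom
      (H.tmul (H.tmul m (H.toUnit a)) n)) = H.tmul (m <• H.s a) n
    rw [ap_assocIso_hom, tmul_bal]
    rfl)

end Monoidal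

section PreBraiding

attribute [local instance] monoidalCategory

/-- The pre-braiding of the category of right-right Yetter-Drinfeld modules. -/
noncomputable def preBraiding : PreBraiding (YDRR H) where
  braid := braid
  naturality {X X' Y Y'} f g := tensor_hom_ext fun m n => by
    change ap (braid X' Y') (H.tmul (ap f m) (ap g n)) =
      ap (tensorHom g f) (ap (braid X Y) (H.tmul m n))
    rw [ap_braid, ap_braid, map_sw, sw_δ_ap g (isBal_braid_inner X' Y' _)]
    exact sw_congr fun y z => congrArg (H.tmul _) ((ap f).map_smul _ m).symm
  hexagon_forward X Y Z := tensor_hom_ext₃ fun m n p => by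
    change ap (assocIso Y Z X).hom (ap (braid X (tensor Y Z)) (ap (assocIso X Y Z).hom
      (H.tmul (H.tmul m n) p))) = ap (tensorHom (𝟙 Y) (braid X Z)) (ap (assocIso Y X Z).hom
        (H.tmul (ap (braid X Y) (H.tmul m n)) p))
    rw [ap_assocIso_hom, ap_braid, ap_braid, sw_tmul_left, map_sw, map_sw, map_sw]
    change sw (tensorδ Y Z (H.tmul n p)) _ = _
    -- The coefficient of `n ⊗ p` is the product `n₁ p₁`, and acting by it on `m` means acting
    -- twice.
    rw [sw_tensorδ Y Z (B := fun w z => ap (assocIso Y Z X).hom (H.tmul w (m <• z)))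
      ((isBal_braid_inner X (tensor Y Z) m).map _)]
    refine sw_congr fun n₀ z => ?_
    rw [ap_assocIso_hom, ap_tensorHom, ap_braid, tmul_sw]
    refine sw_congr fun p₀ z' => ?_
    rw [ap_assocIso_hom, rsmul_mul]
    rfl
  hexagon_reverse X Y Z := tensor_hom_ext₃' fun m n p => by
    change ap (assocIso Z X Y).inv (ap (braid (tensor X Y) Z) (ap (assocIso X Y Z).inv
      (H.tmul m (H.tmul n p)))) = ap (tensorHom (braid X Z) (𝟙 Y)) (ap (assocIso X Z Y).inv
        (H.tmul m (ap (braid Y Z) (H.tmul n p))))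
    rw [ap_assocIso_inv, ap_braid, ap_braid, tmul_sw, map_sw, map_sw, map_sw]
    have h : H.IsBal₃ (fun (p : Z.carrier) (u v : R) =>
        H.tmul (H.tmul p (m <• u)) (n <• v)) := by
      refine ⟨?_, ?_, ?_, fun p a u v => ?_, fun p u a v => ?_⟩
      · intros; simp only [add_tmul]
      · intros; simp only [MulOpposite.op_add, add_smul, tmul_add, add_tmul]
      · intros; simp only [MulOpposite.op_add, add_smul, tmul_add]
      · simp only [tmul_bal, MulOpposite.smul_eq_mul_unop, MulOpposite.unop_op, rsmul_mul]
      · simp only [MulOpposite.smul_eq_mul_unop, MulOpposite.unop_op, rsmul_mul, ← tmul_bal,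
          H.tmul_rsmul_s]
    -- The diagonal action of `p₁` on `m ⊗ n` involves `Δ p₁`; coassociativity of `Z` turns it into
    -- two successive coactions.
    refine Eq.trans (sw_congr fun p₀ z => ?_) ((Z.comodule.sw_coassoc h p).symm.trans
      (sw_congr fun p₀ z => ?_))
    · rw [H.tmul_rsmul, tmul_sw, map_sw]
      exact sw_congr fun y y' => ap_assocIso_inv _ _ _ _ _ _
    · rw [ap_assocIso_inv, ap_tensorHom, ap_braid, sw_tmul_left]
      rfl
  unit_right X := tensor_hom_ext fun m a => by
    obtain ⟨a, rfl⟩ := H.toUnit.surjective a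
    change ap (leftUnitorIso X).hom (ap (braid X (unitObj H)) (H.tmul m (H.toUnit a))) =
      ap (rightUnitorIso X).hom (H.tmul m (H.toUnit a))
    rw [ap_braid]
    change ap _ (sw (H.tmul (H.toUnit 1) (H.s a)) _) = _
    rw [sw_tmul (isBal_braid_inner X (unitObj H) m), ap_leftUnitorIso_hom, ap_rightUnitorIso_hom,
      t_one, MulOpposite.op_one, one_smul]
  unit_left X := tensor_hom_ext fun a m => by
    obtain ⟨a, rfl⟩ := H.toUnit.surjective a
    change ap (rightUnitorIso X).hom (ap (braid (unitObj H) X) (H.tmul (H.toUnit a) m)) =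
      ap (leftUnitorIso X).hom (H.tmul (H.toUnit a) m)
    rw [ap_braid, map_sw, ap_leftUnitorIso_hom]
    simp only [H.unit_rsmul]
    refine Eq.trans (sw_congr fun x z => ap_rightUnitorIso_hom _ _) ?_
    rw [← X.comodule.sw_t IsRightComodule.isBal_rsmul_ε, X.comodule.sw_counit]

end PreBraiding
end YDRR

/-! ### Restriction to finitely generated projective objects. -/

section FullSubcategory

namespace RRFGP

section

attribute [local instance] YDRR.monoidalCategory

theorem isMonoidal : ObjectProperty.IsMonoidal (fun M : YDRR H => H.RightFGP M.carrier) where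
  prop_unit := H.rightFGP_unit
  prop_tensor _ _ hM hN := H.rightFGP_tensor hM hN

attribute [local instance] isMonoidal

/-- The monoidal category of right finitely generated projective Yetter-Drinfeld modules. -/
@[reducible] noncomputable def monoidalCategory : MonoidalCategory (RRFGP H) :=
  ObjectProperty.fullMonoidalSubcategory _

end

attribute [local instance] monoidalCategory

variable (H) in
/-- The monoidal structure of `RRFGP H` is the diagonal one. -/
noncomputable def diagonal : RRDiagonal H where
  tens M N := LinearEquiv.refl k _
  unit := H.toUnit
  tens_act M N m m' X n x y hX := sw_rep (H.isBal_rsmul_rsmul H.isBal_tmul m m') hX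
  tens_coact M N m m' n x z n' x' z' hm hm' := by
    refine (sw_rep (YDRR.isBal_coact_left M.obj N.obj H.isBal_tmul m') hm).trans ?_
    exact Finset.sum_congr rfl fun i _ =>
      sw_rep (YDRR.isBal_coact_right M.obj N.obj H.isBal_tmul _ _) hm'
  unit_act a X := rfl
  unit_coact a := rfl
  hom_tens f g m m' := rfl
  assoc M N P m m' m'' := YDRR.ap_assocIso_hom _ _ _ _ _ _
  left_unit M a m := rfl
  right_unit M a m := rfl

/-- The pre-braiding of `RRFGP H`. -/
noncomputable def preBraiding : PreBraiding (RRFGP H) :=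
  letI := YDRR.monoidalCategory (H := H)
  { braid X Y := ObjectProperty.homMk (YDRR.preBraiding.braid X.obj Y.obj)
    naturality f g := ObjectProperty.hom_ext _ (YDRR.preBraiding.naturality f.hom g.hom)
    hexagon_forward X Y Z :=
      ObjectProperty.hom_ext _ (YDRR.preBraiding.hexagon_forward X.obj Y.obj Z.obj)
    hexagon_reverse X Y Z :=
      ObjectProperty.hom_ext _ (YDRR.preBraiding.hexagon_reverse X.obj Y.obj Z.obj)
    unit_right X := ObjectProperty.hom_ext _ (YDRR.preBraiding.unit_right X.obj)
    unit_left X := ObjectProperty.hom_ext _ (YDRR.preBraiding.unit_left X.obj) }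

theorem preBraiding_apply (L₁ L₂ : RRFGP H) (η₁ : L₁.El) (η₂ : L₂.El) (n : ℕ)
    (x : Fin n → L₂.El) (z : Fin n → R) (h : L₂.obj.δ η₂ = ∑ i, H.tmul (x i) (z i)) :
    RRFGP.app (preBraiding.braid L₁ L₂) ((diagonal H).tens L₁ L₂ (H.tmul η₁ η₂)) =
      ∑ i, (diagonal H).tens L₂ L₁ (H.tmul (x i) (η₁ <• z i)) :=
  sw_rep (YDRR.isBal_braid_inner L₁.obj L₂.obj η₁) h

end RRFGP
end FullSubcategory
end

/-! ### Coopposite bialgebroids and the flip of tensor products. -/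

/-- A pair of source-target structures on the same algebra `R`, over anti-isomorphic base algebras,
with source and target interchanged. -/
structure SwapPair {k A A' R : Type*} [Field k] [Ring A] [Algebra k A] [Ring A'] [Algebra k A']
    [Ring R] [Algebra k R] (E : SourceTarget k A R) (E' : SourceTarget k A' R) where
  θ : A ≃ₗ[k] A'
  θ_mul : ∀ a b, θ (a * b) = θ b * θ a
  s_θ : ∀ a, E'.s (θ a) = E.t a
  t_θ : ∀ a, E'.t (θ a) = E.s a

namespace SwapPair

variable {k A A' R : Type*} [Field k] [Ring A] [Algebra k A] [Ring A'] [Algebra k A']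
    [Ring R] [Algebra k R] {E : SourceTarget k A R} {E' : SourceTarget k A' R} (c : SwapPair E E')
  {M N L Q : Type*}
  [AddCommGroup M] [Module k M] [Module Rᵐᵒᵖ M] [IsScalarTower k Rᵐᵒᵖ M]
  [AddCommGroup N] [Module k N] [Module Rᵐᵒᵖ N] [IsScalarTower k Rᵐᵒᵖ N]
  [AddCommGroup L] [Module k L] [Module Rᵐᵒᵖ L] [IsScalarTower k Rᵐᵒᵖ L]
  [AddCommGroup Q]

/-- The pair in the opposite order. -/
def symm : SwapPair E' E where
  θ := c.θ.symm
  θ_mul a b := by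
    apply c.θ.injective
    simp [c.θ_mul]
  s_θ a := by rw [← c.t_θ, LinearEquiv.apply_symm_apply]
  t_θ a := by rw [← c.s_θ, LinearEquiv.apply_symm_apply]

theorem s_eq (a : A) : E.s a = E'.t (c.θ a) := (c.t_θ a).symm
theorem t_eq (a : A) : E.t a = E'.s (c.θ a) := (c.s_θ a).symm

include c in
theorem isBal {B : M → N → Q} (hB : E'.IsBal fun n m => B m n) : E.IsBal B :=
  ⟨fun _ _ _ => hB.add_right _ _ _, fun _ _ _ => hB.add_left _ _ _, fun m a n => by
    rw [c.s_eq, c.t_eq]; exact (hB.bal _ _ _).symm⟩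

/-- The flip `M ⊗_A N → N ⊗_{A'} M`. -/
noncomputable def swap : E.Bal M N →ₗ[k] E'.Bal N M :=
  liftₗ (fun m n => E'.tmul n m) (c.isBal E'.isBal_tmul) fun _ _ _ => tmul_smul _ _ _ _

@[simp] theorem swap_tmul (m : M) (n : N) : c.swap (E.tmul m n) = E'.tmul n m := rfl

@[simp] theorem swap_swap (w : E.Bal M N) : c.symm.swap (c.swap w) = w :=
  addHom_ext (c.symm.swap ∘ₗ c.swap) (LinearMap.id (R := k) (M := E.Bal M N)) (fun _ _ => rfl) w

@[simp] theorem swap_swap' (w : E'.Bal M N) : c.swap (c.symm.swap w) = w :=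
  addHom_ext (c.swap ∘ₗ c.symm.swap) (LinearMap.id (R := k) (M := E'.Bal M N)) (fun _ _ => rfl) w

theorem swap_sw (w : E.Bal M N) : c.swap w = sw w fun m n => E'.tmul n m :=
  (sw_eq_lift (c.isBal E'.isBal_tmul) w).symm

/-- Translates a representation on one side of the flip into one on the other, which is the form of
every Sweedler hypothesis in the axioms. -/
theorem swap_eq_sum {w : E.Bal M N} {n : ℕ} {x : Fin n → N} {y : Fin n → M} :
    c.swap w = ∑ i, E'.tmul (x i) (y i) ↔ w = ∑ i, E.tmul (y i) (x i) := by
  constructor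
  · intro h
    rw [← c.swap_swap w, h, map_sum]
    rfl
  · rintro rfl
    rw [map_sum]
    rfl

include c in
theorem isBal₃ {B : M → N → L → Q} (hB : E'.IsBal₃ fun n m l => B l m n) : E.IsBal₃ B :=
  ⟨fun _ _ _ _ => hB.add_right _ _ _ _, fun _ _ _ _ => hB.add_mid _ _ _ _,
    fun _ _ _ _ => hB.add_left _ _ _ _,
    fun m a n p => by rw [c.s_eq, c.t_eq]; exact (hB.bal_right _ _ _ _).symm,
    fun m n a p => by rw [c.s_eq, c.t_eq]; exact (hB.bal_left _ _ _ _).symm⟩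

/-- The flip `M ⊗_A N ⊗_A L → L ⊗_{A'} N ⊗_{A'} M`. -/
noncomputable def swap₃ : E.Bal₃ M N L →+ E'.Bal₃ L N M :=
  lift₃ (fun m n l => E'.tmulRight l (E'.tmul n m)) (c.isBal₃ E'.isBal₃_tmul)

theorem swap₃_tmulRight (m : M) (w : E.Bal N L) :
    c.swap₃ (E.tmulRight m w) = E'.tmulLeft (c.swap w) m := by
  rw [swap₃, lift₃_tmulRight, swap_sw, tmulLeft_sw]
  rfl

theorem swap₃_tmulLeft (w : E.Bal M N) (l : L) :
    c.swap₃ (E.tmulLeft w l) = E'.tmulRight l (c.swap w) := by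
  rw [swap₃, lift₃_tmulLeft, swap_sw, map_sw]

end SwapPair

/-- The coopposite source-target structure. -/
def SourceTarget.cop {k A R : Type*} [Field k] [Ring A] [Algebra k A] [Ring R] [Algebra k R]
    (E : SourceTarget k A R) : SourceTarget k Aᵐᵒᵖ R where
  s := E.tOp
  tOp := E.s.comp (AlgEquiv.opOp k A).symm.toAlgHom
  commute a b := (E.s_comm_t b.unop a.unop).symm

/-- The coopposite source-target structure has source and target interchanged. -/
def SourceTarget.swapPair {k A R : Type*} [Field k] [Ring A] [Algebra k A] [Ring R] [Algebra k R]
    (E : SourceTarget k A R) : SwapPair E E.cop where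
  θ := MulOpposite.opLinearEquiv k
  θ_mul _ _ := rfl
  s_θ _ := rfl
  t_θ _ := rfl

/-- The coopposite right bialgebroid. -/
noncomputable def RightBialgebroid.cop {k A R : Type*} [Field k] [Ring A] [Algebra k A] [Ring R]
    [Algebra k R] (G : RightBialgebroid k A R) : RightBialgebroid k Aᵐᵒᵖ R where
  toSourceTarget := G.toSourceTarget.cop
  Δ := G.swapPair.swap ∘ₗ G.Δ
  ε := (MulOpposite.opLinearEquiv k).toLinearMap ∘ₗ G.ε
  Δ_bimod X b c n x y h := by
    refine G.swapPair.swap_eq_sum.2 ?_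
    have := G.Δ_bimod X c.unop b.unop n y x (G.swapPair.swap_eq_sum.1 h)
    rw [mul_assoc, G.s_comm_t, ← mul_assoc] at this
    exact this
  ε_bimod X b c := by
    have := G.ε_bimod X c.unop b.unop
    rw [mul_assoc, G.s_comm_t, ← mul_assoc] at this
    exact (congrArg MulOpposite.op this).trans (by simp [mul_assoc])
  coassoc X n x y h := by
    have := congrArg G.swapPair.swap₃ (G.coassoc X n y x (G.swapPair.swap_eq_sum.1 h))
    simp only [map_sum, SwapPair.swap₃_tmulLeft, SwapPair.swap₃_tmulRight] at this
    exact this.symm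
  counit_left X n x y h := G.counit_right X n y x (G.swapPair.swap_eq_sum.1 h)
  counit_right X n x y h := G.counit_left X n y x (G.swapPair.swap_eq_sum.1 h)
  takeuchi X a n x y h := by
    have := congrArg G.swapPair.swap
      (G.takeuchi X a.unop n y x (G.swapPair.swap_eq_sum.1 h))
    simp only [map_sum, SwapPair.swap_tmul] at this
    exact this.symm
  Δ_one := congrArg G.swapPair.swap G.Δ_one
  Δ_mul X Y n x y n' x' y' h h' := by
    have := congrArg G.swapPair.swap (G.Δ_mul X Y n y x n' y' x' (G.swapPair.swap_eq_sum.1 h)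
      (G.swapPair.swap_eq_sum.1 h'))
    simp only [map_sum, SwapPair.swap_tmul] at this
    exact this
  ε_one := congrArg MulOpposite.op G.ε_one
  ε_s X Y := congrArg MulOpposite.op (G.ε_t X Y)
  ε_t X Y := congrArg MulOpposite.op (G.ε_s X Y)

/-- Two right bialgebroids that are coopposite to each other. -/
structure CopPair {k A A' R : Type*} [Field k] [Ring A] [Algebra k A] [Ring A'] [Algebra k A']
    [Ring R] [Algebra k R] (G : RightBialgebroid k A R) (G' : RightBialgebroid k A' R) extends
    SwapPair G.toSourceTarget G'.toSourceTarget where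
  Δ_eq : ∀ X, G'.Δ X = toSwapPair.swap (G.Δ X)
  ε_eq : ∀ X, G'.ε X = θ (G.ε X)

/-- A bialgebroid and its coopposite. -/
def RightBialgebroid.copPair {k A R : Type*} [Field k] [Ring A] [Algebra k A] [Ring R]
    [Algebra k R] (G : RightBialgebroid k A R) : CopPair G G.cop where
  toSwapPair := G.swapPair
  Δ_eq _ := rfl
  ε_eq _ := rfl

namespace CopPair

variable {k A A' R : Type*} [Field k] [Ring A] [Algebra k A] [Ring A'] [Algebra k A']
  [Ring R] [Algebra k R] {G : RightBialgebroid k A R} {G' : RightBialgebroid k A' R}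
  (c : CopPair G G') {M : Type*}
  [AddCommGroup M] [Module k M] [Module Rᵐᵒᵖ M] [IsScalarTower k Rᵐᵒᵖ M]

/-- The pair in the opposite order. -/
def symm : CopPair G' G where
  toSwapPair := c.toSwapPair.symm
  Δ_eq X := by rw [c.Δ_eq, SwapPair.swap_swap]
  ε_eq X := by rw [c.ε_eq]; exact (c.θ.symm_apply_apply _).symm

/-- Flipping reverses tensor products and exchanges `s` with `t`; each axiom is the image under
`swap` or `swap₃` of its mirror image. -/
theorem rightComodule {δ : M →ₗ[k] G.Bal R M} (h : IsLeftComodule G δ) :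
    IsRightComodule G' (c.swap ∘ₗ δ) where
  bimod m a a' n x z hm := by
    obtain ⟨a, rfl⟩ := c.θ.surjective a
    obtain ⟨a', rfl⟩ := c.θ.surjective a'
    have := h.bimod m a' a n z x (c.swap_eq_sum.1 hm)
    rw [c.s_θ, c.s_θ, c.t_θ, ← G.s_comm_t]
    exact c.swap_eq_sum.2 this
  takeuchi m a n x z hm := by
    obtain ⟨a, rfl⟩ := c.θ.surjective a
    have := congrArg c.swap (h.takeuchi m a n z x (c.swap_eq_sum.1 hm))
    simp only [map_sum, SwapPair.swap_tmul] at this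
    rw [c.t_θ]
    exact this.symm
  coassoc m n x z hm := by
    have := congrArg c.swap₃ (h.coassoc m n z x (c.swap_eq_sum.1 hm))
    simp only [map_sum, SwapPair.swap₃_tmulLeft, SwapPair.swap₃_tmulRight] at this
    simp only [c.Δ_eq]
    exact this.symm
  counit m n x z hm := by
    simp only [c.ε_eq, c.s_θ]
    exact h.counit m n z x (c.swap_eq_sum.1 hm)

theorem leftComodule {δ : M →ₗ[k] G.Bal M R} (h : IsRightComodule G δ) :
    IsLeftComodule G' (c.swap ∘ₗ δ) where
  bimod m a a' n x z hm := by
    obtain ⟨a, rfl⟩ := c.θ.surjective a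
    obtain ⟨a', rfl⟩ := c.θ.surjective a'
    have := h.bimod m a' a n z x (c.swap_eq_sum.1 hm)
    rw [c.s_θ, c.t_θ, c.t_θ, ← G.s_comm_t]
    exact c.swap_eq_sum.2 this
  takeuchi m a n x z hm := by
    obtain ⟨a, rfl⟩ := c.θ.surjective a
    have := congrArg c.swap (h.takeuchi m a n z x (c.swap_eq_sum.1 hm))
    simp only [map_sum, SwapPair.swap_tmul] at this
    rw [c.s_θ]
    exact this.symm
  coassoc m n x z hm := by
    have := congrArg c.swap₃ (h.coassoc m n z x (c.swap_eq_sum.1 hm))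
    simp only [map_sum, SwapPair.swap₃_tmulLeft, SwapPair.swap₃_tmulRight] at this
    simp only [c.Δ_eq]
    exact this.symm
  counit m n x z hm := by
    simp only [c.ε_eq, c.t_θ]
    exact h.counit m n z x (c.swap_eq_sum.1 hm)

end CopPair

/-! ### Left-right modules as right-right modules of the coopposite bialgebroid. -/

section

variable {k : Type*} {A A' : Type u} {R : Type*} [Field k] [Ring A] [Algebra k A] [Ring A']
  [Algebra k A'] [Ring R] [Algebra k R] {Q : Type*} [AddCommGroup Q]
  {G : RightBialgebroid k A R} {G' : RightBialgebroid k A' R}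

namespace YDLR

/-- The underlying linear map of a morphism. -/
def ap {M N : YDLR G} (f : M ⟶ N) : M.carrier →ₗ[Rᵐᵒᵖ] N.carrier := Hom.toLin f

theorem hom_ext {M N : YDLR G} {f g : M ⟶ N} (h : ∀ m, ap f m = ap g m) : f = g :=
  Hom.ext (LinearMap.ext h)

/-- A left-right Yetter-Drinfeld module as a right-right one of the coopposite bialgebroid. -/
noncomputable abbrev toRR (c : CopPair G G') (M : YDLR G) : YDRR G' where
  carrier := M.carrier
  δ := c.swap ∘ₗ M.δ
  comodule := c.rightComodule M.comodule
  yd m X n x y p m₀ m₁ q l z hX hm hl := by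
    rw [c.Δ_eq, c.swap_eq_sum] at hX
    have := congrArg c.swap (M.yd m X n y x p m₁ m₀ q z l hX (c.swap_eq_sum.1 hm)
      (fun j => c.swap_eq_sum.1 (hl j)))
    simp only [map_sum, SwapPair.swap_tmul] at this
    exact this

/-- Morphisms of left-right modules as morphisms of right-right modules. -/
def homToRR (c : CopPair G G') {M N : YDLR G} (f : M ⟶ N) : M.toRR c ⟶ N.toRR c :=
  YDRR.Hom.mk (ap f) fun m n x z h =>
    c.swap_eq_sum.2 (Hom.colinear f m n z x (c.swap_eq_sum.1 h))

end YDLR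

namespace YDRR

/-- A right-right Yetter-Drinfeld module as a left-right one of the coopposite bialgebroid. -/
noncomputable abbrev toLR (c : CopPair G G') (M : YDRR G) : YDLR G' where
  carrier := M.carrier
  δ := c.swap ∘ₗ M.δ
  comodule := c.leftComodule M.comodule
  yd m X n x y p m₁ m₀ q z l hX hm hl := by
    rw [c.Δ_eq, c.swap_eq_sum] at hX
    have := congrArg c.swap (M.yd m X n y x p m₀ m₁ q l z hX (c.swap_eq_sum.1 hm)
      (fun j => c.swap_eq_sum.1 (hl j)))
    simp only [map_sum, SwapPair.swap_tmul] at this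
    exact this

/-- Morphisms of right-right modules as morphisms of left-right modules. -/
def homToLR (c : CopPair G G') {M N : YDRR G} (f : M ⟶ N) : M.toLR c ⟶ N.toLR c :=
  YDLR.Hom.mk (ap f) fun m n z x h =>
    c.swap_eq_sum.2 (Hom.colinear f m n x z (c.swap_eq_sum.1 h))

end YDRR

namespace CopPair

variable (c : CopPair G G')

include c

/-- The map `θ` reverses products and turns `t` into `s`, hence it turns left linear functionals
into right linear ones. -/
theorem rightFGP {M : Type*} [AddCommGroup M] [Module k M] [Module Rᵐᵒᵖ M]
    [IsScalarTower k Rᵐᵒᵖ M] (h : G.LeftFGP M) : G'.RightFGP M := by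
  obtain ⟨n, x, φ, hφ, hx⟩ := h
  refine ⟨n, x, fun i => c.θ.toLinearMap ∘ₗ φ i, fun i m a => ?_, fun m => ?_⟩
  · obtain ⟨a, rfl⟩ := c.θ.surjective a
    rw [c.s_θ]
    exact (congrArg c.θ (hφ i m a)).trans (c.θ_mul _ _)
  · conv_lhs => rw [hx m]
    exact Finset.sum_congr rfl fun i _ => by rw [← c.s_θ]; rfl

theorem leftFGP {M : Type*} [AddCommGroup M] [Module k M] [Module Rᵐᵒᵖ M]
    [IsScalarTower k Rᵐᵒᵖ M] (h : G.RightFGP M) : G'.LeftFGP M := by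
  obtain ⟨n, x, φ, hφ, hx⟩ := h
  refine ⟨n, x, fun i => c.θ.toLinearMap ∘ₗ φ i, fun i m a => ?_, fun m => ?_⟩
  · obtain ⟨a, rfl⟩ := c.θ.surjective a
    rw [c.t_θ]
    exact (congrArg c.θ (hφ i m a)).trans (c.θ_mul _ _)
  · conv_lhs => rw [hx m]
    exact Finset.sum_congr rfl fun i _ => by rw [← c.t_θ]; rfl

omit c

/-- The functor from left-right to right-right modules. -/
noncomputable def toRR : LRFGP G ⥤ RRFGP G' where
  obj M := ⟨M.obj.toRR c, c.rightFGP M.property⟩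
  map f := ObjectProperty.homMk (YDLR.homToRR c f.hom)

/-- The functor from right-right to left-right modules. -/
noncomputable def toLR : RRFGP G ⥤ LRFGP G' where
  obj M := ⟨M.obj.toLR c, c.leftFGP M.property⟩
  map f := ObjectProperty.homMk (YDRR.homToLR c f.hom)

/-- Right-right modules of the coopposite bialgebroid are left-right modules. -/
noncomputable def equivalence : RRFGP G' ≌ LRFGP G where
  functor := c.symm.toLR
  inverse := c.toRR
  -- The underlying maps are identities; only the coaction is replaced by its double flip.
  unitIso := NatIso.ofComponents (fun M =>
    { hom := ObjectProperty.homMk (YDRR.Hom.mk (N := (M.obj.toLR c.symm).toRR c) LinearMap.id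
        fun m n x z h => (c.swap_swap' _).trans h)
      inv := ObjectProperty.homMk (YDRR.Hom.mk (M := (M.obj.toLR c.symm).toRR c) LinearMap.id
        fun m n x z h => (c.swap_swap' _).symm.trans h) })
  counitIso := NatIso.ofComponents (fun M =>
    { hom := ObjectProperty.homMk (YDLR.Hom.mk (M := (M.obj.toRR c).toLR c.symm) LinearMap.id
        fun m n x z h => (c.swap_swap _).symm.trans h)
      inv := ObjectProperty.homMk (YDLR.Hom.mk (N := (M.obj.toRR c).toLR c.symm) LinearMap.id
        fun m n x z h => (c.swap_swap _).trans h) })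

end CopPair

namespace LRFGP

variable (G)

/-- Left-right modules are right-right modules of the coopposite bialgebroid, with the reversed
tensor product. -/
noncomputable def copEquivalence : MonoidalOpposite (RRFGP G.cop) ≌ LRFGP G :=
  (MonoidalOpposite.unmopEquiv (RRFGP G.cop)).trans G.copPair.equivalence

attribute [local instance] RRFGP.monoidalCategory

/-- The monoidal category of left finitely generated projective Yetter-Drinfeld modules. -/
@[reducible] noncomputable def monoidalCategory : MonoidalCategory (LRFGP G) :=
  Monoidal.transport (copEquivalence G)

attribute [local instance] monoidalCategory

/-- The passage to the coopposite bialgebroid is monoidal. -/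
@[reducible] noncomputable def copEquivalenceMonoidal : (copEquivalence G).inverse.Monoidal :=
  inferInstanceAs (Monoidal.equivalenceTransported (copEquivalence G)).inverse.Monoidal

/-- The identification of the tensor products. -/
noncomputable def _root_.SwapPair.swapEquiv {k A A' R : Type*} [Field k] [Ring A] [Algebra k A]
    [Ring A'] [Algebra k A'] [Ring R] [Algebra k R] {E : SourceTarget k A R}
    {E' : SourceTarget k A' R} (c : SwapPair E E') (M N : Type*)
    [AddCommGroup M] [Module k M] [Module Rᵐᵒᵖ M] [IsScalarTower k Rᵐᵒᵖ M]
    [AddCommGroup N] [Module k N] [Module Rᵐᵒᵖ N] [IsScalarTower k Rᵐᵒᵖ N] :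
    E.Bal M N ≃ₗ[k] E'.Bal N M :=
  LinearEquiv.ofLinearMap c.swap c.symm.swap (LinearMap.ext c.swap_swap') (LinearMap.ext c.swap_swap)

/-- Since `a = ε(s a)`, both sides are `ε(s a * X)` by the two counit axioms. This reconciles the
unit action of the coopposite, whose source is `t`, with the action `ε(s a * X)`. -/
theorem _root_.RightBialgebroid.ε_t_mul (a : A) (X : R) : G.ε (G.t a * X) = G.ε (G.s a * X) := by
  have h : G.ε (G.s a) = a := by rw [← one_mul (G.s a), G.ε_mul_s, G.ε_one, one_mul]
  rw [← h, G.ε_t, G.ε_s]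

theorem app_functor_map {X Y : MonoidalOpposite (RRFGP G.cop)} (f : X ⟶ Y)
    (m : X.unmop.El) : LRFGP.app ((copEquivalence G).functor.map f) m = RRFGP.app f.unmop m := rfl

theorem app_comp_apply {X Y Z : RRFGP G.cop} (f : X ⟶ Y) (g : Y ⟶ Z) (m : X.El) :
    RRFGP.app (f ≫ g) m = RRFGP.app g (RRFGP.app f m) := rfl

/-- Under reversal the associator becomes the inverse associator of the coopposite category. The
unit isomorphisms by which transport conjugates it are identities on elements. -/
theorem associator_aux (M N P : LRFGP G) (m : M.El) (m' : N.El) (m'' : P.El) :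
    LRFGP.app (α_ M N P).hom
      (G.cop.tmul (M := P.El) (N := G.cop.Bal N.El M.El) m'' (G.cop.tmul (M := N.El) (N := M.El) m' m)) =
      G.cop.tmul (M := G.cop.Bal P.El N.El) (N := M.El) (G.cop.tmul (M := P.El) (N := N.El) m'' m') m := by
  have h : (α_ M N P).hom = (copEquivalence G).functor.map
    ((whiskerRightIso ((copEquivalence G).unitIso.app _).symm _ ≪≫
        α_ ((copEquivalence G).inverse.obj M) ((copEquivalence G).inverse.obj N)
          ((copEquivalence G).inverse.obj P) ≪≫
        whiskerLeftIso _ ((copEquivalence G).unitIso.app _)).hom) := rfl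
  rw [h]
  refine (app_functor_map G _ _).trans ?_
  simp only [Iso.trans_hom, unmop_comp]
  refine (app_comp_apply G _ _ _).trans ?_
  have h₁ : RRFGP.app (whiskerRightIso ((copEquivalence G).unitIso.app
        ((copEquivalence G).inverse.obj M ⊗ (copEquivalence G).inverse.obj N)).symm
        ((copEquivalence G).inverse.obj P)).hom.unmop
      (G.cop.tmul (M := P.El) (N := G.cop.Bal N.El M.El) m''
        (G.cop.tmul (M := N.El) (N := M.El) m' m)) =
      G.cop.tmul (M := P.El) (N := G.cop.Bal N.El M.El) m''
        (G.cop.tmul (M := N.El) (N := M.El) m' m) := rfl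
  refine (congrArg _ h₁).trans ?_
  refine (app_comp_apply G _ _ _).trans ?_
  have h₂ : RRFGP.app (α_ ((copEquivalence G).inverse.obj M) ((copEquivalence G).inverse.obj N)
          ((copEquivalence G).inverse.obj P)).hom.unmop
      (G.cop.tmul (M := P.El) (N := G.cop.Bal N.El M.El) m''
        (G.cop.tmul (M := N.El) (N := M.El) m' m)) =
      G.cop.tmul (M := G.cop.Bal P.El N.El) (N := M.El)
        (G.cop.tmul (M := P.El) (N := N.El) m'' m') m :=
    YDRR.ap_assocIso_inv (P.obj.toRR G.copPair) (N.obj.toRR G.copPair) (M.obj.toRR G.copPair)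
      m'' m' m
  refine (congrArg _ h₂).trans ?_
  rfl

/-- The monoidal structure of `LRFGP G` is the diagonal one. -/
noncomputable def diagonal : LRDiagonal G where
  -- The transported `M ⊗ N` has underlying space `N ⊗ M` over `Aᵒᵖ`, so the identification is the
  -- flip.
  tens M N := G.swapPair.swapEquiv M.El N.El
  unit := G.swapPair.θ.trans G.cop.toUnit
  tens_act M N m m' X n x y hX := by
    refine sw_rep (G.cop.isBal_rsmul_rsmul G.cop.isBal_tmul m' m) (x := y) (y := x) ?_
    exact G.swapPair.swap_eq_sum.2 hX
  tens_coact M N m m' n z x n' z' x' hm hm' := by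
    have hm := G.swapPair.swap_eq_sum.2 hm
    have hm' := G.swapPair.swap_eq_sum.2 hm'
    have h : (YDRR.tensor (N.obj.toRR G.copPair) (M.obj.toRR G.copPair)).δ
        (G.cop.tmul (M := N.El) (N := M.El) m' m) =
        ∑ j, ∑ i, G.cop.tmul (G.cop.tmul (M := N.El) (N := M.El) (x' j) (x i)) (z' j * z i) := by
      refine (sw_rep (YDRR.isBal_coact_left (N.obj.toRR G.copPair) (M.obj.toRR G.copPair) G.cop.isBal_tmul m)
        hm').trans ?_
      exact Finset.sum_congr rfl fun i _ =>
        sw_rep (YDRR.isBal_coact_right (N.obj.toRR G.copPair) (M.obj.toRR G.copPair) G.cop.isBal_tmul _ _) hm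
    refine (congrArg G.copPair.symm.swap h).trans ?_
    rw [map_sum, Finset.sum_comm]
    simp only [map_sum]
    rfl
  unit_act a X := by
    refine congrArg (fun b : A => G.cop.toUnit (MulOpposite.op b)) (G.ε_t_mul a X)
  unit_coact a := rfl
  hom_tens f g m m' := rfl
  assoc M N P m m' m'' := by
    exact associator_aux G M N P m m' m''
  left_unit M a m := rfl
  right_unit M a m := rfl

end LRFGP
end

/-! ### Pre-braidings under reversal of the tensor product and along monoidal functors. -/

namespace PreBraiding

variable {C D : Type*} [Category C] [Category D] [MonoidalCategory C] [MonoidalCategory D]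

/-- The pre-braiding of the category with the reversed tensor product. -/
def mop (σ : PreBraiding C) : PreBraiding (MonoidalOpposite C) where
  braid X Y := (σ.braid Y.unmop X.unmop).mop
  naturality f g := congrArg Quiver.Hom.mop (σ.naturality g.unmop f.unmop)
  hexagon_forward X Y Z :=
    congrArg Quiver.Hom.mop (σ.hexagon_reverse Z.unmop Y.unmop X.unmop)
  hexagon_reverse X Y Z :=
    congrArg Quiver.Hom.mop (σ.hexagon_forward Z.unmop Y.unmop X.unmop)
  unit_right X := congrArg Quiver.Hom.mop (σ.unit_left X.unmop)
  unit_left X := congrArg Quiver.Hom.mop (σ.unit_right X.unmop)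

theorem naturality_left (σ : PreBraiding C) {X X' : C} (f : X ⟶ X') (Y : C) :
    f ▷ Y ≫ σ.braid X' Y = σ.braid X Y ≫ Y ◁ f := by
  rw [← tensorHom_id, σ.naturality, id_tensorHom]

theorem naturality_right (σ : PreBraiding C) (X : C) {Y Y' : C} (f : Y ⟶ Y') :
    X ◁ f ≫ σ.braid X Y' = σ.braid X Y ≫ f ▷ X := by
  rw [← tensorHom_id, ← id_tensorHom, σ.naturality]

open Functor.LaxMonoidal Functor in
/-- A family of morphisms is a pre-braiding if a faithful monoidal functor maps it to one. -/
def ofFaithful (F : C ⥤ D) [F.Monoidal] [F.Faithful] (σ : PreBraiding D)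
    (β : ∀ X Y : C, X ⊗ Y ⟶ Y ⊗ X)
    (w : ∀ X Y, μ F _ _ ≫ F.map (β X Y) = σ.braid _ _ ≫ μ F _ _) : PreBraiding C where
  braid := β
  naturality {X X' Y Y'} f g := by
    apply F.map_injective
    refine (cancel_epi (μ F _ _)).1 ?_
    rw [Functor.map_comp, ← μ_natural_assoc, w, Functor.map_comp, reassoc_of% w,
      ← μ_natural, ← Category.assoc, σ.naturality, Category.assoc]
  hexagon_forward X Y Z := by
    apply F.map_injective
    -- Precomposing with the invertible `μ` allows `w` to replace the image of `β` by `σ`; what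
    -- remains is the hexagon of `σ`.
    refine (cancel_epi (μ F _ _)).1 ?_
    refine (cancel_epi (μ F _ _ ▷ _)).1 ?_
    rw [Functor.map_comp, Functor.map_comp, Functor.map_comp, Functor.map_comp, ←
      μ_natural_left_assoc, ← comp_whiskerRight_assoc, w,
      comp_whiskerRight_assoc, Functor.LaxMonoidal.associativity_assoc,
      Functor.LaxMonoidal.associativity_assoc, ← μ_natural_right, ←
      MonoidalCategory.whiskerLeft_comp_assoc, w, MonoidalCategory.whiskerLeft_comp_assoc,
      reassoc_of% w, reassoc_of% σ.naturality_right,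
      Functor.LaxMonoidal.associativity, reassoc_of% σ.hexagon_forward]
  hexagon_reverse X Y Z := by
    apply F.map_injective
    refine (cancel_epi (μ F _ _)).1 ?_
    refine (cancel_epi (_ ◁ μ F _ _)).1 ?_
    rw [Functor.map_comp, Functor.map_comp, Functor.map_comp, Functor.map_comp, ←
      μ_natural_right_assoc, ← MonoidalCategory.whiskerLeft_comp_assoc, w,
      MonoidalCategory.whiskerLeft_comp_assoc, Functor.LaxMonoidal.associativity_inv_assoc,
      Functor.LaxMonoidal.associativity_inv_assoc, ← μ_natural_left,
      ← comp_whiskerRight_assoc, w, comp_whiskerRight_assoc, reassoc_of% w,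
      reassoc_of% σ.naturality_left, Functor.LaxMonoidal.associativity_inv,
      reassoc_of% σ.hexagon_reverse]
  unit_right X := by
    apply F.map_injective
    refine (cancel_epi (μ F _ _)).1 ?_
    refine (cancel_epi (_ ◁ ε F)).1 ?_
    rw [Functor.map_comp, reassoc_of% w, ← Functor.LaxMonoidal.right_unitality,
      reassoc_of% σ.naturality_right, ← Functor.LaxMonoidal.left_unitality, σ.unit_right]
  unit_left X := by
    apply F.map_injective
    refine (cancel_epi (μ F _ _)).1 ?_
    refine (cancel_epi (ε F ▷ _)).1 ?_
    rw [Functor.map_comp, reassoc_of% w, ← Functor.LaxMonoidal.left_unitality,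
      reassoc_of% σ.naturality_left, ← Functor.LaxMonoidal.right_unitality, σ.unit_left]

end PreBraiding

/-! ### The pre-braiding of left-right modules. -/

namespace LRFGP

variable {k : Type*} {A : Type u} {R : Type*} [Field k] [Ring A] [Algebra k A]
  [Ring R] [Algebra k R] (G : RightBialgebroid k A R)

attribute [local instance] RRFGP.monoidalCategory monoidalCategory copEquivalenceMonoidal

/-- The pre-braiding of left-right Yetter-Drinfeld modules. -/
noncomputable def preBraiding : PreBraiding (LRFGP G) :=
  PreBraiding.ofFaithful (copEquivalence G).inverse (RRFGP.preBraiding (H := G.cop)).mop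
    (fun X Y => (copEquivalence G).functor.map ((RRFGP.preBraiding (H := G.cop)).mop.braid
      ((copEquivalence G).inverse.obj X) ((copEquivalence G).inverse.obj Y)))
    -- The maps `μ` of the transported structure unfold to components of the unit isomorphism, so
    -- the required square is its naturality.
    (fun _ _ => (((copEquivalence G).unitIso.hom.naturality _).symm : _))

theorem preBraiding_apply (T₁ T₂ : LRFGP G) (f : T₁.El) (g : T₂.El) (n : ℕ) (ω : Fin n → R)
    (x : Fin n → T₁.El) (h : T₁.obj.δ f = ∑ i, G.tmul (ω i) (x i)) :
    LRFGP.app ((preBraiding G).braid T₁ T₂) ((diagonal G).tens T₁ T₂ (G.tmul f g)) =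
      ∑ i, (diagonal G).tens T₂ T₁ (G.tmul (g <• ω i) (x i)) := by
  refine (sw_rep (YDRR.isBal_braid_inner (T₂.obj.toRR G.copPair) (T₁.obj.toRR G.copPair) g)
    (G.swapPair.swap_eq_sum.2 h)).trans ?_
  rfl

end LRFGP

/-! ### Perfect pairings: dual bases and separation of points. -/

section

variable {k : Type*} {A : Type u} {R Ω : Type*} [Field k] [Ring A] [Algebra k A]
  [Ring R] [Algebra k R] [Ring Ω] [Algebra k Ω]

/-- The two sides of a bilinear map to the base algebra have finite bases that are dual to each
other. -/
def IsPerfect {T L : Type*} [AddCommGroup T] [Module k T] [Module Ωᵐᵒᵖ T] [AddCommGroup L]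
    [Module k L] [Module Rᵐᵒᵖ L] (E' : SourceTarget k A Ω) (E : SourceTarget k A R)
    (p : T →ₗ[k] L →ₗ[k] A) : Prop :=
  ∃ (n : ℕ) (x : Fin n → L) (f : Fin n → T),
    (∀ η, ∑ i, x i <• E.s (p (f i) η) = η) ∧ ∀ g, ∑ i, f i <• E'.t (p g (x i)) = g

namespace IsPerfect

variable {T L : Type*} [AddCommGroup T] [Module k T] [Module Ωᵐᵒᵖ T] [AddCommGroup L]
    [Module k L] [Module Rᵐᵒᵖ L] {E' : SourceTarget k A Ω} {E : SourceTarget k A R}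
    {p : T →ₗ[k] L →ₗ[k] A}

theorem of_fintype {ι : Type*} [Fintype ι] (x : ι → L) (f : ι → T)
    (hx : ∀ η, ∑ i, x i <• E.s (p (f i) η) = η) (hf : ∀ g, ∑ i, f i <• E'.t (p g (x i)) = g) :
    IsPerfect E' E p := by
  let e := (Fintype.equivFin ι).symm
  refine ⟨Fintype.card ι, x ∘ e, f ∘ e, fun η => ?_, fun g => ?_⟩
  · conv_rhs => rw [← hx η]
    exact Fintype.sum_equiv e _ _ fun _ => rfl
  · conv_rhs => rw [← hf g]
    exact Fintype.sum_equiv e _ _ fun _ => rfl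

theorem left_ext (h : IsPerfect E' E p) {f g : T} (hfg : ∀ η, p f η = p g η) : f = g := by
  obtain ⟨n, x, φ, -, hφ⟩ := h
  rw [← hφ f, ← hφ g]
  simp only [hfg]

theorem right_ext (h : IsPerfect E' E p) {η ξ : L} (hηξ : ∀ f, p f η = p f ξ) : η = ξ := by
  obtain ⟨n, x, φ, hx, -⟩ := h
  rw [← hx η, ← hx ξ]
  simp only [hηξ]

theorem leftFGP (h : IsPerfect E' E p) (left_t : ∀ f η a, p (f <• E'.t a) η = a * p f η) :
    E'.LeftFGP T := by
  obtain ⟨n, x, φ, -, hφ⟩ := h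
  exact ⟨n, φ, fun i => p.flip (x i), fun i f a => left_t _ _ _, fun g => (hφ g).symm⟩

theorem rightFGP (h : IsPerfect E' E p) (right_s : ∀ f η a, p f (η <• E.s a) = p f η * a) :
    E.RightFGP L := by
  obtain ⟨n, x, φ, hx, -⟩ := h
  exact ⟨n, x, fun i => p (φ i), fun i η a => right_s _ _ _, fun η => (hx η).symm⟩

/-- The functional `φ` is represented by `∑ f i ◁ t(φ (x i))`, and uniqueness is nondegeneracy. -/
theorem existsUnique (h : IsPerfect E' E p)
    (left_t : ∀ f η a, p (f <• E'.t a) η = a * p f η) (φ : L →ₗ[k] A)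
    (hφ : E.IsRightLinear φ) : ∃! f, p f = φ := by
  refine existsUnique_of_exists_of_unique ?_ fun f g hf hg =>
    h.left_ext fun η => by rw [hf, hg]
  obtain ⟨n, x, f, hx, -⟩ := h
  refine ⟨∑ i, f i <• E'.t (φ (x i)), LinearMap.ext fun η => ?_⟩
  conv_rhs => rw [← hx η, map_sum]
  rw [map_sum, LinearMap.sum_apply]
  exact Finset.sum_congr rfl fun i _ => (left_t _ _ _).trans (hφ _ _).symm

end IsPerfect

variable {G : RightBialgebroid k A Ω} {H : RightBialgebroid k A R}

namespace DualPairing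

variable (P : DualPairing G H) (α : Ω) (X : R) (a : A)

theorem pair_s_mul : P.pair (G.s a * α) X = P.pair α (H.t a * X) := by
  simpa using P.bimod a 1 1 1 1 α X

theorem pair_t_mul : P.pair (G.t a * α) X = P.pair α (X * H.t a) := by
  simpa using P.bimod 1 a 1 1 1 α X

theorem pair_mul_s : P.pair (α * G.s a) X = P.pair α (H.s a * X) := by
  simpa using P.bimod 1 1 a 1 1 α X

theorem pair_mul_t : P.pair (α * G.t a) X = a * P.pair α X := by
  simpa using P.bimod 1 1 1 a 1 α X

theorem pair_mul_right_s : P.pair α (X * H.s a) = P.pair α X * a := by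
  simpa using (P.bimod 1 1 1 1 a α X).symm

theorem isBal_mul_pair (β : Ω) : H.IsBal fun x y : R => P.pair β (y * H.t (P.pair α x)) := by
  refine ⟨?_, ?_, fun x b y => ?_⟩
  · intros; simp [mul_add]
  · intros; simp [add_mul]
  · simp [pair_mul_right_s, H.t_mul, mul_assoc]

theorem sw_mul_pair (β : Ω) :
    P.pair (α * β) X = sw (H.Δ X) fun x y => P.pair β (y * H.t (P.pair α x)) :=
  P.mul_pair α β X _ _ _ (rep_spec _)

theorem sw_pair_mul (Y : R) :
    P.pair α (X * Y) = sw (G.Δ α) fun β γ => P.pair β (H.s (P.pair γ X) * Y) :=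
  P.pair_mul' α X Y _ _ _ (rep_spec _)

/-- Both bialgebroids have finite bases that are dual to each other. -/
theorem isPerfect (hR : H.RightFGP R) (hΩ : G.LeftFGP Ω)
    (hP : P.IdentifiesRightDual ∨ P.IdentifiesLeftDual) :
    IsPerfect G.toSourceTarget H.toSourceTarget P.pair := by
  rcases hP with hP | hP
  · obtain ⟨n, x, φ, hφ, hx⟩ := hR
    -- The coordinate functionals of `R` are represented by elements of `Ω`. The dual expansion in
    -- `Ω` then follows from the uniqueness of representing elements.
    choose ω hω _ using fun i => hP (φ i) (hφ i)
    refine ⟨n, x, ω, fun X => ?_, fun β => ?_⟩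
    · rw [hx X]
      conv_rhs => rw [hx X]
      simp only [hω, ← hx X]
    · refine (hP (P.pair β) fun X a => P.pair_mul_right_s β X a).unique
        (LinearMap.ext fun X => ?_) rfl
      conv_rhs => rw [hx X, map_sum]
      rw [map_sum, LinearMap.sum_apply]
      refine Finset.sum_congr rfl fun i _ => (P.pair_mul_t _ _ _).trans ?_
      rw [hω]
      exact (P.pair_mul_right_s _ _ _).symm
  · obtain ⟨n, ω, φ, hφ, hω⟩ := hΩ
    choose x hx _ using fun i => hP (φ i) (hφ i)
    replace hx (i : Fin n) (β : Ω) : P.pair β (x i) = φ i β := LinearMap.congr_fun (hx i) β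
    refine ⟨n, x, ω, fun X => ?_, fun β => ?_⟩
    · refine (hP (P.pair.flip X) fun β a => P.pair_mul_t β X a).unique
        (LinearMap.ext fun β => ?_) rfl
      rw [LinearMap.flip_apply, LinearMap.flip_apply]
      conv_rhs => rw [hω β, map_sum, LinearMap.sum_apply]
      rw [map_sum]
      refine Finset.sum_congr rfl fun i _ => (P.pair_mul_right_s _ _ _).trans ?_
      rw [hx]
      exact (P.pair_mul_t _ _ _).symm
    · conv_rhs => rw [hω β]
      simp only [hx]

end DualPairing

/-! ### Separating functionals on `Ω ⊗_A T` -/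

section Test

variable {P : DualPairing G H} {T L : Type*}
  [AddCommGroup T] [Module k T] [Module Ωᵐᵒᵖ T] [IsScalarTower k Ωᵐᵒᵖ T]
  [AddCommGroup L] [Module k L] [Module Rᵐᵒᵖ L] [IsScalarTower k Rᵐᵒᵖ L]
  {p : T →ₗ[k] L →ₗ[k] A}

variable (P) in
-- The resulting functionals on `Ω ⊗_A T` take the value `(f, η ◁ X)` on `δ f`, which is how they
-- determine a coaction.
theorem isBal_test (left_t : ∀ f η a, p (f <• G.t a) η = a * p f η) (η : L) (X : R) :
    G.IsBal fun (ω : Ω) (f : T) => P.pair ω (H.s (p f η) * X) := by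
  refine ⟨?_, ?_, fun ω a f => ?_⟩
  · intros; simp
  · intros; simp [add_mul]
  · simp [P.pair_mul_s, left_t, mul_assoc]

variable (P) in
theorem isBal_act (right_s : ∀ f η a, p f (η <• H.s a) = p f η * a) (f : T) (α : Ω) :
    H.IsBal fun (x : L) (z : R) => P.pair α (z * H.t (p f x)) := by
  refine ⟨?_, ?_, fun m a n => ?_⟩
  · intros; simp [mul_add]
  · intros; simp [add_mul]
  · simp [right_s, H.t_mul, mul_assoc]

variable (P) in
theorem isBal₃_test (left_t : ∀ f η a, p (f <• G.t a) η = a * p f η) (η : L) (X Y : R) :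
    G.IsBal₃ fun (ω ω' : Ω) (f : T) => P.pair ω (H.s (P.pair ω' (H.s (p f η) * X)) * Y) := by
  refine ⟨?_, ?_, ?_, fun ω a ω' f => ?_, fun ω ω' a f => ?_⟩
  · intros; simp
  · intros; simp [add_mul]
  · intros; simp [add_mul]
  · simp [P.pair_mul_s, P.pair_mul_t, mul_assoc]
  · simp [P.pair_mul_s, left_t, mul_assoc]

/-- Dual bases recover `w` from its test values: `w = ∑ ω j t(τ i j (w)) ⊗ φ i`, where `τ i j` is
the test functional at `η = x i` and `X = e j`. -/
theorem test_ext (hP : IsPerfect G.toSourceTarget H.toSourceTarget P.pair)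
    (hp : IsPerfect G.toSourceTarget H.toSourceTarget p)
    (left_t : ∀ f η a, p (f <• G.t a) η = a * p f η) {w w' : G.Bal Ω T}
    (h : ∀ η X, sw w (fun ω f => P.pair ω (H.s (p f η) * X)) =
      sw w' (fun ω f => P.pair ω (H.s (p f η) * X))) : w = w' := by
  obtain ⟨m, e, ω, -, hω⟩ := hP
  obtain ⟨n, x, φ, -, hφ⟩ := hp
  have key (w : G.Bal Ω T) : w = ∑ i, ∑ j, G.tmul (ω j * G.t (sw w fun ω f =>
      P.pair ω (H.s (p f (x i)) * e j))) (φ i) := by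
    induction w using bal_induction with
    | h0 => simp [sw_zero (isBal_test P left_t _ _)]
    | h1 α f =>
      have ev (η X) := sw_tmul (isBal_test P left_t η X) α f
      simp only [ev]
      simp only [← P.pair_mul_s, ← sum_tmul]
      have hω' (β : Ω) : ∑ j, ω j * G.t (P.pair β (e j)) = β := hω β
      simp only [hω', mul_tmul_bal, ← tmul_sum, hφ]
    | h2 w w' hw hw' =>
      simp only [sw_add (isBal_test P left_t _ _), t_add, mul_add, add_tmul,
        Finset.sum_add_distrib, ← hw, ← hw']
  rw [key w, key w']
  simp only [h]

/-- The expansion of `test_ext` with one more basis of `Ω`; it serves to test coassociativity. -/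
theorem test_ext₃ (hP : IsPerfect G.toSourceTarget H.toSourceTarget P.pair)
    (hp : IsPerfect G.toSourceTarget H.toSourceTarget p)
    (left_t : ∀ f η a, p (f <• G.t a) η = a * p f η) {w w' : G.Bal₃ Ω Ω T}
    (h : ∀ η X Y, lift₃ _ (isBal₃_test P left_t η X Y) w =
      lift₃ _ (isBal₃_test P left_t η X Y) w') : w = w' := by
  obtain ⟨m, e, ω, -, hω⟩ := hP
  obtain ⟨n, x, φ, -, hφ⟩ := hp
  have hω' (β : Ω) : ∑ j, ω j * G.t (P.pair β (e j)) = β := hω β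
  have key (w : G.Bal₃ Ω Ω T) : w = ∑ i, ∑ j, ∑ l, G.tmulRight (ω l * G.t
      (lift₃ _ (isBal₃_test P left_t (x i) (e j) (e l)) w)) (G.tmul (ω j) (φ i)) := by
    have hB := isBal₃_tmul (M := Ω) (N := Ω) (L := T) (E := G.toSourceTarget)
    induction w using bal₃_induction with
    | h0 =>
      simp only [map_zero, t_zero, mul_zero]
      rw [Finset.sum_eq_zero]
      intro i _
      refine Finset.sum_eq_zero fun j _ => Finset.sum_eq_zero fun l _ => ?_
      rw [← tmulLeft_tmul, zero_tmul, map_zero]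
      rfl
    | h1 α β f =>
      have ev (η X Y) : lift₃ _ (isBal₃_test P left_t η X Y) (G.tmulRight α (G.tmul β f)) =
          P.pair α (H.s (P.pair β (H.s (p f η) * X)) * Y) :=
        (lift₃_tmulRight _ _ _ _).trans (sw_tmul ((isBal₃_test P left_t η X Y).right α) β f)
      simp only [ev]
      simp only [← P.pair_mul_s, ← tmulLeft_tmul]
      simp only [← LinearMap.sum_apply, ← map_sum, ← sum_tmul, hω']
      simp only [mul_tmul_bal, MulOpposite.smul_eq_mul_unop, MulOpposite.unop_op]
      simp only [← tmul_sum, hω']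
      simp only [tmulLeft_tmul, ← map_sum]
      simp only [mul_tmul_bal, ← tmul_sum, hφ]
    | h2 w w' hw hw' =>
      have e : ∀ i j l, G.tmulRight (ω l * G.t
          (lift₃ _ (isBal₃_test P left_t (x i) (e j) (e l)) (w + w'))) (G.tmul (ω j) (φ i)) =
          G.tmulRight (ω l * G.t
          (lift₃ _ (isBal₃_test P left_t (x i) (e j) (e l)) w)) (G.tmul (ω j) (φ i)) +
          G.tmulRight (ω l * G.t
          (lift₃ _ (isBal₃_test P left_t (x i) (e j) (e l)) w')) (G.tmul (ω j) (φ i)) := by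
        intro i j l
        rw [map_add, t_add, mul_add]
        exact hB.add_left _ _ _ _
      simp only [e, Finset.sum_add_distrib, ← hw, ← hw']
  rw [key w, key w']
  simp only [h]

end Test

end

/-! ### Yetter-Drinfeld pairings and the structure of the dual module. -/

section

variable {k : Type*} {A : Type u} {R Ω : Type*} [Field k] [Ring A] [Algebra k A]
  [Ring R] [Algebra k R] [Ring Ω] [Algebra k Ω]
  {G : RightBialgebroid k A Ω} {H : RightBialgebroid k A R}

namespace IsYDPairing

variable {P : DualPairing G H} {T : YDLR G} {L : YDRR H} {p : T.carrier →ₗ[k] L.carrier →ₗ[k] A}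
  (h : IsYDPairing P T L p)

/-- The second form of each action axiom follows from the first by moving `t` or `s` across the
pairing `P`. -/
theorem of (left_s : ∀ f η a, p (f <• G.s a) η = p f (η <• H.t a))
    (left_t : ∀ f η a, p (f <• G.t a) η = a * p f η)
    (right_s : ∀ f η a, p f (η <• H.s a) = p f η * a)
    (act : ∀ f α η, p (f <• α) η = sw (L.δ η) fun x z => P.pair α (z * H.t (p f x)))
    (coact : ∀ f η X, p f (η <• X) = sw (T.δ f) fun ω g => P.pair ω (H.s (p g η) * X)) :
    IsYDPairing P T L p := by
  have e (f α η n) (x : Fin n → L.carrier) (z : Fin n → R)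
      (hη : L.δ η = ∑ i, H.tmul (x i) (z i)) :
      p (f <• α) η = ∑ i, P.pair α (z i * H.t (p f (x i))) := by
    rw [act]
    exact sw_rep (isBal_act P right_s f α) hη
  have e' (f η X n) (ω : Fin n → Ω) (g : Fin n → T.carrier)
      (hf : T.δ f = ∑ i, G.tmul (ω i) (g i)) :
      p f (η <• X) = ∑ i, P.pair (ω i) (H.s (p (g i) η) * X) := by
    rw [coact]
    exact sw_rep (isBal_test P left_t η X) hf
  exact
  { bimod f η a b c := by
      rw [rsmul_mul, left_t, left_s, mul_assoc, ← right_s, H.s_comm_t, rsmul_mul]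
    act_left f α η n x z hη := by simp only [e f α η n x z hη, P.pair_t_mul]
    act_left' := e
    act_right := e'
    act_right' f η X n ω g hf := by simp only [e' f η X n ω g hf, P.pair_mul_s] }

include h

theorem left_s (f η a) : p (f <• G.s a) η = p f (η <• H.t a) := by
  simpa using h.bimod f η a 1 1

theorem left_t (f η a) : p (f <• G.t a) η = a * p f η := by
  simpa using h.bimod f η 1 a 1

theorem right_s (f η a) : p f (η <• H.s a) = p f η * a := by
  simpa using (h.bimod f η 1 1 a).symm

theorem act (f α η) : p (f <• α) η = sw (L.δ η) fun x z => P.pair α (z * H.t (p f x)) :=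
  h.act_left' f α η _ _ _ (rep_spec _)

theorem coact (f η X) : p f (η <• X) = sw (T.δ f) fun ω g => P.pair ω (H.s (p g η) * X) :=
  h.act_right f η X _ _ _ (rep_spec _)

end IsYDPairing

/-! ### The Yetter-Drinfeld structure of the right dual -/

/-- A right `Ω`-module `T` with the pairing and the action of the right dual of `L`. -/
structure IsDualModule (P : DualPairing G H) (L : YDRR H) {T : Type*} [AddCommGroup T]
    [Module k T] [Module Ωᵐᵒᵖ T] [IsScalarTower k Ωᵐᵒᵖ T] (p : T →ₗ[k] L.carrier →ₗ[k] A) :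
    Prop where
  left_s : ∀ f η a, p (f <• G.s a) η = p f (η <• H.t a)
  left_t : ∀ f η a, p (f <• G.t a) η = a * p f η
  right_s : ∀ f η a, p f (η <• H.s a) = p f η * a
  act : ∀ f α η, p (f <• α) η = sw (L.δ η) fun x z => P.pair α (z * H.t (p f x))
  base_perfect : IsPerfect G.toSourceTarget H.toSourceTarget P.pair
  perfect : IsPerfect G.toSourceTarget H.toSourceTarget p

namespace IsDualModule

variable {P : DualPairing G H} {L : YDRR H} {T : Type*} [AddCommGroup T]
  [Module k T] [Module Ωᵐᵒᵖ T] [IsScalarTower k Ωᵐᵒᵖ T] {p : T →ₗ[k] L.carrier →ₗ[k] A}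
  (h : IsDualModule P L p)

include h

/-- The formula is forced: it is the expansion of `test_ext` with the test values `(f, x i ◁ e j)`.
That it works for every `η` and `X` follows from the expansions of `η` and of `s(φ i, η) X` in the
dual bases. -/
theorem exists_coaction : ∃ δ : T →ₗ[k] G.Bal Ω T, ∀ f η X,
    sw (δ f) (fun ω g => P.pair ω (H.s (p g η) * X)) = p f (η <• X) := by
  obtain ⟨m, e, ω, he, -⟩ := h.base_perfect
  obtain ⟨n, x, φ, hx, -⟩ := h.perfect
  refine ⟨{ toFun := fun f => ∑ i, ∑ j, G.tmul (ω j * G.t (p f (x i <• e j))) (φ i)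
            map_add' := ?_
            map_smul' := ?_ }, fun f η X => ?_⟩
  · intro f g
    simp only [map_add, LinearMap.add_apply, t_add, mul_add, add_tmul, Finset.sum_add_distrib]
  · intro c f
    simp only [map_smul, LinearMap.smul_apply, t_smul, mul_smul_comm, smul_tmul,
      Finset.smul_sum, RingHom.id_apply]
  · have hB := isBal_test P h.left_t η X
    change sw (∑ i, ∑ j, G.tmul (ω j * G.t (p f (x i <• e j))) (φ i)) _ = _
    have ev (α g) := sw_tmul hB α g
    simp only [sw_sum hB, ev, P.pair_mul_t, ← h.right_s, ← map_sum]
    have he' (Y : R) : ∑ j, e j * H.s (P.pair (ω j) Y) = Y := he Y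
    congr 1
    simp only [← rsmul_mul, ← Finset.sum_smul, ← Finset.op_sum, he']
    simp only [rsmul_mul, ← Finset.smul_sum, hx]

variable {δ : T →ₗ[k] G.Bal Ω T}
  (hδ : ∀ f η X, sw (δ f) (fun ω g => P.pair ω (H.s (p g η) * X)) = p f (η <• X))

include hδ

theorem sum_coaction {f : T} {n : ℕ} {z : Fin n → Ω} {x : Fin n → T}
    (hf : δ f = ∑ i, G.tmul (z i) (x i)) (η : L.carrier) (X : R) :
    ∑ i, P.pair (z i) (H.s (p (x i) η) * X) = p f (η <• X) := by
  rw [← hδ, sw_rep (isBal_test P h.left_t η X) hf]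

theorem coaction_ext {n : ℕ} {z : Fin n → Ω} {x : Fin n → T} {w : G.Bal Ω T}
    (H' : ∀ η X, sw w (fun ω g => P.pair ω (H.s (p g η) * X)) =
      ∑ i, P.pair (z i) (H.s (p (x i) η) * X)) : w = ∑ i, G.tmul (z i) (x i) := by
  refine test_ext h.base_perfect h.perfect h.left_t fun η X => ?_
  rw [H', sw_rep (isBal_test P h.left_t η X) rfl]

/-- After testing, each axiom concerns `η ◁ X` only. Coassociativity becomes `η ◁ (XY) = (η ◁ X) ◁
Y`, and the counit law becomes `η ◁ 1 = η`. -/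
theorem comodule : IsLeftComodule G δ where
  bimod m a a' n z x hm := by
    refine h.coaction_ext hδ fun η X => ?_
    simp only [P.pair_mul_t, mul_assoc, P.pair_t_mul, ← Finset.mul_sum]
    rw [hδ, rsmul_mul, h.left_t, h.left_s, h.sum_coaction hδ hm, rsmul_mul]
  takeuchi m a n z x hm := by
    refine test_ext h.base_perfect h.perfect h.left_t fun η X => ?_
    rw [sw_rep (isBal_test P h.left_t η X) rfl, sw_rep (isBal_test P h.left_t η X) rfl]
    simp only [P.pair_s_mul, h.left_s, h.sum_coaction hδ hm, ← mul_assoc, ← H.s_comm_t]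
    simp only [mul_assoc, h.sum_coaction hδ hm, rsmul_mul]
  coassoc m n z x hm := by
    refine test_ext₃ h.base_perfect h.perfect h.left_t fun η X Y => ?_
    simp only [map_sum, lift₃_tmulLeft, lift₃_tmulRight]
    simp only [← P.sw_pair_mul, mul_assoc, h.sum_coaction hδ hm]
    have ev (i) (ω : Ω) : sw (δ (x i)) (fun ω' f => P.pair ω (H.s (P.pair ω'
        (H.s (p f η) * X)) * Y)) = P.pair ω (H.s (p (x i) (η <• X)) * Y) := by
      rw [← hδ, map_sw, sw_mul, map_sw]
    simp only [ev, h.sum_coaction hδ hm, rsmul_mul]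
  counit m n z x hm := by
    refine h.perfect.left_ext fun η => ?_
    have := h.sum_coaction hδ hm η 1
    rw [MulOpposite.op_one, one_smul] at this
    rw [← this, map_sum, LinearMap.sum_apply]
    refine Finset.sum_congr rfl fun i _ => ?_
    rw [h.left_t, ← P.pair_one, ← P.pair_mul_right_s, one_mul, mul_one]

/-- Tested against `η` and `X`, both sides become values of `(u, v) ↦ (α | v t(m, u))`, and the
claim is the Yetter-Drinfeld condition of `L` at `η` and `X`. -/
theorem yd (m : T) (α : Ω) (n : ℕ) (β γ : Fin n → Ω) (q : ℕ) (m₁ : Fin q → Ω) (m₀ : Fin q → T)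
    (r : Fin n → ℕ) (z : ∀ j, Fin (r j) → Ω) (l : ∀ j, Fin (r j) → T)
    (hα : G.Δ α = ∑ j, G.tmul (β j) (γ j)) (hm : δ m = ∑ i, G.tmul (m₁ i) (m₀ i))
    (hl : ∀ j, δ (m <• β j) = ∑ i, G.tmul (z j i) (l j i)) :
    ∑ j, ∑ i, G.tmul (γ j * z j i) (l j i) = ∑ j, ∑ i, G.tmul (m₁ i * β j) (m₀ i <• γ j) := by
  refine test_ext h.base_perfect h.perfect h.left_t fun η X => ?_
  have hB := isBal_test P h.left_t η X
  have ev (α' g) := sw_tmul hB α' g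
  simp only [sw_sum hB, ev]
  -- The product `γ j * z j i` is expanded through `Δ X`, the coaction of `m ◁ β j` is eliminated by
  -- `hδ`, and the action of `β j` by its definition.
  have e₁ (j) : ∑ i, P.pair (γ j * z j i) (H.s (p (l j i) η) * X) =
      sw (H.Δ X) fun x y => sw (L.δ (η <• y)) fun u v =>
        P.pair (β j) (H.s (P.pair (γ j) x) * (v * H.t (p m u))) := by
    have e (i) : P.pair (γ j * z j i) (H.s (p (l j i) η) * X) =
        sw (H.Δ X) fun x y => P.pair (z j i) (H.s (p (l j i) η) * (y * H.t (P.pair (γ j) x))) := by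
      rw [P.sw_mul_pair, H.sw_Δ_s_mul (P.isBal_mul_pair _ _)]
      simp only [mul_assoc]
    simp only [e, ← sw_sum_fun, h.sum_coaction hδ (hl j)]
    refine sw_congr fun x y => ?_
    rw [h.act, rsmul_mul, L.comodule.sw_t (isBal_act P h.right_s m (β j))]
    simp only [mul_assoc]
  have e₂ (i) (j) : P.pair (m₁ i * β j) (H.s (p (m₀ i <• γ j) η) * X) =
      sw (L.δ η) fun u v => sw (H.Δ X) fun x y =>
        P.pair (β j) (H.s (P.pair (γ j) (v * H.t (p (m₀ i) u))) * (y * H.t (P.pair (m₁ i) x))) := by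
    rw [P.sw_mul_pair, H.sw_Δ_s_mul (P.isBal_mul_pair _ _), sw_comm]
    refine sw_congr fun x y => ?_
    rw [h.act, map_sw, sw_mul, sw_mul, map_sw]
    simp only [mul_assoc]
  have e₃ (X' Y : R) : ∑ j, P.pair (β j) (H.s (P.pair (γ j) X') * Y) = P.pair α (X' * Y) :=
    (P.pair_mul' α X' Y _ _ _ hα).symm
  -- The Takeuchi condition moves the base element to the other leg of `Δ X`, where it completes the
  -- coaction formula for `(m, u ◁ x)`.
  have e₄ (u : L.carrier) (v : R) (i) :
      sw (H.Δ X) (fun x y => P.pair α (v * H.t (p (m₀ i) u) * (y * H.t (P.pair (m₁ i) x)))) =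
      sw (H.Δ X) fun x y => P.pair α (v * (y * H.t (P.pair (m₁ i) (H.s (p (m₀ i) u) * x)))) := by
    have hB : H.IsBal fun x y => P.pair α (v * (y * H.t (P.pair (m₁ i) x))) := by
      refine ⟨?_, ?_, fun x b y => ?_⟩
      · intros; simp [mul_add]
      · intros; simp [add_mul, mul_add]
      · simp [P.pair_mul_right_s, H.t_mul, mul_assoc]
    rw [H.sw_takeuchi hB]
    simp only [mul_assoc]
  rw [Finset.sum_comm (s := Finset.univ) (t := Finset.univ)
    (f := fun j i => P.pair (m₁ i * β j) (H.s (p (m₀ i <• γ j) η) * X))]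
  simp only [e₁, e₂, ← sw_sum_fun, e₃]
  simp only [sw_sum_fun, e₄]
  simp only [← sw_sum_fun, ← map_sum, ← Finset.mul_sum, ← t_sum, h.sum_coaction hδ hm]
  have := L.sw_yd (isBal_act P h.right_s m α) η X
  simp only [mul_assoc] at this
  exact this

omit h hδ

/-- The right dual is a left-right Yetter-Drinfeld module. -/
theorem exists_ydlr {T : Type u} [AddCommGroup T] [Module k T] [Module Ωᵐᵒᵖ T]
    [IsScalarTower k Ωᵐᵒᵖ T] {p : T →ₗ[k] L.carrier →ₗ[k] A} (h : IsDualModule P L p) :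
    ∃ (S : YDLR G) (q : S.carrier →ₗ[k] L.carrier →ₗ[k] A), IsYDPairing P S L q ∧
      IsPerfect G.toSourceTarget H.toSourceTarget q := by
  obtain ⟨δ, hδ⟩ := h.exists_coaction
  exact ⟨⟨T, δ, h.comodule hδ, h.yd hδ⟩, p, .of h.left_s h.left_t h.right_s h.act
    fun f η X => (hδ f η X).symm, h.perfect⟩

end IsDualModule

end

/-! ### Construction of the right dual. -/

section

variable {k : Type*} {A : Type u} {R Ω : Type*} [Field k] [Ring A] [Algebra k A]
  [Ring R] [Algebra k R] [Ring Ω] [Algebra k Ω]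
  {G : RightBialgebroid k A Ω} {H : RightBialgebroid k A R}

/-- The space of right `A`-linear maps to `A`. -/
def YDRR.dualSpace (L : YDRR H) : Submodule k (L.carrier →ₗ[k] A) where
  carrier := {φ | H.IsRightLinear φ}
  zero_mem' _ _ := by simp
  add_mem' h h' m a := by
    rw [LinearMap.add_apply, LinearMap.add_apply, h m a, h' m a, add_mul]
  smul_mem' c φ h m a := by
    rw [LinearMap.smul_apply, LinearMap.smul_apply, h m a, smul_mul_assoc]

namespace DualPairing

variable (P : DualPairing G H) (L : YDRR H)

variable {L} in
theorem isBal_dualAct (α : Ω) (f : L.dualSpace) :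
    H.IsBal fun (x : L.carrier) (z : R) => P.pair α (z * H.t (f.1 x)) := by
  refine ⟨?_, ?_, fun m a n => ?_⟩
  · intros; simp [mul_add]
  · intros; simp [add_mul]
  · have := f.2 m a
    simp [this, H.t_mul, mul_assoc]

variable {L} in
/-- The action of `Ω` on the right dual. -/
noncomputable def dualAct (α : Ω) (f : L.dualSpace) : L.dualSpace where
  val :=
    { toFun := fun η => sw (L.δ η) fun x z => P.pair α (z * H.t (f.1 x))
      map_add' := fun η ξ => by rw [map_add, sw_add (P.isBal_dualAct α f)]
      map_smul' := fun c η => by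
        rw [map_smul, sw_smul (P.isBal_dualAct α f)]
        · rfl
        · intro c m z
          rw [map_smul, t_smul, mul_smul_comm, map_smul] }
  property η a := by
    refine (L.comodule.sw_s (P.isBal_dualAct α f) η a).trans ?_
    refine Eq.trans ?_ (sw_mul (L.δ η) (fun x z => P.pair α (z * H.t (f.1 x))) a).symm
    simp only [mul_assoc, H.s_comm_t]
    simp only [← mul_assoc, P.pair_mul_right_s]

theorem dualAct_apply (α : Ω) (f : L.dualSpace) (η : L.carrier) :
    (P.dualAct α f).1 η = sw (L.δ η) fun x z => P.pair α (z * H.t (f.1 x)) := rfl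

/-- Since `(1 | X) = ε(X)`, `(s a | X) = ε(t a * X)` and `(t b | X) = ε(X * t b)`, this one
computation gives the action of `1`, `s a` and `t b` on the dual. -/
theorem sw_counit_dual (f : L.dualSpace) (η : L.carrier) (a b : A) :
    sw (L.δ η) (fun x z => H.ε (H.t a * z * H.t (f.1 x) * H.t b)) = b * f.1 (η <• H.t a) := by
  have e (x : L.carrier) (z : R) : H.ε (H.t a * z * H.t (f.1 x) * H.t b) =
      b * f.1 (x <• H.s (H.ε (H.t a * z))) := by
    rw [H.ε_mul_t, H.ε_mul_t, f.2]
  simp only [e, ← mul_sw, ← map_sw]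
  rw [← L.comodule.sw_takeuchi IsRightComodule.isBal_rsmul_ε]
  simp only [← rsmul_s_t]
  simp only [← sw_rsmul, L.comodule.sw_counit]

/-- The right dual as a right `Ω`-module. -/
@[reducible] noncomputable def dualModule : Module Ωᵐᵒᵖ L.dualSpace where
  smul α f := P.dualAct α.unop f
  one_smul f := Subtype.ext <| LinearMap.ext fun η => by
    refine (P.dualAct_apply L 1 f η).trans ?_
    simpa [P.one_pair, H.t_one] using sw_counit_dual L f η 1 1
  mul_smul α β f := Subtype.ext <| LinearMap.ext fun η => by
    change sw (L.δ η) (fun x z => P.pair (β.unop * α.unop) (z * H.t (f.1 x))) =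
      sw (L.δ η) (fun x z => P.pair α.unop (z * H.t (sw (L.δ x) fun x z => P.pair β.unop (z * H.t (f.1 x)))))
    simp only [t_sw, mul_sw, map_sw, P.sw_mul_pair, H.sw_Δ_mul_t (P.isBal_mul_pair _ _)]
    -- Once the pairing with a product is expanded through `Δ z`, the two sides differ by
    -- coassociativity of `L`.
    refine (L.comodule.sw_coassoc (B := fun x z z' => P.pair α.unop (z' * H.t (P.pair β.unop (z * H.t (f.1 x))))) ?_ η).symm
    refine ⟨?_, ?_, ?_, fun m a y z => ?_, fun m y a z => ?_⟩
    · intros; simp [mul_add]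
    · intros; simp [add_mul, mul_add]
    · intros; simp [add_mul]
    · have := f.2 m a
      simp [this, H.t_mul, mul_assoc]
    · simp [mul_assoc, H.s_comm_t]
      simp [← mul_assoc, P.pair_mul_right_s, H.t_mul]
  smul_zero α := Subtype.ext <| LinearMap.ext fun η => by
    refine (P.dualAct_apply L _ _ η).trans ?_
    simp [sw_zero_fun]
  smul_add α f g := Subtype.ext <| LinearMap.ext fun η => by
    refine (P.dualAct_apply L _ _ η).trans ?_
    simp only [Submodule.coe_add, LinearMap.add_apply, t_add, mul_add, map_add, sw_add_fun]
    rfl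
  add_smul α β f := Subtype.ext <| LinearMap.ext fun η => by
    refine (P.dualAct_apply L _ _ η).trans ?_
    simp only [MulOpposite.unop_add, map_add, LinearMap.add_apply, sw_add_fun]
    rfl
  zero_smul f := Subtype.ext <| LinearMap.ext fun η => by
    refine (P.dualAct_apply L _ _ η).trans ?_
    simp [sw_zero_fun]

/-- The right dual of a finitely generated projective Yetter-Drinfeld module. -/
theorem exists_dual (hP : IsPerfect G.toSourceTarget H.toSourceTarget P.pair)
    (hL : H.RightFGP L.carrier) :
    ∃ (S : YDLR G) (q : S.carrier →ₗ[k] L.carrier →ₗ[k] A), IsYDPairing P S L q ∧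
      IsPerfect G.toSourceTarget H.toSourceTarget q := by
  let := P.dualModule L
  have act (f : L.dualSpace) (α : Ω) (η : L.carrier) : (f <• α).1 η =
      sw (L.δ η) fun x z => P.pair α (z * H.t (f.1 x)) := rfl
  have left_t (f : L.dualSpace) (η : L.carrier) (a : A) : (f <• G.t a).1 η = a * f.1 η := by
    rw [act]
    have e (X : R) : P.pair (G.t a) X = H.ε (X * H.t a) := by
      rw [← P.one_pair, ← P.pair_t_mul, mul_one]
    simpa [e, H.t_one] using sw_counit_dual L f η 1 a
  have : IsScalarTower k Ωᵐᵒᵖ L.dualSpace := ⟨fun c α f => Subtype.ext <| LinearMap.ext fun η => by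
    refine (P.dualAct_apply L _ _ η).trans ?_
    simp only [MulOpposite.unop_smul, map_smul, LinearMap.smul_apply, ← smul_sw]
    rfl⟩
  refine IsDualModule.exists_ydlr (P := P) (T := L.dualSpace) (p := L.dualSpace.subtype)
    ⟨fun f η a => ?_, left_t, fun (f : L.dualSpace) η a => f.2 η a, act, hP, ?_⟩
  · refine (act _ _ _).trans ?_
    have e (X : R) : P.pair (G.s a) X = H.ε (H.t a * X) := by
      rw [← P.one_pair, ← P.pair_s_mul, mul_one]
    simpa [e, H.t_one, mul_assoc] using sw_counit_dual L f η a 1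
  -- The coordinate functionals of `L` are themselves elements of the dual, so they form its basis.
  · obtain ⟨n, x, φ, hφ, hx⟩ := hL
    refine ⟨n, x, fun i => ⟨φ i, hφ i⟩, fun η => (hx η).symm, fun f => Subtype.ext <|
      LinearMap.ext fun η => ?_⟩
    rw [AddSubmonoidClass.coe_finsetSum, LinearMap.sum_apply]
    conv_rhs => rw [hx η, map_sum]
    exact Finset.sum_congr rfl fun i _ => (left_t _ _ _).trans (f.2 _ _).symm

end DualPairing

end

/-! ### Dual morphisms, coopposite pairings and preduals. -/

section

variable {k : Type*} {A A' : Type u} {R Ω : Type*} [Field k] [Ring A] [Algebra k A]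
  [Ring A'] [Algebra k A'] [Ring R] [Algebra k R] [Ring Ω] [Algebra k Ω]
  {G : RightBialgebroid k A Ω} {H : RightBialgebroid k A R}
  {G' : RightBialgebroid k A' Ω} {H' : RightBialgebroid k A' R}

/-! ### Morphisms of dual modules -/

/-- A morphism of right-right modules has a dual morphism of left-right modules. -/
theorem IsYDPairing.exists_dualHom {P : DualPairing G H} {T T' : YDLR G} {L L' : YDRR H}
    {p : T.carrier →ₗ[k] L.carrier →ₗ[k] A} {p' : T'.carrier →ₗ[k] L'.carrier →ₗ[k] A}
    (h : IsYDPairing P T L p) (h' : IsYDPairing P T' L' p')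
    (hP : IsPerfect G.toSourceTarget H.toSourceTarget P.pair)
    (hp : IsPerfect G.toSourceTarget H.toSourceTarget p) (g : L ⟶ L') :
    ∃ φ : T' ⟶ T, ∀ f η, p (YDLR.ap φ f) η = p' f (YDRR.ap g η) := by
  have hφ (f : T'.carrier) : ∃ f', ∀ η, p f' η = p' f (YDRR.ap g η) := by
    obtain ⟨f', hf', -⟩ := hp.existsUnique h.left_t
      ((p' f) ∘ₗ ((YDRR.ap g).restrictScalars k)) fun m a => by
        have := h'.right_s f (YDRR.ap g m) a
        rwa [← map_smul] at this
    exact ⟨f', fun η => LinearMap.congr_fun hf' η⟩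
  choose φ hφ using hφ
  have add (f f') : φ (f + f') = φ f + φ f' := hp.left_ext fun η => by simp [hφ]
  -- The action on the duals is defined by the coactions, so linearity of `φ` comes from colinearity
  -- of `g`.
  have act (f) (α : Ω) : φ (f <• α) = φ f <• α := hp.left_ext fun η => by
    rw [hφ, h'.act, h.act, YDRR.sw_δ_ap g (isBal_act P h'.right_s f α)]
    simp only [hφ]
  refine ⟨YDLR.Hom.mk { toFun := φ, map_add' := add, map_smul' := fun α f => act f α.unop }
    fun f n z x hf => ?_, hφ⟩
  -- Conversely, testing reduces colinearity of `φ` to `R`-linearity of `g`.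
  refine test_ext hP hp h.left_t fun η X => ?_
  rw [sw_rep (isBal_test P h.left_t η X) rfl, ← h.coact]
  refine (hφ f (η <• X)).trans ?_
  rw [map_smul, h'.act_right f _ X n z x hf]
  refine Finset.sum_congr rfl fun i _ => ?_
  rw [← hφ]
  rfl

/-! ### The coopposite pairing -/

/-- The pairing of the coopposite bialgebroids. -/
noncomputable def DualPairing.cop (P : DualPairing G H) (c : CopPair G G') (d : CopPair H H')
    (hcd : c.θ = d.θ) : DualPairing H' G' where
  -- The bialgebroids change places: each rule for a product in `Ω` becomes the rule for a product
  -- on the other side, and conversely.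
  pair := P.pair.flip.compr₂ d.θ.toLinearMap
  bimod a b b' a' f X α := by
    obtain ⟨a, rfl⟩ := d.θ.surjective a
    obtain ⟨b, rfl⟩ := d.θ.surjective b
    obtain ⟨b', rfl⟩ := d.θ.surjective b'
    obtain ⟨a', rfl⟩ := d.θ.surjective a'
    obtain ⟨f, rfl⟩ := d.θ.surjective f
    have := P.bimod a b' b f a' α X
    simp only [LinearMap.compr₂_apply, LinearMap.flip_apply, LinearEquiv.coe_coe, d.s_θ, d.t_θ]
    simp only [← hcd, c.s_θ, c.t_θ, ← c.θ_mul]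
    rw [← H.s_comm_t, mul_assoc _ (H.t b'), ← H.s_comm_t, ← mul_assoc, ← this, ← G.s_comm_t,
      mul_assoc _ (G.t f), ← G.s_comm_t, ← mul_assoc]
  mul_pair X Y α n x y h := by
    rw [c.Δ_eq, c.swap_eq_sum] at h
    simp only [LinearMap.compr₂_apply, LinearMap.flip_apply, LinearEquiv.coe_coe, ← hcd, c.t_θ,
      P.pair_mul α X Y n y x h, map_sum]
  mul_pair' X Y α n x y h := by
    rw [c.Δ_eq, c.swap_eq_sum] at h
    simp only [LinearMap.compr₂_apply, LinearMap.flip_apply, LinearEquiv.coe_coe, d.t_θ,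
      P.pair_mul' α X Y n y x h, map_sum]
  pair_mul X α β n x y h := by
    rw [d.Δ_eq, d.swap_eq_sum] at h
    simp only [LinearMap.compr₂_apply, LinearMap.flip_apply, LinearEquiv.coe_coe, d.s_θ,
      P.mul_pair α β X n y x h, map_sum]
  pair_mul' X α β n x y h := by
    rw [d.Δ_eq, d.swap_eq_sum] at h
    simp only [LinearMap.compr₂_apply, LinearMap.flip_apply, LinearEquiv.coe_coe, ← hcd, c.s_θ,
      P.mul_pair' α β X n y x h, map_sum]
  pair_one X := by rw [d.ε_eq, ← P.one_pair]; rfl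
  one_pair α := by rw [c.ε_eq, ← P.pair_one, hcd]; rfl

theorem IsPerfect.cop {T L : Type*} [AddCommGroup T] [Module k T] [Module Ωᵐᵒᵖ T]
    [AddCommGroup L] [Module k L] [Module Rᵐᵒᵖ L] {p : T →ₗ[k] L →ₗ[k] A}
    (h : IsPerfect G.toSourceTarget H.toSourceTarget p) (c : CopPair G G') (d : CopPair H H')
    (hcd : c.θ = d.θ) :
    IsPerfect H'.toSourceTarget G'.toSourceTarget (p.flip.compr₂ d.θ.toLinearMap) := by
  obtain ⟨n, x, f, hx, hf⟩ := h
  refine ⟨n, f, x, fun g => ?_, fun η => ?_⟩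
  · simpa only [LinearMap.compr₂_apply, LinearMap.flip_apply, LinearEquiv.coe_coe, ← hcd, c.s_θ]
      using hf g
  · simpa only [LinearMap.compr₂_apply, LinearMap.flip_apply, LinearEquiv.coe_coe, d.t_θ]
      using hx η

/-- The two modules change places, so that a statement about duals becomes one about preduals. -/
theorem IsYDPairing.cop {P : DualPairing G H} {T : YDLR G} {L : YDRR H}
    {p : T.carrier →ₗ[k] L.carrier →ₗ[k] A} (h : IsYDPairing P T L p) (c : CopPair G G')
    (d : CopPair H H') (hcd : c.θ = d.θ) :
    IsYDPairing (P.cop c d hcd) (L.toLR d) (T.toRR c) (p.flip.compr₂ d.θ.toLinearMap) where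
  bimod η f a b b' := by
    obtain ⟨a, rfl⟩ := d.θ.surjective a
    obtain ⟨b, rfl⟩ := d.θ.surjective b
    obtain ⟨b', rfl⟩ := d.θ.surjective b'
    have := h.bimod f η a b' b
    simp only [LinearMap.compr₂_apply, LinearMap.flip_apply, LinearEquiv.coe_coe, d.s_θ, d.t_θ]
    simp only [← hcd, c.s_θ, c.t_θ, ← c.θ_mul]
    rw [← H.s_comm_t, ← this, ← G.s_comm_t]
  act_left η X f n x z hf := by
    simp only [LinearMap.compr₂_apply, LinearMap.flip_apply, LinearEquiv.coe_coe, d.t_θ,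
      h.act_right f η X n z x (c.swap_eq_sum.1 hf), map_sum, DualPairing.cop]
  act_left' η X f n x z hf := by
    simp only [LinearMap.compr₂_apply, LinearMap.flip_apply, LinearEquiv.coe_coe, ← hcd, c.t_θ,
      h.act_right' f η X n z x (c.swap_eq_sum.1 hf), map_sum, DualPairing.cop]
  act_right η f α n z x hη := by
    simp only [LinearMap.compr₂_apply, LinearMap.flip_apply, LinearEquiv.coe_coe, ← hcd, c.s_θ,
      h.act_left f α η n x z (d.swap_eq_sum.1 hη), map_sum, DualPairing.cop]
  act_right' η f α n z x hη := by
    simp only [LinearMap.compr₂_apply, LinearMap.flip_apply, LinearEquiv.coe_coe, d.s_θ,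
      h.act_left' f α η n x z (d.swap_eq_sum.1 hη), map_sum, DualPairing.cop]

/-- The way back: a dual built for the coopposite pairing is read as a predual for `P`. It is stated
for arbitrary `S` because such a dual is not given as `L.toLR d`. -/
theorem IsYDPairing.of_cop {P : DualPairing G H} {c : CopPair G G'} {d : CopPair H H'}
    {hcd : c.θ = d.θ} {T : YDLR G} {S : YDLR H'}
    {q : S.carrier →ₗ[k] (T.toRR c).carrier →ₗ[k] A'}
    (h : IsYDPairing (P.cop c d hcd) S (T.toRR c) q) :
    IsYDPairing P T (S.toRR d.symm) (q.flip.compr₂ d.θ.symm.toLinearMap) := by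
  have hq : ∀ (η : S.carrier) (f : T.carrier),
      q η f = d.θ ((q.flip.compr₂ d.θ.symm.toLinearMap) f η) := by simp
  have hP : ∀ X α, (P.cop c d hcd).pair X α = d.θ (P.pair α X) := fun _ _ => rfl
  refine
  { bimod := fun f η a b b' => ?_
    act_left := fun f α η n x z hη => ?_
    act_left' := fun f α η n x z hη => ?_
    act_right := fun f η X n z x hf => ?_
    act_right' := fun f η X n z x hf => ?_ }
  · have := h.bimod η f (d.θ a) (d.θ b') (d.θ b)
    apply d.θ.injective
    simp only [hq, ← d.θ_mul, d.s_θ, d.t_θ] at this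
    rw [← hcd, c.s_θ, c.t_θ, hcd, EmbeddingLike.apply_eq_iff_eq] at this
    rw [G.s_comm_t, ← this, H.s_comm_t]
  · have := h.act_right η f α n z x ((d.symm.swap_eq_sum (w := S.δ η)).1 hη)
    apply d.θ.injective
    simp only [hq, hP, map_sum] at this ⊢
    simpa only [← hcd, c.s_θ] using this
  · have := h.act_right' η f α n z x ((d.symm.swap_eq_sum (w := S.δ η)).1 hη)
    apply d.θ.injective
    simp only [hq, hP, map_sum, d.s_θ] at this ⊢
    exact this
  · have := h.act_left η X f n x z (c.swap_eq_sum.2 hf)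
    apply d.θ.injective
    simp only [hq, hP, map_sum, d.t_θ] at this ⊢
    exact this
  · have := h.act_left' η X f n x z (c.swap_eq_sum.2 hf)
    apply d.θ.injective
    simp only [hq, hP, map_sum] at this ⊢
    simpa only [← hcd, c.t_θ] using this

/-- A morphism of left-right modules has a dual morphism of right-right modules. -/
theorem IsYDPairing.exists_predualHom {P : DualPairing G H} {T T' : YDLR G} {L L' : YDRR H}
    {p : T.carrier →ₗ[k] L.carrier →ₗ[k] A} {p' : T'.carrier →ₗ[k] L'.carrier →ₗ[k] A}
    (h : IsYDPairing P T L p) (h' : IsYDPairing P T' L' p')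
    (hP : IsPerfect G.toSourceTarget H.toSourceTarget P.pair)
    (hp' : IsPerfect G.toSourceTarget H.toSourceTarget p') (φ : T' ⟶ T) :
    ∃ g : L ⟶ L', ∀ f η, p (YDLR.ap φ f) η = p' f (YDRR.ap g η) := by
  -- In the coopposite pairing `φ` is a morphism of right-right modules, and its dual goes between
  -- the flips of `L` and `L'`.
  obtain ⟨ψ, hψ⟩ := (h'.cop G.copPair H.copPair rfl).exists_dualHom
    (h.cop G.copPair H.copPair rfl) (hP.cop G.copPair H.copPair rfl)
    (hp'.cop G.copPair H.copPair rfl) (YDLR.homToRR G.copPair φ)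
  refine ⟨YDRR.Hom.mk (YDLR.ap ψ) fun m n x z hm => H.swapPair.swap_eq_sum.1
    (YDLR.Hom.colinear ψ m n z x (H.swapPair.swap_eq_sum.2 hm)), fun f η => ?_⟩
  exact (MulOpposite.op_injective (hψ η f)).symm

/-- Every finitely generated projective left-right module is a right dual. -/
theorem DualPairing.exists_predual (P : DualPairing G H) (T : YDLR G)
    (hP : IsPerfect G.toSourceTarget H.toSourceTarget P.pair) (hT : G.LeftFGP T.carrier) :
    ∃ (L : YDRR H) (p : T.carrier →ₗ[k] L.carrier →ₗ[k] A), IsYDPairing P T L p ∧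
      IsPerfect G.toSourceTarget H.toSourceTarget p := by
  obtain ⟨S, q, hq, hq'⟩ := (P.cop G.copPair H.copPair rfl).exists_dual
    (L := T.toRR G.copPair) (hP.cop G.copPair H.copPair rfl) (G.copPair.rightFGP hT)
  exact ⟨S.toRR H.copPair.symm, _, hq.of_cop, hq'.cop H.copPair.symm G.copPair.symm rfl⟩

end

/-! ### Tensor products of pairings, using only the diagonal description of the monoidal structures.
-/

section

variable {k : Type*} {A : Type u} {R Ω : Type*} [Field k] [Ring A] [Algebra k A]
  [Ring R] [Algebra k R] [Ring Ω] [Algebra k Ω]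
  {G : RightBialgebroid k A Ω} {H : RightBialgebroid k A R}

theorem RightBialgebroid.Δ_s_eq (a : A) : H.Δ (H.s a) = H.tmul 1 (H.s a) := by
  simpa using H.Δ_bimod 1 a 1 1 (fun _ => 1) (fun _ => 1) (by simp [H.Δ_one])

theorem RightBialgebroid.Δ_t_eq (a : A) : H.Δ (H.t a) = H.tmul (H.t a) 1 := by
  simpa using H.Δ_bimod 1 1 a 1 (fun _ => 1) (fun _ => 1) (by simp [H.Δ_one])

namespace RRDiagonal

variable [MonoidalCategory (RRFGP H)] (T : RRDiagonal H) {M N : RRFGP H}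

theorem induction {C : (M ⊗ N : RRFGP H).El → Prop} (w : (M ⊗ N : RRFGP H).El) (h0 : C 0)
    (h1 : ∀ m n, C (T.tens M N (H.tmul m n))) (h2 : ∀ w w', C w → C w' → C (w + w')) : C w := by
  obtain ⟨w, rfl⟩ := (T.tens M N).surjective w
  induction w using bal_induction with
  | h0 => rwa [map_zero]
  | h1 m n => exact h1 m n
  | h2 w w' hw hw' => rw [map_add]; exact h2 _ _ hw hw'

theorem sw_tens_act (m : M.El) (n : N.El) (X : R) : T.tens M N (H.tmul m n) <• X =
    sw (H.Δ X) fun x y => T.tens M N (H.tmul (m <• x) (n <• y)) :=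
  T.tens_act M N m n X _ _ _ (rep_spec _)

theorem sw_tens_coact (m : M.El) (n : N.El) : (M ⊗ N : RRFGP H).obj.δ (T.tens M N (H.tmul m n)) =
    sw (M.obj.δ m) fun x z => sw (N.obj.δ n) fun x' z' =>
      H.tmul (T.tens M N (H.tmul x x')) (z * z') :=
  T.tens_coact M N m n _ _ _ _ _ _ (rep_spec _) (rep_spec _)

theorem tens_s (m : M.El) (n : N.El) (a : A) :
    T.tens M N (H.tmul m n) <• H.s a = T.tens M N (H.tmul m (n <• H.s a)) := by
  simpa using T.tens_act M N m n (H.s a) 1 (fun _ => 1) (fun _ => H.s a) (by simp [H.Δ_s_eq])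

theorem tens_t (m : M.El) (n : N.El) (a : A) :
    T.tens M N (H.tmul m n) <• H.t a = T.tens M N (H.tmul (m <• H.t a) n) := by
  simpa using T.tens_act M N m n (H.t a) 1 (fun _ => H.t a) (fun _ => 1) (by simp [H.Δ_t_eq])

end RRDiagonal

namespace LRDiagonal

variable [MonoidalCategory (LRFGP G)] (T : LRDiagonal G) {M N : LRFGP G}

theorem induction {C : (M ⊗ N : LRFGP G).El → Prop} (w : (M ⊗ N : LRFGP G).El) (h0 : C 0)
    (h1 : ∀ m n, C (T.tens M N (G.tmul m n))) (h2 : ∀ w w', C w → C w' → C (w + w')) : C w := by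
  obtain ⟨w, rfl⟩ := (T.tens M N).surjective w
  induction w using bal_induction with
  | h0 => rwa [map_zero]
  | h1 m n => exact h1 m n
  | h2 w w' hw hw' => rw [map_add]; exact h2 _ _ hw hw'

theorem sw_tens_act (m : M.El) (n : N.El) (X : Ω) : T.tens M N (G.tmul m n) <• X =
    sw (G.Δ X) fun x y => T.tens M N (G.tmul (m <• x) (n <• y)) :=
  T.tens_act M N m n X _ _ _ (rep_spec _)

theorem sw_tens_coact (m : M.El) (n : N.El) : (M ⊗ N : LRFGP G).obj.δ (T.tens M N (G.tmul m n)) =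
    sw (M.obj.δ m) fun z x => sw (N.obj.δ n) fun z' x' =>
      G.tmul (z' * z) (T.tens M N (G.tmul x x')) :=
  T.tens_coact M N m n _ _ _ _ _ _ (rep_spec _) (rep_spec _)

theorem tens_s (m : M.El) (n : N.El) (a : A) :
    T.tens M N (G.tmul m n) <• G.s a = T.tens M N (G.tmul m (n <• G.s a)) := by
  simpa using T.tens_act M N m n (G.s a) 1 (fun _ => 1) (fun _ => G.s a) (by simp [G.Δ_s_eq])

theorem tens_t (m : M.El) (n : N.El) (a : A) :
    T.tens M N (G.tmul m n) <• G.t a = T.tens M N (G.tmul (m <• G.t a) n) := by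
  simpa using T.tens_act M N m n (G.t a) 1 (fun _ => G.t a) (fun _ => 1) (by simp [G.Δ_t_eq])

end LRDiagonal

/-! ### Pairings of tensor products -/

section TensorPairing

variable {P : DualPairing G H} {S₁ S₂ : LRFGP G} {L₁ L₂ : RRFGP H}
  {p₁ : S₁.El →ₗ[k] L₁.El →ₗ[k] A} {p₂ : S₂.El →ₗ[k] L₂.El →ₗ[k] A}
  (h₁ : IsYDPairing P S₁.obj L₁.obj p₁) (h₂ : IsYDPairing P S₂.obj L₂.obj p₂)

include h₁ in
theorem isBal_tensorPairing_right (f : S₁.El) (g : S₂.El) :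
    H.IsBal fun (η : L₁.El) (ξ : L₂.El) => p₂ g (ξ <• H.t (p₁ f η)) := by
  refine ⟨?_, ?_, fun m a n => ?_⟩
  · intros; simp [add_smul]
  · intros; simp
  · simp [h₁.right_s, H.t_mul, mul_smul]

include h₁ in
/-- The pairing with a pure tensor. -/
noncomputable def tensorPairingRight (f : S₁.El) (g : S₂.El) : H.Bal L₁.El L₂.El →ₗ[k] A :=
  liftₗ _ (isBal_tensorPairing_right (p₂ := p₂) h₁ f g) fun c η ξ => by
    rw [(p₁ f).map_smul, H.t_smul, MulOpposite.op_smul, smul_assoc, (p₂ g).map_smul]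

theorem tensorPairingRight_tmul (f : S₁.El) (g : S₂.El) (η : L₁.El) (ξ : L₂.El) :
    tensorPairingRight (p₂ := p₂) h₁ f g (H.tmul η ξ) = p₂ g (ξ <• H.t (p₁ f η)) := rfl

include h₂ in
theorem isBal_tensorPairing_left :
    G.IsBal fun (g : S₂.El) (f : S₁.El) => tensorPairingRight (p₂ := p₂) h₁ f g := by
  refine ⟨fun g g' f => ?_, fun g f f' => ?_, fun g a f => ?_⟩
  · refine LinearMap.ext fun w => addHom_ext _ (tensorPairingRight (p₂ := p₂) h₁ f g +
      tensorPairingRight h₁ f g') (fun η ξ => ?_) w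
    simp [tensorPairingRight_tmul]
  · refine LinearMap.ext fun w => addHom_ext _ (tensorPairingRight (p₂ := p₂) h₁ f g +
      tensorPairingRight h₁ f' g) (fun η ξ => ?_) w
    simp [tensorPairingRight_tmul, add_smul]
  · refine LinearMap.ext fun w => addHom_ext _ (tensorPairingRight (p₂ := p₂) h₁ (f <• G.t a) g)
      (fun η ξ => ?_) w
    simp [tensorPairingRight_tmul, h₂.left_s, h₁.left_t, H.t_mul, mul_smul]

variable [MonoidalCategory (RRFGP H)] [MonoidalCategory (LRFGP G)] (T : RRDiagonal H)
  (T' : LRDiagonal G)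

/-- The pairing `(g ⊗ f, η ⊗ ξ) = (g, ξ ◁ t(f, η))` of tensor products. -/
noncomputable def tensorPairing :
    (S₂ ⊗ S₁ : LRFGP G).El →ₗ[k] (L₁ ⊗ L₂ : RRFGP H).El →ₗ[k] A :=
  (liftₗ _ (isBal_tensorPairing_left h₁ h₂) fun c g f => by
    refine LinearMap.ext fun w => addHom_ext _ (c • tensorPairingRight (p₂ := p₂) h₁ f g)
      (fun η ξ => ?_) w
    simp [tensorPairingRight_tmul]).compl₁₂ (T'.tens S₂ S₁).symm.toLinearMap
    (T.tens L₁ L₂).symm.toLinearMap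

theorem tensorPairing_tens (f : S₁.El) (g : S₂.El) (η : L₁.El) (ξ : L₂.El) :
    tensorPairing h₁ h₂ T T' (T'.tens S₂ S₁ (G.tmul g f)) (T.tens L₁ L₂ (H.tmul η ξ)) =
      p₂ g (ξ <• H.t (p₁ f η)) := by
  simp only [tensorPairing, LinearMap.compl₁₂_apply, LinearEquiv.coe_coe,
    LinearEquiv.symm_apply_apply]
  rfl

theorem tensorPairing_left_s (w) (v) (a : A) : tensorPairing h₁ h₂ T T' (w <• G.s a) v =
    tensorPairing h₁ h₂ T T' w (v <• H.t a) := by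
  induction w using T'.induction with
  | h0 => simp
  | h1 g f =>
    induction v using T.induction with
    | h0 => simp
    | h1 η ξ =>
      rw [T'.tens_s, T.tens_t, tensorPairing_tens, tensorPairing_tens, h₁.left_s]
    | h2 v v' hv hv' => simp only [smul_add, map_add, hv, hv']
  | h2 w w' hw hw' => simp only [smul_add, map_add, LinearMap.add_apply, hw, hw']

theorem tensorPairing_left_t (w) (v) (a : A) : tensorPairing h₁ h₂ T T' (w <• G.t a) v =
    a * tensorPairing h₁ h₂ T T' w v := by
  induction w using T'.induction with
  | h0 => simp
  | h1 g f =>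
    induction v using T.induction with
    | h0 => simp
    | h1 η ξ =>
      rw [T'.tens_t, tensorPairing_tens, tensorPairing_tens, h₂.left_t]
    | h2 v v' hv hv' => simp only [map_add, hv, hv', mul_add]
  | h2 w w' hw hw' => simp only [smul_add, map_add, LinearMap.add_apply, hw, hw', mul_add]

theorem tensorPairing_right_s (w) (v) (a : A) : tensorPairing h₁ h₂ T T' w (v <• H.s a) =
    tensorPairing h₁ h₂ T T' w v * a := by
  induction w using T'.induction with
  | h0 => simp
  | h1 g f =>
    induction v using T.induction with
    | h0 => simp
    | h1 η ξ =>
      rw [T.tens_s, tensorPairing_tens, tensorPairing_tens, ← h₂.right_s, H.rsmul_s_t]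
    | h2 v v' hv hv' => simp only [smul_add, map_add, hv, hv', add_mul]
  | h2 w w' hw hw' => simp only [map_add, LinearMap.add_apply, hw, hw', add_mul]

/-- On pure tensors the left side is a sum of `(α₁ | s(α₂ | η₁ t(f, η₀)) ξ₁ t(g, ξ₀))`, which the
product rule for the pairing collapses to one pairing with `α`. The diagonal coaction gives the same
up to the Takeuchi condition for the coaction on `ξ`. -/
theorem tensorPairing_act (w) (α : Ω) (v) : tensorPairing h₁ h₂ T T' (w <• α) v =
    sw ((L₁ ⊗ L₂ : RRFGP H).obj.δ v) fun x z =>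
      P.pair α (z * H.t (tensorPairing h₁ h₂ T T' w x)) := by
  induction w using T'.induction with
  | h0 => simp [sw_zero_fun]
  | h1 g f =>
    have hB := isBal_act P (tensorPairing_right_s h₁ h₂ T T') (T'.tens S₂ S₁ (G.tmul g f)) α
    induction v using T.induction with
    | h0 => simp [sw_zero hB]
    | h1 η ξ =>
      have hB' (X : R) : H.IsBal fun (x : L₂.El) (z : R) =>
          P.pair α (X * (z * H.t (p₂ g x))) := by
        refine ⟨?_, ?_, fun m a n => ?_⟩
        · intros; simp [mul_add]
        · intros; simp [add_mul, mul_add]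
        · simp [h₂.right_s, H.t_mul, mul_assoc]
      have eL (β γ : Ω) : tensorPairing h₁ h₂ T T' (T'.tens S₂ S₁ (G.tmul (g <• β) (f <• γ)))
          (T.tens L₁ L₂ (H.tmul η ξ)) = sw (L₁.obj.δ η) fun x z => sw (L₂.obj.δ ξ) fun x' z' =>
            P.pair β (H.s (P.pair γ (z * H.t (p₁ f x))) * (z' * H.t (p₂ g x'))) := by
        rw [tensorPairing_tens, h₂.act, L₂.obj.comodule.sw_t (isBal_act P h₂.right_s g β), h₁.act,
          sw_comm]
        refine sw_congr fun x' z' => ?_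
        rw [map_sw, sw_mul, sw_mul, map_sw]
        simp only [mul_assoc]
      have eR (x : L₁.El) (z : R) : sw (sw (L₂.obj.δ ξ) fun x' z' =>
          H.tmul (T.tens L₁ L₂ (H.tmul x x')) (z * z')) (fun x z => P.pair α (z * H.t
            (tensorPairing h₁ h₂ T T' (T'.tens S₂ S₁ (G.tmul g f)) x))) =
          sw (L₂.obj.δ ξ) fun x' z' => P.pair α (z * (z' * H.t (p₂ g (x' <• H.t (p₁ f x))))) := by
        rw [sw_sw hB]
        refine sw_congr fun x' z' => ?_
        rw [sw_tmul hB, tensorPairing_tens, mul_assoc]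
      rw [T.sw_tens_coact, sw_sw hB, T'.sw_tens_act, map_sw, sw_apply]
      simp only [eL, eR]
      rw [sw_comm]
      refine sw_congr fun x z => ?_
      rw [sw_comm, L₂.obj.comodule.sw_takeuchi (hB' z)]
      simp only [← P.sw_pair_mul, mul_assoc]
    | h2 v v' hv hv' => simp only [map_add, hv, hv', sw_add hB]
  | h2 w w' hw hw' =>
    simp only [smul_add, map_add, LinearMap.add_apply, hw, hw', t_add, mul_add, sw_add_fun]

/-- The reversed product of coefficients on `g ⊗ f` is expanded by the rule for `(αβ | X)`. The
match with `(g, ξ ◁ X₂ t(f, η ◁ X₁))` uses the Takeuchi condition for `Δ X`. -/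
theorem tensorPairing_coact (w) (v) (X : R) : tensorPairing h₁ h₂ T T' w (v <• X) =
    sw ((S₂ ⊗ S₁ : LRFGP G).obj.δ w) fun ω g =>
      P.pair ω (H.s (tensorPairing h₁ h₂ T T' g v) * X) := by
  have hB (v) := isBal_test P (tensorPairing_left_t h₁ h₂ T T') v X
  induction w using T'.induction with
  | h0 => simp [sw_zero (hB _)]
  | h1 g f =>
    induction v using T.induction with
    | h0 => simp [sw_zero_fun]
    | h1 η ξ =>
      have hB' (Y : Ω) : H.IsBal fun x y : R => p₂ g (ξ <• (y * H.t (P.pair Y x))) := by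
        refine ⟨?_, ?_, fun m a n => ?_⟩
        · intros; simp [mul_add, add_smul]
        · intros; simp [add_mul, add_smul]
        · simp [P.pair_mul_right_s, H.t_mul, mul_assoc, mul_smul]
      have eL (x y : R) : tensorPairing h₁ h₂ T T' (T'.tens S₂ S₁ (G.tmul g f))
          (T.tens L₁ L₂ (H.tmul (η <• x) (ξ <• y))) = sw (S₁.obj.δ f) fun ω f' =>
            p₂ g (ξ <• (y * H.t (P.pair ω (H.s (p₁ f' η) * x)))) := by
        rw [tensorPairing_tens, h₁.coact, ← rsmul_mul, t_sw, mul_sw, rsmul_sw, map_sw]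
      have eR (ω : Ω) (g' : S₂.El) : sw (sw (S₁.obj.δ f) fun ω' f' =>
          G.tmul (ω' * ω) (T'.tens S₂ S₁ (G.tmul g' f'))) (fun ω w => P.pair ω (H.s
            (tensorPairing h₁ h₂ T T' w (T.tens L₁ L₂ (H.tmul η ξ))) * X)) =
          sw (S₁.obj.δ f) fun ω' f' => sw (H.Δ X) fun x y => P.pair ω
            (H.s (p₂ g' (ξ <• H.t (p₁ f' η))) * (y * H.t (P.pair ω' x))) := by
        rw [sw_sw (hB _)]
        refine sw_congr fun ω' f' => ?_
        rw [sw_tmul (hB _), tensorPairing_tens, P.sw_mul_pair,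
          H.sw_Δ_s_mul (P.isBal_mul_pair _ _)]
        simp only [mul_assoc]
      rw [T'.sw_tens_coact, sw_sw (hB _), T.sw_tens_act, map_sw]
      simp only [eL, eR]
      rw [sw_comm, sw_comm (w := S₂.obj.δ g)]
      refine sw_congr fun ω f' => ?_
      rw [H.sw_takeuchi (hB' ω), sw_comm]
      refine sw_congr fun x y => ?_
      rw [mul_assoc, rsmul_mul, h₂.coact]
    | h2 v v' hv hv' =>
      simp only [smul_add, map_add, hv, hv', add_mul, sw_add_fun]
  | h2 w w' hw hw' =>
    simp only [map_add, LinearMap.add_apply, hw, hw', sw_add (hB _)]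

theorem tensorPairing_isYDPairing : IsYDPairing P (S₂ ⊗ S₁ : LRFGP G).obj (L₁ ⊗ L₂ : RRFGP H).obj
    (tensorPairing h₁ h₂ T T') :=
  .of (tensorPairing_left_s h₁ h₂ T T') (tensorPairing_left_t h₁ h₂ T T')
    (tensorPairing_right_s h₁ h₂ T T') (tensorPairing_act h₁ h₂ T T')
    (tensorPairing_coact h₁ h₂ T T')

/-- The families `x i ⊗ y j` and `g j ⊗ f i` are dual bases: the contraction over one index leaves
the contraction over the other. -/
theorem tensorPairing_isPerfect (hp₁ : IsPerfect G.toSourceTarget H.toSourceTarget p₁)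
    (hp₂ : IsPerfect G.toSourceTarget H.toSourceTarget p₂) :
    IsPerfect G.toSourceTarget H.toSourceTarget (tensorPairing h₁ h₂ T T') := by
  obtain ⟨n, x, f, hx, hf⟩ := hp₁
  obtain ⟨m, y, g, hy, hg⟩ := hp₂
  refine .of_fintype (ι := Fin n × Fin m) (fun i => T.tens L₁ L₂ (H.tmul (x i.1) (y i.2)))
    (fun i => T'.tens S₂ S₁ (G.tmul (g i.2) (f i.1))) (fun v => ?_) (fun w => ?_)
  · induction v using T.induction with
    | h0 => simp
    | h1 η ξ =>
      simp only [tensorPairing_tens, T.tens_s, Fintype.sum_prod_type, ← map_sum, ← tmul_sum, hy]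
      simp only [← tmul_bal, ← sum_tmul, hx]
    | h2 v v' hv hv' =>
      simp only [map_add, MulOpposite.op_add, add_smul, Finset.sum_add_distrib, hv, hv']
  · induction w using T'.induction with
    | h0 => simp
    | h1 b a =>
      simp only [tensorPairing_tens, T'.tens_t, Fintype.sum_prod_type, ← h₂.left_s, ← map_sum,
        ← sum_tmul, hg]
      simp only [tmul_bal, ← tmul_sum, hf]
    | h2 v v' hv hv' =>
      simp only [map_add, LinearMap.add_apply, t_add, MulOpposite.op_add, add_smul,
        Finset.sum_add_distrib, hv, hv']

end TensorPairing
end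

/-! ### Unit pairing and the right dual functor. -/

section

variable {k : Type*} {A : Type u} {R Ω : Type*} [Field k] [Ring A] [Algebra k A]
  [Ring R] [Algebra k R] [Ring Ω] [Algebra k Ω]
  {G : RightBialgebroid k A Ω} {H : RightBialgebroid k A R}

/-! ### The pairing of unit objects -/

section UnitPairing

variable (P : DualPairing G H) [MonoidalCategory (RRFGP H)] [MonoidalCategory (LRFGP G)]
  (T : RRDiagonal H) (T' : LRDiagonal G)

theorem RRDiagonal.unit_s (T : RRDiagonal H) (a b : A) :
    T.unit a <• H.s b = T.unit (a * b) := by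
  rw [T.unit_act, H.ε_mul_s, ← one_mul (H.s a), H.ε_mul_s, H.ε_one, one_mul]

theorem RRDiagonal.unit_t (T : RRDiagonal H) (a b : A) :
    T.unit a <• H.t b = T.unit (b * a) := by
  rw [T.unit_act, H.ε_mul_t, ← one_mul (H.s a), H.ε_mul_s, H.ε_one, one_mul]

theorem LRDiagonal.unit_s (T : LRDiagonal G) (a b : A) :
    T.unit a <• G.s b = T.unit (a * b) := by
  rw [T.unit_act, G.ε_mul_s, ← one_mul (G.s a), G.ε_mul_s, G.ε_one, one_mul]

theorem LRDiagonal.unit_t (T : LRDiagonal G) (a b : A) :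
    T.unit a <• G.t b = T.unit (b * a) := by
  rw [T.unit_act, G.ε_mul_t, ← one_mul (G.s a), G.ε_mul_s, G.ε_one, one_mul]

/-- The pairing `(a, b) = a * b` of unit objects. -/
noncomputable def unitPairing : (𝟙_ (LRFGP G)).El →ₗ[k] (𝟙_ (RRFGP H)).El →ₗ[k] A :=
  (LinearMap.mul k A).compl₁₂ T'.unit.symm.toLinearMap T.unit.symm.toLinearMap

theorem unitPairing_unit (a b : A) : unitPairing T T' (T'.unit a) (T.unit b) = a * b := by
  simp [unitPairing]

/-- The action and coaction formulas reduce to `(α | 1) = ε(α)` and `(1 | X) = ε(X)`. -/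
theorem unitPairing_isYDPairing :
    IsYDPairing P (𝟙_ (LRFGP G)).obj (𝟙_ (RRFGP H)).obj (unitPairing T T') := by
  have right_s (w v) (c : A) : unitPairing T T' w (v <• H.s c) = unitPairing T T' w v * c := by
    obtain ⟨a, rfl⟩ := T'.unit.surjective w
    obtain ⟨b, rfl⟩ := T.unit.surjective v
    rw [T.unit_s, unitPairing_unit, unitPairing_unit, mul_assoc]
  have left_t (w v) (c : A) : unitPairing T T' (w <• G.t c) v = c * unitPairing T T' w v := by
    obtain ⟨a, rfl⟩ := T'.unit.surjective w
    obtain ⟨b, rfl⟩ := T.unit.surjective v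
    rw [T'.unit_t, unitPairing_unit, unitPairing_unit, mul_assoc]
  refine .of (fun w v c => ?_) left_t right_s (fun w α v => ?_) (fun w v X => ?_)
  all_goals
    obtain ⟨a, rfl⟩ := T'.unit.surjective w
    obtain ⟨b, rfl⟩ := T.unit.surjective v
  · rw [T'.unit_s, T.unit_t, unitPairing_unit, unitPairing_unit, mul_assoc]
  · rw [T.unit_coact, sw_tmul (isBal_act P right_s _ α), T'.unit_act, unitPairing_unit,
      unitPairing_unit, mul_one, H.s_comm_t, ← P.pair_s_mul, ← one_mul (H.s b),
      P.pair_mul_right_s, P.pair_one]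
  · rw [T'.unit_coact, sw_tmul (isBal_test P left_t _ X), T.unit_act, unitPairing_unit,
      unitPairing_unit, one_mul, ← mul_one (G.t a), P.pair_t_mul, P.one_pair, H.ε_mul_t]

theorem unitPairing_isPerfect :
    IsPerfect G.toSourceTarget H.toSourceTarget (unitPairing T T') := by
  refine ⟨1, fun _ => T.unit 1, fun _ => T'.unit 1, fun v => ?_, fun w => ?_⟩
  · obtain ⟨b, rfl⟩ := T.unit.surjective v
    simp [unitPairing_unit, T.unit_s]
  · obtain ⟨a, rfl⟩ := T'.unit.surjective w
    simp [unitPairing_unit, T'.unit_t]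

end UnitPairing

/-! ### Perfect pairings of Yetter-Drinfeld modules -/

theorem RRFGP.app_comp {M N L : RRFGP H} (f : M ⟶ N) (g : N ⟶ L) (m : M.El) :
    app (f ≫ g) m = app g (app f m) := rfl

theorem RRFGP.app_id (M : RRFGP H) (m : M.El) : app (𝟙 M) m = m := rfl

theorem RRFGP.hom_ext {M N : RRFGP H} {f g : M ⟶ N} (h : ∀ m, app f m = app g m) : f = g :=
  ObjectProperty.hom_ext _ (YDRR.hom_ext h)

theorem LRFGP.app_comp {M N L : LRFGP G} (f : M ⟶ N) (g : N ⟶ L) (m : M.El) :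
    app (f ≫ g) m = app g (app f m) := rfl

theorem LRFGP.hom_ext {M N : LRFGP G} {f g : M ⟶ N} (h : ∀ m, app f m = app g m) : f = g :=
  ObjectProperty.hom_ext _ (YDLR.hom_ext h)

/-- A perfect dual pairing of Yetter-Drinfeld modules. -/
structure PerfectPairing (P : DualPairing G H) (S : LRFGP G) (L : RRFGP H) where
  ev : S.El →ₗ[k] L.El →ₗ[k] A
  isYD : IsYDPairing P S.obj L.obj ev
  isPerfect : IsPerfect G.toSourceTarget H.toSourceTarget ev

namespace PerfectPairing

variable {P : DualPairing G H} (hP : IsPerfect G.toSourceTarget H.toSourceTarget P.pair)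
  {S S' S₁ S₂ : LRFGP G} {L L' L₁ L₂ : RRFGP H}

theorem hom_ext (q : PerfectPairing P S L) {φ ψ : S' ⟶ S}
    (h : ∀ f η, q.ev (LRFGP.app φ f) η = q.ev (LRFGP.app ψ f) η) : φ = ψ :=
  LRFGP.hom_ext fun f => q.isPerfect.left_ext (h f)

section

variable (q : PerfectPairing P S L) (q' : PerfectPairing P S' L')

include hP in
theorem exists_dualMap (g : L ⟶ L') :
    ∃ φ : S' ⟶ S, ∀ f η, q.ev (LRFGP.app φ f) η = q'.ev f (RRFGP.app g η) := by
  obtain ⟨φ, hφ⟩ := q.isYD.exists_dualHom q'.isYD hP q.isPerfect g.hom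
  exact ⟨ObjectProperty.homMk φ, hφ⟩

include hP in
theorem exists_predualMap (φ : S' ⟶ S) :
    ∃ g : L ⟶ L', ∀ f η, q.ev (LRFGP.app φ f) η = q'.ev f (RRFGP.app g η) := by
  obtain ⟨g, hg⟩ := q.isYD.exists_predualHom q'.isYD hP q'.isPerfect φ.hom
  exact ⟨ObjectProperty.homMk g, hg⟩

/-- The dual of a morphism. -/
noncomputable def dualMap (g : L ⟶ L') : S' ⟶ S := (q.exists_dualMap hP q' g).choose

theorem ev_dualMap (g : L ⟶ L') (f : S'.El) (η : L.El) :
    q.ev (LRFGP.app (q.dualMap hP q' g) f) η = q'.ev f (RRFGP.app g η) :=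
  (q.exists_dualMap hP q' g).choose_spec f η

end

/-- Left-right modules in perfect duality with the same right-right module are isomorphic. -/
noncomputable def dualIso (q : PerfectPairing P S L) (q' : PerfectPairing P S' L) : S' ≅ S where
  hom := q.dualMap hP q' (𝟙 L)
  inv := q'.dualMap hP q (𝟙 L)
  hom_inv_id := q'.hom_ext fun f η => by
    rw [LRFGP.app_comp, ev_dualMap, ev_dualMap]
    rfl
  inv_hom_id := q.hom_ext fun f η => by
    rw [LRFGP.app_comp, ev_dualMap, ev_dualMap]
    rfl

theorem ev_dualIso_hom (q : PerfectPairing P S L) (q' : PerfectPairing P S' L) (f : S'.El)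
    (η : L.El) : q.ev (LRFGP.app (q.dualIso hP q').hom f) η = q'.ev f η :=
  q.ev_dualMap hP q' (𝟙 L) f η

variable [MonoidalCategory (RRFGP H)] [MonoidalCategory (LRFGP G)] (T : RRDiagonal H)
  (T' : LRDiagonal G)

/-- The tensor product of perfect pairings. -/
noncomputable def tensor (q₁ : PerfectPairing P S₁ L₁) (q₂ : PerfectPairing P S₂ L₂) :
    PerfectPairing P (S₂ ⊗ S₁) (L₁ ⊗ L₂) where
  ev := tensorPairing q₁.isYD q₂.isYD T T'
  isYD := tensorPairing_isYDPairing q₁.isYD q₂.isYD T T'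
  isPerfect := tensorPairing_isPerfect q₁.isYD q₂.isYD T T' q₁.isPerfect q₂.isPerfect

theorem tensor_ev (q₁ : PerfectPairing P S₁ L₁) (q₂ : PerfectPairing P S₂ L₂) (f : S₁.El)
    (g : S₂.El) (η : L₁.El) (ξ : L₂.El) :
    (tensor T T' q₁ q₂).ev (T'.tens S₂ S₁ (G.tmul g f)) (T.tens L₁ L₂ (H.tmul η ξ)) =
      q₂.ev g (ξ <• H.t (q₁.ev f η)) := tensorPairing_tens q₁.isYD q₂.isYD T T' f g η ξ

variable (P) in
/-- The perfect pairing of unit objects. -/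
noncomputable def unit : PerfectPairing P (𝟙_ (LRFGP G)) (𝟙_ (RRFGP H)) where
  ev := unitPairing T T'
  isYD := unitPairing_isYDPairing P T T'
  isPerfect := unitPairing_isPerfect T T'

theorem unit_ev (a b : A) : (unit P T T').ev (T'.unit a) (T.unit b) = a * b :=
  unitPairing_unit T T' a b

end PerfectPairing

/-! ### The right dual functor -/

section DualFunctor

variable {P : DualPairing G H} (hP : IsPerfect G.toSourceTarget H.toSourceTarget P.pair)

include hP in
theorem exists_perfectPairing (L : RRFGP H) : ∃ S : LRFGP G, Nonempty (PerfectPairing P S L) := by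
  obtain ⟨S, q, h, h'⟩ := P.exists_dual L.obj hP L.property
  exact ⟨⟨S, h'.leftFGP h.left_t⟩, ⟨q, h, h'⟩⟩

include hP in
theorem exists_perfectPairing' (S : LRFGP G) : ∃ L : RRFGP H, Nonempty (PerfectPairing P S L) := by
  obtain ⟨L, q, h, h'⟩ := P.exists_predual S.obj hP S.property
  exact ⟨⟨L, h'.rightFGP h.right_s⟩, ⟨q, h, h'⟩⟩

/-- The right dual. -/
noncomputable def rightDual (L : RRFGP H) : LRFGP G := (exists_perfectPairing hP L).choose

/-- The evaluation pairing of the right dual. -/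
noncomputable def rightDualPairing (L : RRFGP H) : PerfectPairing P (rightDual hP L) L :=
  (exists_perfectPairing hP L).choose_spec.some

/-- The right dual functor. -/
noncomputable def rightDualFunctor : (RRFGP H)ᵒᵖ ⥤ LRFGP G where
  obj L := rightDual hP L.unop
  map {L L'} g := (rightDualPairing hP L'.unop).dualMap hP (rightDualPairing hP L.unop) g.unop
  map_id L := (rightDualPairing hP L.unop).hom_ext fun f η => by
    rw [PerfectPairing.ev_dualMap]
    rfl
  map_comp {L L' L''} g g' := (rightDualPairing hP L''.unop).hom_ext fun f η => by
    rw [PerfectPairing.ev_dualMap, LRFGP.app_comp, PerfectPairing.ev_dualMap,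
      PerfectPairing.ev_dualMap]
    rfl

/-- The evaluation pairing on the values of the right dual functor. -/
noncomputable def evPairing (L : (RRFGP H)ᵒᵖ) :
    PerfectPairing P ((rightDualFunctor hP).obj L) L.unop :=
  rightDualPairing hP L.unop

theorem ev_rightDualFunctor_map {L L' : (RRFGP H)ᵒᵖ} (g : L ⟶ L')
    (f : ((rightDualFunctor hP).obj L).El) (η : L'.unop.El) :
    (evPairing hP L').ev (LRFGP.app ((rightDualFunctor hP).map g) f) η =
      (evPairing hP L).ev f (RRFGP.app g.unop η) :=
  PerfectPairing.ev_dualMap hP (rightDualPairing hP L'.unop) (rightDualPairing hP L.unop) g.unop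
    f η

/-- The defining data of the right dual functor. -/
noncomputable def rightDualFunctorData : RightDualFunctor P (rightDualFunctor hP) where
  ev L := (evPairing hP (op L)).ev
  isPairing L := (evPairing hP (op L)).isYD
  dual L φ hφ := (evPairing hP (op L)).isPerfect.existsUnique (evPairing hP (op L)).isYD.left_t φ hφ
  map g f η := ev_rightDualFunctor_map hP g.op f η

/-- Functionals separate the points of a finitely generated projective module, so a morphism is
determined by its dual. -/
instance : (rightDualFunctor hP).Faithful where
  map_injective {L L'} g g' h := by
    refine Quiver.Hom.unop_inj (RRFGP.hom_ext fun η => ?_)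
    refine (evPairing hP L).isPerfect.right_ext fun f => ?_
    rw [← ev_rightDualFunctor_map, ← ev_rightDualFunctor_map, h]

/-- Every morphism between duals has a predual, by duality for the coopposite pairing. -/
instance : (rightDualFunctor hP).Full where
  map_surjective {L L'} φ := by
    obtain ⟨g, hg⟩ := (evPairing hP L').exists_predualMap hP (evPairing hP L) φ
    refine ⟨g.op, (evPairing hP L').hom_ext fun f η => ?_⟩
    rw [ev_rightDualFunctor_map, hg]
    rfl

/-- Each `S` is in perfect duality with some `L`, and modules in perfect duality with the same `L`
are isomorphic. -/
instance : (rightDualFunctor hP).EssSurj where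
  mem_essImage S := by
    obtain ⟨L, ⟨q⟩⟩ := exists_perfectPairing' hP S
    exact ⟨op L, ⟨q.dualIso hP (evPairing hP (op L))⟩⟩

instance : (rightDualFunctor hP).IsEquivalence where

end DualFunctor

end

/-! ### The anti-monoidal structure and its compatibility with the pre-braidings. -/

section

variable {k : Type*} {A : Type u} {R Ω : Type*} [Field k] [Ring A] [Algebra k A]
  [Ring R] [Algebra k R] [Ring Ω] [Algebra k Ω]
  {G : RightBialgebroid k A Ω} {H : RightBialgebroid k A R}
  {P : DualPairing G H} (hP : IsPerfect G.toSourceTarget H.toSourceTarget P.pair)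
  [MonoidalCategory (RRFGP H)] [MonoidalCategory (LRFGP G)] (T : RRDiagonal H) (T' : LRDiagonal G)

theorem LRDiagonal.tensor_hom_ext (T' : LRDiagonal G) {M N S : LRFGP G} {φ ψ : M ⊗ N ⟶ S}
    (h : ∀ m n, LRFGP.app φ (T'.tens M N (G.tmul m n)) =
      LRFGP.app ψ (T'.tens M N (G.tmul m n))) : φ = ψ := by
  refine LRFGP.hom_ext fun w => ?_
  induction w using T'.induction with
  | h0 => rw [map_zero, map_zero]
  | h1 m n => exact h m n
  | h2 w w' hw hw' => rw [map_add, map_add, hw, hw']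

theorem LRDiagonal.tensor_hom_ext₃ (T' : LRDiagonal G) {M N L S : LRFGP G}
    {φ ψ : (M ⊗ N) ⊗ L ⟶ S}
    (h : ∀ m n l, LRFGP.app φ (T'.tens (M ⊗ N) L (G.tmul (T'.tens M N (G.tmul m n)) l)) =
      LRFGP.app ψ (T'.tens (M ⊗ N) L (G.tmul (T'.tens M N (G.tmul m n)) l))) : φ = ψ := by
  refine T'.tensor_hom_ext fun w l => ?_
  induction w using T'.induction with
  | h0 => rw [zero_tmul, map_zero, map_zero, map_zero]
  | h1 m n => exact h m n l
  | h2 w w' hw hw' => rw [add_tmul, map_add, map_add, map_add, hw, hw']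

theorem RRDiagonal.ext (T : RRDiagonal H) {M N : RRFGP H} {φ ψ : (M ⊗ N : RRFGP H).El →ₗ[k] A}
    (h : ∀ m n, φ (T.tens M N (H.tmul m n)) = ψ (T.tens M N (H.tmul m n))) : φ = ψ := by
  refine LinearMap.ext fun w => ?_
  induction w using T.induction with
  | h0 => rw [map_zero, map_zero]
  | h1 m n => exact h m n
  | h2 w w' hw hw' => rw [map_add, map_add, hw, hw']

theorem RRDiagonal.ext₃ (T : RRDiagonal H) {M N L : RRFGP H}
    {φ ψ : ((M ⊗ N) ⊗ L : RRFGP H).El →ₗ[k] A}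
    (h : ∀ m n l, φ (T.tens (M ⊗ N) L (H.tmul (T.tens M N (H.tmul m n)) l)) =
      ψ (T.tens (M ⊗ N) L (H.tmul (T.tens M N (H.tmul m n)) l))) : φ = ψ := by
  refine T.ext fun w l => ?_
  induction w using T.induction with
  | h0 => rw [zero_tmul, map_zero, map_zero, map_zero]
  | h1 m n => exact h m n l
  | h2 w w' hw hw' => rw [add_tmul, map_add, map_add, map_add, hw, hw']

theorem LRDiagonal.whiskerRight_tens {M M' : LRFGP G} (φ : M ⟶ M') (N : LRFGP G) (m : M.El)
    (n : N.El) : LRFGP.app (φ ▷ N) (T'.tens M N (G.tmul m n)) =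
      T'.tens M' N (G.tmul (LRFGP.app φ m) n) := by
  rw [← tensorHom_id, T'.hom_tens]
  rfl

theorem LRDiagonal.whiskerLeft_tens (M : LRFGP G) {N N' : LRFGP G} (φ : N ⟶ N') (m : M.El)
    (n : N.El) : LRFGP.app (M ◁ φ) (T'.tens M N (G.tmul m n)) =
      T'.tens M N' (G.tmul m (LRFGP.app φ n)) := by
  rw [← id_tensorHom, T'.hom_tens]
  rfl

theorem RRDiagonal.leftUnitor_inv (M : RRFGP H) (m : M.El) :
    RRFGP.app (λ_ M).inv m = T.tens (𝟙_ _) M (H.tmul (T.unit 1) m) := by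
  have : m = RRFGP.app (λ_ M).hom (T.tens (𝟙_ _) M (H.tmul (T.unit 1) m)) := by
    rw [T.left_unit, H.t_one, MulOpposite.op_one, one_smul]
  conv_lhs => rw [this]
  rw [← RRFGP.app_comp, Iso.hom_inv_id, RRFGP.app_id]

theorem RRDiagonal.rightUnitor_inv (M : RRFGP H) (m : M.El) :
    RRFGP.app (ρ_ M).inv m = T.tens M (𝟙_ _) (H.tmul m (T.unit 1)) := by
  have : m = RRFGP.app (ρ_ M).hom (T.tens M (𝟙_ _) (H.tmul m (T.unit 1))) := by
    rw [T.right_unit, map_one, MulOpposite.op_one, one_smul]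
  conv_lhs => rw [this]
  rw [← RRFGP.app_comp, Iso.hom_inv_id, RRFGP.app_id]

/-- The structure isomorphism `L₂^∨ ⊗ L₁^∨ ≅ (L₁ ⊗ L₂)^∨`. -/
noncomputable def dualTensorIso (L₁ L₂ : RRFGP H) :
    (rightDualFunctor hP).obj (op L₂) ⊗ (rightDualFunctor hP).obj (op L₁) ≅
      (rightDualFunctor hP).obj (op (L₁ ⊗ L₂)) :=
  (evPairing hP (op (L₁ ⊗ L₂))).dualIso hP
    ((evPairing hP (op L₁)).tensor T T' (evPairing hP (op L₂)))

theorem ev_dualTensorIso (L₁ L₂ : RRFGP H) (f : ((rightDualFunctor hP).obj (op L₂)).El)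
    (g : ((rightDualFunctor hP).obj (op L₁)).El) (η : L₁.El) (ξ : L₂.El) :
    (evPairing hP (op (L₁ ⊗ L₂))).ev (LRFGP.app (dualTensorIso hP T T' L₁ L₂).hom
      (T'.tens _ _ (G.tmul f g))) (T.tens L₁ L₂ (H.tmul η ξ)) =
      (evPairing hP (op L₂)).ev f (ξ <• H.t ((evPairing hP (op L₁)).ev g η)) :=
  (PerfectPairing.ev_dualIso_hom hP _ _ _ _).trans (PerfectPairing.tensor_ev T T' _ _ _ _ _ _)

/-- The structure isomorphism `𝟙 ≅ 𝟙^∨`. -/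
noncomputable def dualUnitIso : 𝟙_ (LRFGP G) ≅ (rightDualFunctor hP).obj (op (𝟙_ (RRFGP H))) :=
  (evPairing hP (op (𝟙_ (RRFGP H)))).dualIso hP (PerfectPairing.unit P T T')

theorem ev_dualUnitIso (a b : A) : (evPairing hP (op (𝟙_ (RRFGP H)))).ev
    (LRFGP.app (dualUnitIso hP T T').hom (T'.unit a)) (T.unit b) = a * b :=
  (PerfectPairing.ev_dualIso_hom hP _ _ _ _).trans (PerfectPairing.unit_ev T T' _ _)

/-- A map out of a tensor product of duals is determined by its evaluations. -/
theorem dual_ext {M N : LRFGP G} {L₁ L₂ : RRFGP H}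
    {φ ψ : M ⊗ N ⟶ (rightDualFunctor hP).obj (op (L₁ ⊗ L₂))}
    (h : ∀ m n η ξ, (evPairing hP (op (L₁ ⊗ L₂))).ev (LRFGP.app φ (T'.tens _ _ (G.tmul m n)))
        (T.tens _ _ (H.tmul η ξ)) =
      (evPairing hP (op (L₁ ⊗ L₂))).ev (LRFGP.app ψ (T'.tens _ _ (G.tmul m n)))
        (T.tens _ _ (H.tmul η ξ))) : φ = ψ :=
  T'.tensor_hom_ext fun m n => (evPairing hP (op (L₁ ⊗ L₂))).isPerfect.left_ext fun v =>
    LinearMap.congr_fun (T.ext fun η ξ => h m n η ξ) v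

theorem dualTensorIso_natural {L₁ L₂ L₁' L₂' : RRFGP H} (g₁ : L₁ ⟶ L₁') (g₂ : L₂ ⟶ L₂') :
    ((rightDualFunctor hP).map g₂.op ⊗ₘ (rightDualFunctor hP).map g₁.op) ≫
      (dualTensorIso hP T T' L₁ L₂).hom =
    (dualTensorIso hP T T' L₁' L₂').hom ≫ (rightDualFunctor hP).map (g₁ ⊗ₘ g₂).op := by
  refine dual_ext hP T T' fun f g η ξ => ?_
  rw [LRFGP.app_comp, LRFGP.app_comp, T'.hom_tens, ev_dualTensorIso]
  refine Eq.trans ?_ (ev_rightDualFunctor_map hP (g₁ ⊗ₘ g₂).op _ _).symm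
  rw [Quiver.Hom.unop_op, T.hom_tens]
  refine Eq.trans ?_ (ev_dualTensorIso hP T T' _ _ _ _ _ _).symm
  rw [ev_rightDualFunctor_map, ev_rightDualFunctor_map, map_smul]
  rfl

/-- Both composites send `f ⊗ g ⊗ h` to the functional whose value on `ζ ⊗ ξ ⊗ η` is `(f, η ◁ t(g, ξ
◁ t(h, ζ)))`. -/
theorem dualTensorIso_assoc (L₁ L₂ L₃ : RRFGP H) :
    (dualTensorIso hP T T' L₂ L₁).hom ▷ (rightDualFunctor hP).obj (op L₃) ≫
      (dualTensorIso hP T T' L₃ (L₂ ⊗ L₁)).hom ≫ (rightDualFunctor hP).map (α_ L₃ L₂ L₁).hom.op =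
    (α_ _ _ _).hom ≫ (rightDualFunctor hP).obj (op L₁) ◁ (dualTensorIso hP T T' L₃ L₂).hom ≫
      (dualTensorIso hP T T' (L₃ ⊗ L₂) L₁).hom := by
  refine T'.tensor_hom_ext₃ fun f g h => (evPairing hP _).isPerfect.left_ext fun v =>
    LinearMap.congr_fun (T.ext₃ fun ζ ξ η => ?_) v
  simp only [LRFGP.app_comp]
  rw [T'.assoc, T'.whiskerRight_tens, T'.whiskerLeft_tens, ev_dualTensorIso]
  refine (ev_rightDualFunctor_map hP (α_ L₃ L₂ L₁).hom.op _ _).trans ?_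
  rw [Quiver.Hom.unop_op, T.assoc]
  refine (ev_dualTensorIso hP T T' _ _ _ _ _ _).trans ?_
  rw [T.tens_t, ev_dualTensorIso, ev_dualTensorIso]

theorem dualTensorIso_leftUnitor (L : RRFGP H) :
    (dualUnitIso hP T T').hom ▷ (rightDualFunctor hP).obj (op L) ≫
      (dualTensorIso hP T T' L (𝟙_ _)).hom ≫ (rightDualFunctor hP).map (ρ_ L).inv.op =
      (λ_ ((rightDualFunctor hP).obj (op L))).hom := by
  refine T'.tensor_hom_ext fun w f => (evPairing hP (op L)).isPerfect.left_ext fun η => ?_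
  obtain ⟨a, rfl⟩ := T'.unit.surjective w
  simp only [LRFGP.app_comp]
  rw [T'.left_unit, T'.whiskerRight_tens, (evPairing hP (op L)).isYD.left_t]
  refine (ev_rightDualFunctor_map hP (ρ_ L).inv.op _ _).trans ?_
  rw [Quiver.Hom.unop_op, T.rightUnitor_inv]
  refine (ev_dualTensorIso hP T T' _ _ _ _ _ _).trans ?_
  rw [T.unit_t, ev_dualUnitIso, mul_one]

theorem dualTensorIso_rightUnitor (L : RRFGP H) :
    (rightDualFunctor hP).obj (op L) ◁ (dualUnitIso hP T T').hom ≫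
      (dualTensorIso hP T T' (𝟙_ _) L).hom ≫ (rightDualFunctor hP).map (λ_ L).inv.op =
      (ρ_ ((rightDualFunctor hP).obj (op L))).hom := by
  refine T'.tensor_hom_ext fun f w => (evPairing hP (op L)).isPerfect.left_ext fun η => ?_
  obtain ⟨a, rfl⟩ := T'.unit.surjective w
  simp only [LRFGP.app_comp]
  rw [T'.right_unit, T'.whiskerLeft_tens, (evPairing hP (op L)).isYD.left_s]
  refine (ev_rightDualFunctor_map hP (λ_ L).inv.op _ _).trans ?_
  rw [Quiver.Hom.unop_op, T.leftUnitor_inv]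
  refine (ev_dualTensorIso hP T T' _ _ _ _ _ _).trans ?_
  rw [ev_dualUnitIso, mul_one]

/-- The right dual functor is anti-monoidal. -/
noncomputable def rightDualCoreMonoidal : (revFunctor (rightDualFunctor hP)).CoreMonoidal where
  εIso := dualUnitIso hP T T'
  μIso X Y := dualTensorIso hP T T' Y.unmop.unop X.unmop.unop
  μIso_hom_natural_left {X Y} f Z := by
    have := dualTensorIso_natural hP T T' (𝟙 Z.unmop.unop) f.unmop.unop
    rw [op_id, CategoryTheory.Functor.map_id, tensorHom_id, id_tensorHom] at this
    exact this
  μIso_hom_natural_right {X Y} Z f := by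
    have := dualTensorIso_natural hP T T' f.unmop.unop (𝟙 Z.unmop.unop)
    rw [op_id, CategoryTheory.Functor.map_id, tensorHom_id, id_tensorHom] at this
    exact this
  associativity X Y Z := dualTensorIso_assoc hP T T' X.unmop.unop Y.unmop.unop Z.unmop.unop
  -- Reversal of the tensor product makes the right unitor of the right-right category the left one
  -- of the source.
  left_unitality X := (dualTensorIso_leftUnitor hP T T' X.unmop.unop).symm
  right_unitality X := (dualTensorIso_rightUnitor hP T T' X.unmop.unop).symm

/-- At `η ⊗ ξ` the right side is `(f, η ◁ (ξ₁ t(g, ξ₀)))` and the left side is `(f₋₁ | s(f₀, η) ξ₁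
t(g, ξ₀))`; these agree by the formula that defines the coaction on the dual of `Y`. -/
theorem dualTensorIso_braid (σ : PreBraiding (RRFGP H)) (σ' : PreBraiding (LRFGP G))
    (hσ : ∀ (L₁ L₂ : RRFGP H) (η₁ : L₁.El) (η₂ : L₂.El) (n : ℕ) (x : Fin n → L₂.El)
      (z : Fin n → R), L₂.obj.δ η₂ = ∑ i, H.tmul (x i) (z i) →
      RRFGP.app (σ.braid L₁ L₂) (T.tens L₁ L₂ (H.tmul η₁ η₂)) =
        ∑ i, T.tens L₂ L₁ (H.tmul (x i) (η₁ <• z i)))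
    (hσ' : ∀ (T₁ T₂ : LRFGP G) (f : T₁.El) (g : T₂.El) (n : ℕ) (ω : Fin n → Ω)
      (x : Fin n → T₁.El), T₁.obj.δ f = ∑ i, G.tmul (ω i) (x i) →
      LRFGP.app (σ'.braid T₁ T₂) (T'.tens T₁ T₂ (G.tmul f g)) =
        ∑ i, T'.tens T₂ T₁ (G.tmul (g <• ω i) (x i))) (X Y : RRFGP H) :
    σ'.braid ((rightDualFunctor hP).obj (op Y)) ((rightDualFunctor hP).obj (op X)) ≫
      (dualTensorIso hP T T' Y X).hom =
    (dualTensorIso hP T T' X Y).hom ≫ (rightDualFunctor hP).map (σ.braid Y X).op := by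
  refine dual_ext hP T T' fun f g η ξ => ?_
  rw [LRFGP.app_comp, LRFGP.app_comp, hσ' _ _ f g _ _ _ (rep_spec _)]
  refine Eq.trans ?_ (ev_rightDualFunctor_map hP (σ.braid Y X).op _ _).symm
  rw [Quiver.Hom.unop_op, hσ _ _ η ξ _ _ _ (rep_spec _)]
  simp only [map_sum, LinearMap.sum_apply]
  refine (Finset.sum_congr rfl fun i _ => ev_dualTensorIso hP T T' _ _ _ _ _ _).trans ?_
  refine Eq.trans ?_ (Finset.sum_congr rfl fun i _ => (ev_dualTensorIso hP T T' _ _ _ _ _ _).symm)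
  have hX := (evPairing hP (op X)).isYD
  have hY := (evPairing hP (op Y)).isYD
  change sw (YDLR.δ _ f) (fun ω y => (evPairing hP (op X)).ev (g <• ω)
      (ξ <• H.t ((evPairing hP (op Y)).ev y η))) =
    sw (X.obj.δ ξ) fun x z => (evPairing hP (op Y)).ev f
      ((η <• z) <• H.t ((evPairing hP (op X)).ev g x))
  have e (ω : Ω) (a : A) := (hX.act g ω (ξ <• H.t a)).trans
    (X.obj.comodule.sw_t (isBal_act P hX.right_s g ω) ξ a)
  simp only [e]
  rw [sw_comm]
  refine sw_congr fun x z => ?_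
  rw [← rsmul_mul, hY.coact]
  simp only [mul_assoc]

end

theorem mainTheorem11 {k : Type*} {A : Type u} {R Ω : Type*} [Field k] [Ring A] [Algebra k A]
    [Ring R] [Algebra k R] [Ring Ω] [Algebra k Ω]
    (H : RightBialgebroid k A R) (G : RightBialgebroid k A Ω)
    (hR : H.RightFGP R) (hΩ : G.LeftFGP Ω)
    (P : DualPairing G H) (hP : P.IdentifiesRightDual ∨ P.IdentifiesLeftDual) :
    -- the two monoidal categories
    ∃ (_ : MonoidalCategory (RRFGP H)) (_ : MonoidalCategory (LRFGP G))
      (T : RRDiagonal H) (T' : LRDiagonal G)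
      -- their pre-braidings
      (σ : PreBraiding (RRFGP H)) (σ' : PreBraiding (LRFGP G))
      -- the right dual functor with its anti-monoidal structure
      (F : (RRFGP H)ᵒᵖ ⥤ LRFGP G) (D : RightDualFunctor P F) (_ : (revFunctor F).Monoidal),
      -- `σ (η₁ ⊗ η₂) = η₂₀ ⊗ η₁ ◁ η₂₁`
      (∀ (L₁ L₂ : RRFGP H) (η₁ : L₁.El) (η₂ : L₂.El) (n : ℕ) (x : Fin n → L₂.El) (z : Fin n → R),
        L₂.obj.δ η₂ = ∑ i, H.tmul (x i) (z i) →
        RRFGP.app (σ.braid L₁ L₂) (T.tens L₁ L₂ (H.tmul η₁ η₂)) =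
          ∑ i, T.tens L₂ L₁ (H.tmul (x i) (η₁ <• z i))) ∧
      -- `σ' (f ⊗ g) = g ◁ f₋₁ ⊗ f₀`
      (∀ (T₁ T₂ : LRFGP G) (f : T₁.El) (g : T₂.El) (n : ℕ) (ω : Fin n → Ω) (x : Fin n → T₁.El),
        T₁.obj.δ f = ∑ i, G.tmul (ω i) (x i) →
        LRFGP.app (σ'.braid T₁ T₂) (T'.tens T₁ T₂ (G.tmul f g)) =
          ∑ i, T'.tens T₂ T₁ (G.tmul (g <• ω i) (x i))) ∧
      -- the structure map `F L₂ ⊗ F L₁ → F (L₁ ⊗ L₂)` is given by the pairing of tensor products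
      (∀ (L₁ L₂ : RRFGP H) (f : (F.obj (op L₂)).El) (g : (F.obj (op L₁)).El)
        (η₁ : L₁.El) (η₂ : L₂.El),
        D.ev (L₁ ⊗ L₂) (LRFGP.app (antiμ F L₁ L₂) (T'.tens _ _ (G.tmul f g)))
            (T.tens L₁ L₂ (H.tmul η₁ η₂)) = D.ev L₂ f (η₂ <• H.t (D.ev L₁ g η₁)) ∧
        D.ev (L₁ ⊗ L₂) (LRFGP.app (antiμ F L₁ L₂) (T'.tens _ _ (G.tmul f g)))
            (T.tens L₁ L₂ (H.tmul η₁ η₂)) = D.ev L₂ (f <• G.s (D.ev L₁ g η₁)) η₂) ∧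
      -- the structure map `A → F A` is the canonical one
      (∀ a b : A, D.ev (𝟙_ (RRFGP H)) (LRFGP.app (antiε F) (T'.unit a)) (T.unit b) = a * b) ∧
      -- the right dual functor intertwines the pre-braidings and is an equivalence
      AntiBraided F σ σ' ∧ F.IsEquivalence := by
  -- From here on only the dual bases of the pairing matter, and the two alternatives in `hP` need
  -- no further distinction.
  have hPP := P.isPerfect hR hΩ hP
  let := RRFGP.monoidalCategory (H := H)
  let := LRFGP.monoidalCategory G
  let := (rightDualCoreMonoidal hPP (RRFGP.diagonal H) (LRFGP.diagonal G)).toMonoidal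
  have hμ (L₁ L₂ : RRFGP H) : antiμ (rightDualFunctor hPP) L₁ L₂ =
    (dualTensorIso hPP (RRFGP.diagonal H) (LRFGP.diagonal G) L₁ L₂).hom := rfl
  have hev (L₁ L₂ : RRFGP H) (f : ((rightDualFunctor hPP).obj (op L₂)).El)
      (g : ((rightDualFunctor hPP).obj (op L₁)).El) (η₁ : L₁.El) (η₂ : L₂.El) :=
    ev_dualTensorIso hPP (RRFGP.diagonal H) (LRFGP.diagonal G) L₁ L₂ f g η₁ η₂
  refine ⟨_, _, RRFGP.diagonal H, LRFGP.diagonal G, RRFGP.preBraiding, LRFGP.preBraiding G,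
    rightDualFunctor hPP, rightDualFunctorData hPP, inferInstance, RRFGP.preBraiding_apply,
    LRFGP.preBraiding_apply G, fun L₁ L₂ f g η₁ η₂ => ⟨hev L₁ L₂ f g η₁ η₂,
      -- The two formulas for `ψ` differ by moving a base element across the evaluation pairing.
      (hev L₁ L₂ f g η₁ η₂).trans ((evPairing hPP (op L₂)).isYD.left_s f η₂ _).symm⟩,
    fun a b => ev_dualUnitIso hPP (RRFGP.diagonal H) (LRFGP.diagonal G) a b,
    fun X Y => ?_, inferInstance⟩
  rw [hμ, hμ]
  exact dualTensorIso_braid hPP (RRFGP.diagonal H) (LRFGP.diagonal G) _ _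
    RRFGP.preBraiding_apply (LRFGP.preBraiding_apply G) X Y
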